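/- Let $M$ be a closed (compact, without boundary) smooth manifold with a smooth foliation $\mathcal F$ of dimension $p$ and codimension $q$, and let $g$ be a bundle-like Riemannian metric on $M$, i.e. one for which every geodesic that is orthogonal to one leaf is orthogonal to all the leaves that it meets. Let $N\mathcal F=T\mathcal F^{\perp}$, identify $T^*\mathcal F$ and $N^*\mathcal F$ with the covectors that vanish on $N\mathcal F$ and on $T\mathcal F$, respectively, and let $\Omega^{u,v}$ be the space of smooth sections of $\Lambda^uN^*\mathcal F\wedge\Lambda^vT^*\mathcal F$, with the $L^2$ inner product $(\alpha,\beta)=\int_M\langle\alpha,\beta\rangle\,\mathrm{vol}_g$. Let $d_{\mathcal F}=d_{0,1}:\Omega^{u,v}\to\Omega^{u,v+1}$ be the component of bidegree $(0,1)$ of the exterior derivative. Assume that $T\mathcal F$ and $N\mathcal F$ are oriented (equivalently, that $M$ and $T\mathcal F$ are oriented), with volume forms $\chi\in\Omega^{0,p}$ and $\nu\in\Omega^{q,0}$. Let $*_{\mathcal F}:\Omega^{u,v}\to\Omega^{u,p-v}$ $(0\le v\le p)$ and $*_\perp:\Omega^{u,v}\to\Omega^{q-u,v}$ $(0\le u\le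 q)$ be the star operators given for $\alpha\in\Lambda^uN^*\mathcal F$ and $\beta\in\Lambda^vT^*\mathcal F$ by $*_{\mathcal F}(\alpha\wedge\beta)=\alpha\wedge *_{\mathcal F}\beta$ and $*_\perp(\alpha\wedge\beta)=(*_\perp\alpha)\wedge\beta$, where $\beta'\wedge *_{\mathcal F}\beta=\langle\beta',\beta\rangle\chi$ for all $\beta'\in\Lambda^vT^*\mathcal F$ and $\alpha'\wedge *_\perp\alpha=\langle\alpha',\alpha\rangle\nu$ for all $\alpha'\in\Lambda^uN^*\mathcal F$. For $\omega\in\Omega^{0,1}$ let $P_\omega=d_{\mathcal F}+\omega\wedge:\Omega^{u,v}\to\Omega^{u,v+1}$. Then $P_\omega$ has a formal adjoint $P_\omega^*:\Omega^{u,v+1}\to\Omega^{u,v}$ for the $L^2$ inner products, and the Laplacian $\Delta^{u,v}_{\mathcal F,\omega}=P_\omega P_\omega^*+P_\omega^*P_\omega$ on $\Omega^{u,v}$ (only $P_\omega^*P_\omega$ if $v=0$) satisfies $$*_{\mathcal F}\,\Delta^{u,v}_{\mathcal F,\omega}=\Delta^{u,p-v}_{\mathcal F,-\omega}\,*_{\mathcal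 F}\quad(0\le v\le p),\qquad *_\perp\,\Delta^{u,v}_{\mathcal F,\omega}=\Delta^{q-u,v}_{\mathcal F,\omega}\,*_\perp\quad(0\le u\le q).$$ In particular the relation $*_\perp\Delta^{u,v}_{\mathcal F,\omega}=\pm\Delta^{q-u,v}_{\mathcal F,\omega}*_\perp$ holds with the sign $+$. -/

import Mathlib

open scoped ContDiff Manifold Topology BigOperators

noncomputable section

namespace FoliatedHodge

/-! ### Multilinear algebra -/

section Multilinear

variable {V V' W : Type*} [AddCommGroup V] [Module ℝ V] [AddCommGroup V'] [Module ℝ V']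
  [AddCommGroup W] [Module ℝ W]

/-- An alternating map in `k + l` arguments, seen as an alternating map in the first `k` arguments
with values in the alternating maps in the last `l` arguments. -/
def splitAlt {k l : ℕ} (f : V [⋀^Fin (k + l)]→ₗ[ℝ] W) :
    V [⋀^Fin k]→ₗ[ℝ] (V [⋀^Fin l]→ₗ[ℝ] W) where
  toFun y :=
    { (MultilinearMap.currySum
        (f.toMultilinearMap.domDomCongr finSumFinEquiv.symm)) y with
      map_eq_zero_of_eq' := by
        intro x i j hij hne
        exact f.map_eq_zero_of_eq _
          (i := finSumFinEquiv (Sum.inr i)) (j := finSumFinEquiv (Sum.inr j))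
          (by simpa using hij) (by simpa using hne) }
  map_update_add' y i a b := by
    ext x
    exact congrArg (fun m => m x) ((MultilinearMap.currySum
      (f.toMultilinearMap.domDomCongr finSumFinEquiv.symm)).map_update_add y i a b)
  map_update_smul' y i c a := by
    ext x
    exact congrArg (fun m => m x) ((MultilinearMap.currySum
      (f.toMultilinearMap.domDomCongr finSumFinEquiv.symm)).map_update_smul y i c a)
  map_eq_zero_of_eq' := by
    intro y i j hij hne
    ext x
    exact f.map_eq_zero_of_eq _
      (i := finSumFinEquiv (Sum.inl i)) (j := finSumFinEquiv (Sum.inl j))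
      (by simpa using hij) (by simpa using hne)

theorem splitAlt_apply {k l : ℕ} (f : V [⋀^Fin (k + l)]→ₗ[ℝ] W) (y : Fin k → V)
    (x : Fin l → V) : splitAlt f y x = f (Fin.append y x) := by
  change f _ = f _
  congr 1
  funext i
  refine Fin.addCases (fun i => ?_) (fun i => ?_) i <;> simp

/-- Pullback of alternating maps along a linear map, as a linear map. -/
def altPullback {k : ℕ} (f : V →ₗ[ℝ] V') :
    (V' [⋀^Fin k]→ₗ[ℝ] W) →ₗ[ℝ] (V [⋀^Fin k]→ₗ[ℝ] W) where
  toFun β := β.compLinearMap f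
  map_add' _ _ := rfl
  map_smul' _ _ := rfl

/-- Pointwise Hodge star on `Λ^k (ℝⁿ)^* ⊗ W`. Here `H` is the inverse of the Gram matrix of the
scalar product on `ℝⁿ` and `vol` the volume form:
`(⋆β)(x₁, …, x_{k'}) = (1/k!) ∑ H^{i₁j₁} ⋯ H^{i_k j_k} β(∂_{i₁}, …, ∂_{i_k}) •
vol(∂_{j₁}, …, ∂_{j_k}, x₁, …, x_{k'})`, which for `W = ℝ` is the solution of
`α ∧ ⋆β = ⟨α, β⟩ vol`. -/
def hodgeStar {n k k' : ℕ} (h : k + k' = n) (H : Matrix (Fin n) (Fin n) ℝ)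
    (vol : (Fin n → ℝ) [⋀^Fin n]→ₗ[ℝ] ℝ) :
    ((Fin n → ℝ) [⋀^Fin k]→ₗ[ℝ] W) →ₗ[ℝ] ((Fin n → ℝ) [⋀^Fin k']→ₗ[ℝ] W) where
  toFun β := ((k.factorial : ℝ)⁻¹) • ∑ i : Fin k → Fin n, ∑ j : Fin k → Fin n,
    (∏ m, H (i m) (j m)) •
      (splitAlt (vol.domDomCongr (finCongr h.symm)) (fun m => Pi.single (j m) 1)).smulRight
        (β (fun m => Pi.single (i m) 1))
  map_add' β β' := by
    simp only [AlternatingMap.add_apply, ← smul_add, ← Finset.sum_add_distrib]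
    congr 1
    refine Finset.sum_congr rfl fun i _ => Finset.sum_congr rfl fun j _ => ?_
    congr 1
    ext x
    simp
  map_smul' c β := by
    simp only [AlternatingMap.smul_apply, RingHom.id_apply, Finset.smul_sum]
    refine Finset.sum_congr rfl fun i _ => Finset.sum_congr rfl fun j _ => ?_
    ext x
    simp only [AlternatingMap.smul_apply, AlternatingMap.smulRight_apply, smul_smul]
    congr 1
    ring

end Multilinear

/-! ### Linear algebra in one tangent space -/

/-- The model space `ℝ^p × ℝ^q` of a foliated chart: plaques are the slices `ℝ^p × {y}`. -/
abbrev Model (p q : ℕ) : Type := (Fin p → ℝ) × (Fin q → ℝ)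

/-- The standard basis of `ℝ^p × ℝ^q`. -/
def stdVec (p q : ℕ) : Fin p ⊕ Fin q → Model p q :=
  Sum.elim (fun i => (Pi.single i 1, 0)) (fun a => (0, Pi.single a 1))

theorem continuous_of_multilinear {p q k : ℕ}
    (f : MultilinearMap ℝ (fun _ : Fin k => Model p q) ℝ) : Continuous f := by
  classical
  let b := (Pi.basisFun ℝ (Fin p)).prod (Pi.basisFun ℝ (Fin q))
  have h : (f : (Fin k → Model p q) → ℝ) = fun w => ∑ I : Fin k → (Fin p ⊕ Fin q),
      (∏ m, b.equivFun (w m) (I m)) • f (fun m => b (I m)) := by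
    funext w
    have hw : w = fun m => ∑ c, b.equivFun (w m) c • b c := by
      funext m
      exact (b.sum_equivFun (w m)).symm
    conv_lhs => rw [hw]
    rw [f.map_sum]
    exact Finset.sum_congr rfl fun I _ => f.map_smul_univ _ _
  rw [h]
  refine continuous_finsetSum _ fun I _ => ?_
  simp only [smul_eq_mul]
  refine Continuous.mul ?_ continuous_const
  refine continuous_finsetProd _ fun m _ => ?_
  have hb : Continuous b.equivFun := b.equivFun.toLinearMap.continuous_of_finiteDimensional
  exact (continuous_apply (I m)).comp (hb.comp (continuous_apply m))

/-- Scalar products on the tangent space `ℝ^p × ℝ^q`. -/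
abbrev Bilin (p q : ℕ) : Type := Model p q →L[ℝ] Model p q →L[ℝ] ℝ

section Pointwise

variable {p q : ℕ} (b : Bilin p q)

/-- Gram matrix of the scalar product on the tangent space `ℝ^p × 0` of the leaf. -/
def leafGram : Matrix (Fin p) (Fin p) ℝ :=
  Matrix.of fun i j => b (Pi.single i 1, 0) (Pi.single j 1, 0)

/-- The identification of `TM / TF = ℝ^q` with the orthogonal complement of the tangent space of
the leaf: `y` is sent to the only vector `(x, y)` that is orthogonal to `ℝ^p × 0`. -/
def normalLift : (Fin q → ℝ) →ₗ[ℝ] Model p q :=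
  LinearMap.prod
    (-((Matrix.mulVecLin (leafGram b)⁻¹) ∘ₗ
      LinearMap.pi (fun i => (b (Pi.single i 1, 0)).toLinearMap ∘ₗ LinearMap.inr ℝ _ _)))
    LinearMap.id

/-- The orthogonal projection to the tangent space `ℝ^p` of the leaf. -/
def leafProj : Model p q →ₗ[ℝ] (Fin p → ℝ) :=
  LinearMap.fst ℝ _ _ - LinearMap.fst ℝ _ _ ∘ₗ normalLift b ∘ₗ LinearMap.snd ℝ _ _

/-- Gram matrix of the scalar product on the normal space, identified with `ℝ^q`. -/
def normalGram : Matrix (Fin q) (Fin q) ℝ :=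
  Matrix.of fun a c => b (normalLift b (Pi.single a 1)) (normalLift b (Pi.single c 1))

/-- `Λ^u N^* ⊗ Λ^v T^*` for the normal space `N = ℝ^q` and the leafwise tangent space
`T = ℝ^p`. -/
abbrev BiAlt (p q u v : ℕ) : Type :=
  (Fin q → ℝ) [⋀^Fin u]→ₗ[ℝ] ((Fin p → ℝ) [⋀^Fin v]→ₗ[ℝ] ℝ)

/-- The embedding `Λ^u N^* ⊗ Λ^v T^* → Λ^{u+v}`, `α ⊗ β ↦ α ∧ β`, where covectors of `N` vanish on
`T` and covectors of `T` vanish on `N`. -/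
def toForm {u v : ℕ} (a : BiAlt p q u v) : Model p q [⋀^Fin (u + v)]→L[ℝ] ℝ :=
  let m : MultilinearMap ℝ (fun _ : Fin (u + v) => Model p q) ℝ :=
    MultilinearMap.domDomCongr finSumFinEquiv
      (MultilinearMap.uncurrySum (N := fun _ : Fin u ⊕ Fin v => Model p q)
        ((AlternatingMap.toMultilinearMapLM (S := ℝ) ∘ₗ
          altPullback (leafProj b)).compMultilinearMap
            (a.compLinearMap (LinearMap.snd ℝ _ _)).toMultilinearMap))
  let f : Model p q [⋀^Fin (u + v)]→ₗ[ℝ] ℝ :=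
    (((u.factorial : ℝ) * (v.factorial : ℝ))⁻¹) • MultilinearMap.alternatization m
  { f with cont := continuous_of_multilinear f.toMultilinearMap }

/-- The component in `Λ^u N^* ⊗ Λ^v T^*` of a form of degree `u + v`: evaluate it on `u` normal
vectors followed by `v` leafwise vectors. -/
def toBi {u v : ℕ} (f : Model p q [⋀^Fin (u + v)]→L[ℝ] ℝ) : BiAlt p q u v :=
  (LinearMap.compAlternatingMap (altPullback (LinearMap.inl ℝ _ _))
    (splitAlt f.toAlternatingMap)).compLinearMap (normalLift b)

/-- The scalar product on `Λ^u N^* ⊗ Λ^v T^*`. -/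
def biInner {u v : ℕ} (a a' : BiAlt p q u v) : ℝ :=
  (((u.factorial : ℝ) * (v.factorial : ℝ))⁻¹) *
    ∑ c : Fin u → Fin q, ∑ c' : Fin u → Fin q, ∑ i : Fin v → Fin p, ∑ i' : Fin v → Fin p,
      (∏ m, (normalGram b)⁻¹ (c m) (c' m)) * (∏ m, (leafGram b)⁻¹ (i m) (i' m)) *
        a (fun m => Pi.single (c m) 1) (fun m => Pi.single (i m) 1) *
        a' (fun m => Pi.single (c' m) 1) (fun m => Pi.single (i' m) 1)

end Pointwise

/-- The exterior product `θ ∧ f` of a 1-form with a `k`-form. -/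
def wedgeOne {p q k : ℕ} (θ : Model p q [⋀^Fin 1]→L[ℝ] ℝ) (f : Model p q [⋀^Fin k]→L[ℝ] ℝ) :
    Model p q [⋀^Fin (k + 1)]→L[ℝ] ℝ :=
  ContinuousAlternatingMap.alternatizeUncurryFin
    (((ContinuousAlternatingMap.ofSubsingleton ℝ (Model p q) ℝ (0 : Fin 1)).symm θ).smulRight f)

/-! ### Foliated manifolds, differential forms, Riemannian metrics -/

/-- The charts of the atlas of `M` form a foliated atlas of dimension `p` and codimension `q`: the
changes of charts are locally of the form `(x, y) ↦ (f(x, y), h(y))`. The smooth structure of `M`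
is the one given by this atlas. At each point the tangent space of the leaf is `ℝ^p × 0`, the
tangent space of `M` at `x` being by definition `ℝ^p × ℝ^q`, read in the preferred chart at `x`. -/
def IsFoliatedAtlas (p q : ℕ) (M : Type*) [TopologicalSpace M] [ChartedSpace (Model p q) M] :
    Prop :=
  ∀ c ∈ atlas (Model p q) M, ∀ c' ∈ atlas (Model p q) M, ∀ z ∈ (c.symm.trans c').source,
    ∃ U ∈ 𝓝 z, ∀ z₁ ∈ U, ∀ z₂ ∈ U, z₁.2 = z₂.2 → (c' (c.symm z₁)).2 = (c' (c.symm z₂)).2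

section Manifold

variable {p q : ℕ} {M : Type*} [TopologicalSpace M] [ChartedSpace (Model p q) M]

/-- Differential `k`-forms on `M`, smooth or not. -/
abbrev FormField (p q : ℕ) (M : Type*) [TopologicalSpace M] [ChartedSpace (Model p q) M]
    (k : ℕ) : Type _ :=
  M → Model p q [⋀^Fin k]→L[ℝ] ℝ

/-- The derivative at `z` of the inverse of a chart, with values in the tangent space of `M`. -/
def chartInvDeriv (c : OpenPartialHomeomorph M (Model p q)) (z : Model p q) :
    Model p q →L[ℝ] Model p q :=
  mfderiv 𝓘(ℝ, Model p q) 𝓘(ℝ, Model p q) c.symm z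

/-- A differential form read in a chart. -/
def chartRep {k : ℕ} (c : OpenPartialHomeomorph M (Model p q)) (α : FormField p q M k)
    (z : Model p q) : Model p q [⋀^Fin k]→L[ℝ] ℝ :=
  (α (c.symm z)).compContinuousLinearMap (chartInvDeriv c z)

/-- Smoothness of a differential form. -/
def IsSmoothForm {k : ℕ} (α : FormField p q M k) : Prop :=
  ∀ c ∈ atlas (Model p q) M, ContDiffOn ℝ ∞ (chartRep c α) c.target

/-- The exterior derivative, computed in the preferred chart at each point. -/
def extD {k : ℕ} (α : FormField p q M k) : FormField p q M (k + 1) := fun x =>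
  (extDeriv (chartRep (chartAt (Model p q) x) α)
    (chartAt (Model p q) x x)).compContinuousLinearMap
      (mfderiv 𝓘(ℝ, Model p q) 𝓘(ℝ, Model p q) (chartAt (Model p q) x) x)

variable [IsManifold 𝓘(ℝ, Model p q) ∞ M]

/-- Smooth Riemannian metrics on `M`. -/
abbrev Metric (p q : ℕ) (M : Type*) [TopologicalSpace M] [ChartedSpace (Model p q) M]
    [IsManifold 𝓘(ℝ, Model p q) ∞ M] : Type _ :=
  Bundle.ContMDiffRiemannianMetric 𝓘(ℝ, Model p q) ∞ (Model p q)
    (fun x : M => TangentSpace 𝓘(ℝ, Model p q) x)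

variable (g : Metric p q M)

/-- The scalar product at a point. -/
def metricAt (x : M) : Bilin p q := g.inner x

/-- The metric read in a chart. -/
def chartMetric (c : OpenPartialHomeomorph M (Model p q)) (z : Model p q) : Bilin p q :=
  (metricAt g (c.symm z)).bilinearComp (chartInvDeriv c z) (chartInvDeriv c z)

/-- Geodesics on the interval `(a, b)`: curves `γ` of class `C²` that satisfy
`G(z'', w) + (D_{z'} G)(z', w) - (1/2) (D_w G)(z', z') = 0` for all constant vectors `w`, where `G`
is the metric and `z` the curve, read in a chart. This is the equation
`z''^k + Γ^k_{ij} z'^i z'^j = 0` with the index `k` lowered; as it does not depend on the chart, one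
chart at each point suffices. -/
def IsGeodesicOn (γ : ℝ → M) (a b : ℝ) : Prop :=
  ContMDiffOn 𝓘(ℝ, ℝ) 𝓘(ℝ, Model p q) 2 γ (Set.Ioo a b) ∧
  ∀ t ∈ Set.Ioo a b, ∃ c ∈ atlas (Model p q) M, γ t ∈ c.source ∧
    ∀ w : Model p q,
      let z : ℝ → Model p q := fun s => c (γ s)
      chartMetric g c (z t) (deriv (deriv z) t) w
        + fderiv ℝ (chartMetric g c) (z t) (deriv z t) (deriv z t) w
        - (1 / 2) * fderiv ℝ (chartMetric g c) (z t) w (deriv z t) (deriv z t) = 0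

/-- The curve `γ` is orthogonal to the leaf through `γ t` at the time `t`. -/
def IsOrthogonalToLeafAt (γ : ℝ → M) (t : ℝ) : Prop :=
  ∀ X : Fin p → ℝ,
    metricAt g (γ t) (mfderiv 𝓘(ℝ, ℝ) 𝓘(ℝ, Model p q) γ t (1 : ℝ)) (X, 0) = 0

/-- Bundle-like metrics: a geodesic that is orthogonal to one leaf is orthogonal to all the leaves
that it meets. -/
def IsBundleLike : Prop :=
  ∀ (γ : ℝ → M) (a b : ℝ), IsGeodesicOn g γ a b →
    (∃ t ∈ Set.Ioo a b, IsOrthogonalToLeafAt g γ t) →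
      ∀ t ∈ Set.Ioo a b, IsOrthogonalToLeafAt g γ t

/-- `Ω^{u,v}(M, F)`: smooth sections of `Λ^u N^*F ∧ Λ^v T^*F`. -/
def IsBiform (u v : ℕ) (α : FormField p q M (u + v)) : Prop :=
  IsSmoothForm α ∧ ∀ x, ∃ a : BiAlt p q u v, α x = toForm (metricAt g x) a

/-- The density of the Riemannian volume in a chart. -/
def volDensity (c : OpenPartialHomeomorph M (Model p q)) (z : Model p q) : ℝ :=
  Real.sqrt (Matrix.det (Matrix.of fun s t : Fin p ⊕ Fin q =>
    chartMetric g c z (stdVec p q s) (stdVec p q t)))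

section Closed

variable [T2Space M] [CompactSpace M]

/-- A smooth partition of unity subordinate to the charts. -/
def chartPartition (p q : ℕ) (M : Type*) [TopologicalSpace M] [ChartedSpace (Model p q) M]
    [IsManifold 𝓘(ℝ, Model p q) ∞ M] [T2Space M] [CompactSpace M] :
    SmoothPartitionOfUnity M 𝓘(ℝ, Model p q) M :=
  Classical.choose
    (SmoothPartitionOfUnity.exists_isSubordinate_chartAt_source 𝓘(ℝ, Model p q) M)

/-- The integral of a function on `M` for the Riemannian volume. -/
def integralVol (f : M → ℝ) : ℝ :=
  ∑ᶠ i : M, ∫ z in (chartAt (Model p q) i).target,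
    chartPartition p q M i ((chartAt (Model p q) i).symm z) *
      f ((chartAt (Model p q) i).symm z) * volDensity g (chartAt (Model p q) i) z

/-- The `L²` scalar product on `Ω^{u,v}`. -/
def l2Inner (u v : ℕ) (α β : FormField p q M (u + v)) : ℝ :=
  integralVol g fun x => biInner (metricAt g x) (u := u) (v := v)
    (toBi (metricAt g x) (α x)) (toBi (metricAt g x) (β x))

/-- The operators `A : Ω^{u,v} → Ω^{u,v+1}` and `B : Ω^{u,v+1} → Ω^{u,v}` are formally adjoint. -/
def IsFormalAdjoint (u v : ℕ) (A : FormField p q M (u + v) → FormField p q M (u + (v + 1)))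
    (B : FormField p q M (u + (v + 1)) → FormField p q M (u + v)) : Prop :=
  (∀ φ, IsBiform g u v φ → IsBiform g u (v + 1) (A φ)) ∧
  (∀ ψ, IsBiform g u (v + 1) ψ → IsBiform g u v (B ψ)) ∧
  ∀ φ ψ, IsBiform g u v φ → IsBiform g u (v + 1) ψ →
    l2Inner g u (v + 1) (A φ) ψ = l2Inner g u v φ (B ψ)

open Classical in
/-- The formal adjoint of an operator `Ω^{u,v} → Ω^{u,v+1}`. It is unique on `Ω^{u,v+1}`; the value
is `0` if there is none. -/
def formalAdjoint (u v : ℕ) (A : FormField p q M (u + v) → FormField p q M (u + (v + 1))) :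
    FormField p q M (u + (v + 1)) → FormField p q M (u + v) :=
  if h : ∃ B, IsFormalAdjoint g u v A B then Classical.choose h else 0

end Closed

/-- The leafwise differential `d_F = d_{0,1}`: the component of bidegree `(u, v + 1)` of the
exterior derivative of a form of bidegree `(u, v)`. -/
def dLeaf (u v : ℕ) (φ : FormField p q M (u + v)) : FormField p q M (u + (v + 1)) := fun x =>
  toForm (metricAt g x) (toBi (u := u) (v := v + 1) (metricAt g x) (extD φ x))

/-- The twisted leafwise differential `P = d_F + η ∧`. -/
def twistedD (η : FormField p q M (0 + 1)) (u v : ℕ) (φ : FormField p q M (u + v)) :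
    FormField p q M (u + (v + 1)) := fun x =>
  dLeaf g u v φ x + wedgeOne (η x) (φ x)

section Closed

variable [T2Space M] [CompactSpace M]

/-- The formal adjoint `P^*` of `P = d_F + η ∧`. -/
def twistedCoD (η : FormField p q M (0 + 1)) (u v : ℕ) :
    FormField p q M (u + (v + 1)) → FormField p q M (u + v) :=
  formalAdjoint g u v (twistedD g η u v)

/-- The twisted leafwise Laplacian `P P^* + P^* P` on `Ω^{u,v}`; for `v = 0` the first term is
absent. -/
def twistedLaplacian (η : FormField p q M (0 + 1)) (u : ℕ) :
    (v : ℕ) → FormField p q M (u + v) → FormField p q M (u + v)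
  | 0, φ => twistedCoD g η u 0 (twistedD g η u 0 φ)
  | v + 1, φ => twistedD g η u v (twistedCoD g η u v φ) +
      twistedCoD g η u (v + 1) (twistedD g η u (v + 1) φ)

end Closed

/-- The leafwise volume form of an orientation of `TF`: a smooth section of `Λ^p T^*F` of length
one. These sections correspond bijectively to the orientations of the bundle `TF`. -/
def IsLeafVolume (χ : FormField p q M (0 + p)) : Prop :=
  IsBiform g 0 p χ ∧ ∀ x, biInner (metricAt g x) (u := 0) (v := p)
    (toBi (metricAt g x) (χ x)) (toBi (metricAt g x) (χ x)) = 1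

/-- The transverse volume form of an orientation of the normal bundle: a smooth section of
`Λ^q N^*F` of length one. -/
def IsTransverseVolume (ν : FormField p q M (q + 0)) : Prop :=
  IsBiform g q 0 ν ∧ ∀ x, biInner (metricAt g x) (u := q) (v := 0)
    (toBi (metricAt g x) (ν x)) (toBi (metricAt g x) (ν x)) = 1

/-- The leafwise star operator `⋆_F : Ω^{u,v} → Ω^{u,p-v}`, `α ∧ β ↦ α ∧ ⋆_F β` for `α` in
`Λ^u N^*F` and `β` in `Λ^v T^*F`. -/
def leafStar (χ : FormField p q M (0 + p)) (u : ℕ) {v v' : ℕ} (hv : v + v' = p)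
    (φ : FormField p q M (u + v)) : FormField p q M (u + v') := fun x =>
  toForm (metricAt g x)
    (LinearMap.compAlternatingMap
      (hodgeStar hv (leafGram (metricAt g x))⁻¹
        (toBi (u := 0) (v := p) (metricAt g x) (χ x) 0))
      (toBi (u := u) (v := v) (metricAt g x) (φ x)))

/-- The transversal star operator `⋆_⊥ : Ω^{u,v} → Ω^{q-u,v}`, `α ∧ β ↦ ⋆_⊥ α ∧ β` for `α` in
`Λ^u N^*F` and `β` in `Λ^v T^*F`. -/
def perpStar (ν : FormField p q M (q + 0)) {u u' : ℕ} (hu : u + u' = q) (v : ℕ)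
    (φ : FormField p q M (u + v)) : FormField p q M (u' + v) := fun x =>
  toForm (metricAt g x)
    (hodgeStar hu (normalGram (metricAt g x))⁻¹
      (LinearMap.compAlternatingMap
        ({ toFun := fun β => β 0, map_add' := fun _ _ => rfl, map_smul' := fun _ _ => rfl } :
          ((Fin p → ℝ) [⋀^Fin 0]→ₗ[ℝ] ℝ) →ₗ[ℝ] ℝ)
        (toBi (u := q) (v := 0) (metricAt g x) (ν x)))
      (toBi (u := u) (v := v) (metricAt g x) (φ x)))

end Manifold

end FoliatedHodge

end

noncomputable section

namespace FoliatedHodge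

/-! ### Scalar products of alternating forms and the Hodge star -/

/-! In a foliated chart a form of bidegree (u, v) vanishes on more than v leafwise vectors. Its
coefficients are therefore the same for the orthogonal splitting and for the product splitting of
ℝ^p × ℝ^q (`VanishesOnLeaf.toBi_eq`). So P_η acts on coefficients as Σ dx_m ∧ (∂_m + η_m), with
derivatives along the plaques only (`coef_twistedD`), and all that matters about the transverse
geometry is how it varies along the leaves.

This is where a bundle-like metric G enters. A geodesic z that starts with velocity n orthogonal to
a leaf stays orthogonal to the leaves, so G(z', (X, 0)) = 0 along it. Differentiating this and
subtracting the geodesic equation tested on (X, 0) leaves (D_X G)(n, n) = 0. Hence the Gram matrix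
of the normal bundle is constant along plaques (`IsBundleLike.fderiv_normalGram`). So are the
coefficient of ν and the quotient of the Riemannian density by the coefficient of χ, since the
squares of both equal the determinant of that matrix.

Consequently ⋆_⊥ has constant coefficients along the leaves and acts on the other tensor factor than
P_η. It commutes with P_η up to (-1)^q: a leafwise covector passes u normal arguments before the
star and q - u after it (`perpStar_twistedD`). As ⋆_⊥ is an isometry, P_η^* obeys the same rule
(`perpStar_twistedCoD`). Each summand of the Laplacian contains P_η and P_η^* once, so the sign
occurs twice and disappears.

For ⋆_F, the scalar product times the coefficient of χ is the exterior pairing ⟨α, β⟩ χ = α ∧ ⋆_F β,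
whose coefficients in a chart are constant along the plaques. The Leibniz rule then gives, up to a
divergence along the plaques, (P_η φ, ψ) = (φ, ε ⋆_F P_{-η} ⋆_F ψ) for some sign ε. The derivative
changes sign by integration by parts while η does not, hence -η (`exists_sum_fderiv_leafFlux`). A
partition of unity makes this global, which yields the existence of the adjoint and the formula
P_η^* = ε ⋆_F P_{-η} ⋆_F (`exists_isFormalAdjoint_leafStar`). Since ⋆_F is an isometry with square
±1, it follows that ⋆_F P_η^* = e P_{-η} ⋆_F and ⋆_F P_η = e P_{-η}^* ⋆_F with one and the same sign
e (`exists_leafStar_twistedD`). So ⋆_F exchanges the two summands of the Laplacian, with factor e² =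
1. In leafwise degrees 0 and p the absent summand corresponds to a term that factors through forms
of leafwise degree p + 1, which are zero.

No sign needs to be computed: each is obtained as a constant with square 1, uniform in the data. The
pointwise facts about the stars are reduced to the standard metric by an orthonormal frame
(`exists_frame`) and the naturality of scalar product and star under pullback. -/

/-- The standard basis vector of `ℝⁿ`. -/
abbrev stdE {n : ℕ} (i : Fin n) : Fin n → ℝ := Pi.single i 1

section Star

variable {n k k' : ℕ}

/-- The scalar product of alternating forms for the inverse Gram matrix `H`. -/
def formInner (H : Matrix (Fin n) (Fin n) ℝ) (α β : (Fin n → ℝ) [⋀^Fin k]→ₗ[ℝ] ℝ) : ℝ :=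
  (k.factorial : ℝ)⁻¹ * ∑ i : Fin k → Fin n, ∑ j : Fin k → Fin n,
    (∏ m, H (i m) (j m)) * α (fun m => stdE (i m)) * β (fun m => stdE (j m))

/-- The positions of the two blocks of arguments. -/
def blockEquiv (h : k + k' = n) : Fin n ≃ Fin k ⊕ Fin k' :=
  (finCongr h.symm).trans finSumFinEquiv.symm

theorem append_eq_elim {k l : ℕ} {X : Type*} (x : Fin k → X) (y : Fin l → X) :
    Fin.append x y = Sum.elim x y ∘ finSumFinEquiv.symm := by
  funext i
  refine Fin.addCases (fun i => ?_) (fun i => ?_) i <;> simp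

theorem splitAlt_blockEquiv {V W : Type*} [AddCommGroup V] [Module ℝ V] [AddCommGroup W]
    [Module ℝ W] (h : k + k' = n) (vol : V [⋀^Fin n]→ₗ[ℝ] W) (x : Fin k → V) (y : Fin k' → V) :
    splitAlt (vol.domDomCongr (finCongr h.symm)) x y = vol (Sum.elim x y ∘ blockEquiv h) := by
  rw [splitAlt_apply, AlternatingMap.domDomCongr_apply, append_eq_elim]
  rfl

/-- Evaluation of alternating maps at given arguments, as a linear map. -/
def altEval {V W ι : Type*} [AddCommGroup V] [Module ℝ V] [AddCommGroup W] [Module ℝ W]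
    (x : ι → V) : (V [⋀^ι]→ₗ[ℝ] W) →ₗ[ℝ] W where
  toFun f := f x
  map_add' _ _ := rfl
  map_smul' _ _ := rfl

theorem altEval_apply {V W ι : Type*} [AddCommGroup V] [Module ℝ V] [AddCommGroup W]
    [Module ℝ W] (x : ι → V) (f : V [⋀^ι]→ₗ[ℝ] W) : altEval x f = f x := rfl

theorem hodgeStar_apply {W : Type*} [AddCommGroup W] [Module ℝ W] (h : k + k' = n)
    (H : Matrix (Fin n) (Fin n) ℝ) (vol : (Fin n → ℝ) [⋀^Fin n]→ₗ[ℝ] ℝ)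
    (β : (Fin n → ℝ) [⋀^Fin k]→ₗ[ℝ] W) (x : Fin k' → Fin n → ℝ) :
    hodgeStar h H vol β x = (k.factorial : ℝ)⁻¹ • ∑ i : Fin k → Fin n, ∑ j : Fin k → Fin n,
      ((∏ m, H (i m) (j m)) * vol (Sum.elim (fun m => stdE (j m)) x ∘ blockEquiv h)) •
        β (fun m => stdE (i m)) := by
  have hev : ∀ (f : (Fin n → ℝ) [⋀^Fin k']→ₗ[ℝ] W), f x = altEval x f := fun _ => rfl
  rw [hev]
  simp only [hodgeStar, LinearMap.coe_mk, AddHom.coe_mk, map_smul, map_sum]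
  simp only [altEval_apply, AlternatingMap.smulRight_apply, splitAlt_blockEquiv h, smul_smul]

theorem hodgeStar_real_apply (h : k + k' = n)
    (H : Matrix (Fin n) (Fin n) ℝ) (vol : (Fin n → ℝ) [⋀^Fin n]→ₗ[ℝ] ℝ)
    (β : (Fin n → ℝ) [⋀^Fin k]→ₗ[ℝ] ℝ) (x : Fin k' → Fin n → ℝ) :
    hodgeStar h H vol β x = (k.factorial : ℝ)⁻¹ * ∑ i : Fin k → Fin n, ∑ j : Fin k → Fin n,
      (∏ m, H (i m) (j m)) * β (fun m => stdE (i m)) *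
        vol (Sum.elim (fun m => stdE (j m)) x ∘ blockEquiv h) := by
  rw [hodgeStar_apply, smul_eq_mul]
  congr 1
  refine Finset.sum_congr rfl fun i _ => Finset.sum_congr rfl fun j _ => ?_
  rw [smul_eq_mul]; ring

/-- Functionals reduce the star on W-valued forms to the real case. This is how the scalar
statements reach the transverse star, where W consists of the leafwise forms. -/
theorem map_hodgeStar {W : Type*} [AddCommGroup W] [Module ℝ W] (h : k + k' = n)
    (H : Matrix (Fin n) (Fin n) ℝ) (vol : (Fin n → ℝ) [⋀^Fin n]→ₗ[ℝ] ℝ)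
    (β : (Fin n → ℝ) [⋀^Fin k]→ₗ[ℝ] W) (l : W →ₗ[ℝ] ℝ) (x : Fin k' → Fin n → ℝ) :
    l (hodgeStar h H vol β x) = hodgeStar h H vol (l.compAlternatingMap β) x := by
  rw [hodgeStar_apply, hodgeStar_apply]
  simp [map_sum]

/-- Expansion of a multilinear map on the columns of a matrix. -/
theorem multilinear_mulVec (A : Matrix (Fin n) (Fin n) ℝ)
    (F : MultilinearMap ℝ (fun _ : Fin k => (Fin n → ℝ)) ℝ) (i : Fin k → Fin n) :
    F (fun m => A.mulVec (stdE (i m))) =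
      ∑ a : Fin k → Fin n, (∏ m, A (a m) (i m)) * F (fun m => stdE (a m)) := by
  classical
  have h : (fun m => A.mulVec (stdE (i m))) = fun m => ∑ a, A a (i m) • (stdE a : Fin n → ℝ) := by
    funext m b
    simp [Finset.sum_apply, Pi.single_apply, Matrix.mulVec_single]
  rw [h, F.map_sum]
  exact Finset.sum_congr rfl fun a _ => F.map_smul_univ _ _

theorem sum_comm_four {ι κ : Type*} [Fintype ι] [Fintype κ] (f : ι → ι → κ → κ → ℝ) :
    ∑ a, ∑ b, ∑ i, ∑ j, f a b i j = ∑ i, ∑ j, ∑ a, ∑ b, f a b i j := by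
  calc ∑ a, ∑ b, ∑ i, ∑ j, f a b i j = ∑ a, ∑ i, ∑ j, ∑ b, f a b i j := by
        refine Finset.sum_congr rfl fun a _ => ?_
        rw [Finset.sum_comm]
        exact Finset.sum_congr rfl fun i _ => Finset.sum_comm
    _ = ∑ i, ∑ j, ∑ a, ∑ b, f a b i j := by
        rw [Finset.sum_comm]
        exact Finset.sum_congr rfl fun i _ => Finset.sum_comm

/-- Expanding both factors on the columns of A and regrouping absorbs A into the contravariant
matrix. This one identity gives the naturality of the scalar product and of the star. -/
theorem sum_contraction_mulVec (A H : Matrix (Fin n) (Fin n) ℝ)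
    (F G : MultilinearMap ℝ (fun _ : Fin k => (Fin n → ℝ)) ℝ) :
    ∑ i : Fin k → Fin n, ∑ j : Fin k → Fin n, (∏ m, H (i m) (j m)) *
        F (fun m => A.mulVec (stdE (i m))) * G (fun m => A.mulVec (stdE (j m))) =
      ∑ i : Fin k → Fin n, ∑ j : Fin k → Fin n, (∏ m, (A * H * A.transpose) (i m) (j m)) *
        F (fun m => stdE (i m)) * G (fun m => stdE (j m)) := by
  classical
  have hprod : ∀ a b : Fin k → Fin n, ∏ m, (A * H * A.transpose) (a m) (b m) =
      ∑ i : Fin k → Fin n, ∑ j : Fin k → Fin n,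
        (∏ m, A (a m) (i m)) * (∏ m, H (i m) (j m)) * ∏ m, A (b m) (j m) := by
    intro a b
    simp only [Matrix.mul_apply, Matrix.transpose_apply, Finset.sum_mul]
    rw [Fintype.prod_sum]
    conv_rhs => rw [Finset.sum_comm]
    refine Finset.sum_congr rfl fun j _ => ?_
    rw [Fintype.prod_sum]
    refine Finset.sum_congr rfl fun i _ => ?_
    simp only [Finset.prod_mul_distrib]
  simp only [multilinear_mulVec, hprod, Finset.sum_mul, Finset.mul_sum]
  rw [sum_comm_four, Finset.sum_comm]
  refine Finset.sum_congr rfl fun i _ => Finset.sum_congr rfl fun j _ => ?_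
  refine Finset.sum_congr rfl fun a _ => Finset.sum_congr rfl fun b _ => ?_
  ring

theorem formInner_comp (A H : Matrix (Fin n) (Fin n) ℝ) (α β : (Fin n → ℝ) [⋀^Fin k]→ₗ[ℝ] ℝ) :
    formInner H (α.compLinearMap A.mulVecLin) (β.compLinearMap A.mulVecLin) =
      formInner (A * H * A.transpose) α β := by
  unfold formInner
  exact congrArg _ (sum_contraction_mulVec A H α.toMultilinearMap β.toMultilinearMap)

theorem elim_comp_map {ι κ V V' τ : Type*} (f : V → V') (x : ι → V) (y : κ → V) (e : τ → ι ⊕ κ) :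
    (fun t => f ((Sum.elim x y ∘ e) t)) = Sum.elim (fun i => f (x i)) (fun j => f (y j)) ∘ e := by
  funext t
  simp only [Function.comp]
  cases e t <;> rfl

theorem hodgeStar_comp (h : k + k' = n) (A H : Matrix (Fin n) (Fin n) ℝ)
    (vol : (Fin n → ℝ) [⋀^Fin n]→ₗ[ℝ] ℝ) (β : (Fin n → ℝ) [⋀^Fin k]→ₗ[ℝ] ℝ) :
    hodgeStar h H (vol.compLinearMap A.mulVecLin) (β.compLinearMap A.mulVecLin) =
      (hodgeStar h (A * H * A.transpose) vol β).compLinearMap A.mulVecLin := by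
  ext x
  rw [AlternatingMap.compLinearMap_apply, hodgeStar_real_apply, hodgeStar_real_apply]
  -- With the remaining arguments x frozen, the volume form is multilinear in the contracted slots,
  -- so it can serve as the second factor.
  have := sum_contraction_mulVec A H β.toMultilinearMap
    (MultilinearMap.mk' (fun y => splitAlt (vol.domDomCongr (finCongr h.symm)) y
        (fun m => A.mulVec (x m)))
      (fun m i y y' => by simp [AlternatingMap.map_update_add])
      (fun m i c y => by simp [AlternatingMap.map_update_smul]))
  simp only [MultilinearMap.mk'_apply, splitAlt_blockEquiv h] at this
  congr 1
  refine Eq.trans ?_ this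
  refine Finset.sum_congr rfl fun i _ => Finset.sum_congr rfl fun j _ => ?_
  congr 1
  rw [AlternatingMap.compLinearMap_apply, elim_comp_map (A.mulVecLin)]
  rfl

/-- The standard volume form of `ℝⁿ`. -/
def stdVol (n : ℕ) : (Fin n → ℝ) [⋀^Fin n]→ₗ[ℝ] ℝ := (Pi.basisFun ℝ (Fin n)).det

/-- The exterior product of a covector with an alternating form. -/
def altWedge {V : Type*} [AddCommGroup V] [Module ℝ V] (ξ : V →ₗ[ℝ] ℝ) (α : V [⋀^Fin k]→ₗ[ℝ] ℝ) :
    V [⋀^Fin (k + 1)]→ₗ[ℝ] ℝ :=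
  AlternatingMap.alternatizeUncurryFin (ξ.smulRight α)

theorem altWedge_apply {V : Type*} [AddCommGroup V] [Module ℝ V] (ξ : V →ₗ[ℝ] ℝ)
    (α : V [⋀^Fin k]→ₗ[ℝ] ℝ) (x : Fin (k + 1) → V) :
    altWedge ξ α x = ∑ i : Fin (k + 1), (-1 : ℝ) ^ (i : ℕ) * (ξ (x i) * α (i.removeNth x)) := by
  rw [altWedge, AlternatingMap.alternatizeUncurryFin_apply]
  refine Finset.sum_congr rfl fun i _ => ?_
  simp [zsmul_eq_mul]

theorem vol_eq_smul_stdVol (vol : (Fin n → ℝ) [⋀^Fin n]→ₗ[ℝ] ℝ) :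
    vol = vol (fun i => stdE i) • stdVol n := by
  have h := AlternatingMap.eq_smul_basis_det (Pi.basisFun ℝ (Fin n)) vol
  have e : (⇑(Pi.basisFun ℝ (Fin n)) : Fin n → Fin n → ℝ) = fun i => stdE i := by
    funext i; simp
  rw [e] at h
  exact h

theorem stdVol_stdE : stdVol n (fun i => stdE i) = 1 := by
  have e : (⇑(Pi.basisFun ℝ (Fin n)) : Fin n → Fin n → ℝ) = fun i => stdE i := by
    funext i; simp
  rw [← e]
  exact Module.Basis.det_self _

theorem stdVol_perm_sq (σ : Fin n → Fin n) (hσ : Function.Injective σ) :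
    stdVol n (fun i => stdE (σ i)) * stdVol n (fun i => stdE (σ i)) = 1 := by
  let π : Equiv.Perm (Fin n) := Equiv.ofBijective σ (Finite.injective_iff_bijective.mp hσ)
  have h : stdVol n (fun i => stdE (σ i)) = Equiv.Perm.sign π • stdVol n (fun i => stdE i) :=
    (stdVol n).map_perm (fun i => stdE i) π
  rw [h, stdVol_stdE]
  rcases Int.units_eq_one_or (Equiv.Perm.sign π) with h | h <;> simp [h]

theorem alternating_stdE_eq_zero (α : (Fin n → ℝ) [⋀^Fin k]→ₗ[ℝ] ℝ) (i : Fin k → Fin n)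
    (hi : ¬ Function.Injective i) : α (fun m => stdE (i m)) = 0 := by
  simp only [Function.Injective, not_forall] at hi
  obtain ⟨a, b, hab, hne⟩ := hi
  exact α.map_eq_zero_of_eq _ (by simp [hab]) hne

/-- A sum over multi-indices concentrated on the rearrangements of one of them. -/
theorem sum_mul_eq_factorial (α β : (Fin n → ℝ) [⋀^Fin k]→ₗ[ℝ] ℝ) (j₀ : Fin k → Fin n)
    (h₀ : Function.Injective j₀)
    (h : ∀ j : Fin k → Fin n, Function.Injective j → Set.range j ≠ Set.range j₀ →
      α (fun m => stdE (j m)) = 0) :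
    ∑ j : Fin k → Fin n, α (fun m => stdE (j m)) * β (fun m => stdE (j m)) =
      k.factorial * (α (fun m => stdE (j₀ m)) * β (fun m => stdE (j₀ m))) := by
  classical
  have hinj : Function.Injective (fun (τ : Equiv.Perm (Fin k)) (m : Fin k) => j₀ (τ m)) := by
    intro τ τ' hτ
    ext m
    exact congrArg _ (h₀ (congrFun hτ m))
  -- The only nonzero terms belong to the rearrangements of j₀ by permutations τ. Both factors
  -- acquire the sign of τ, so these k! terms are equal.
  rw [← Fintype.sum_of_injective _ hinj
    (fun _ => α (fun m => stdE (j₀ m)) * β (fun m => stdE (j₀ m)))]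
  · simp [Finset.card_univ, Fintype.card_perm]
  · intro j hj
    by_cases hji : Function.Injective j
    · have hr : Set.range j ≠ Set.range j₀ := by
        intro hr
        apply hj
        refine ⟨(Equiv.ofInjective j hji).trans
          ((Equiv.setCongr hr).trans (Equiv.ofInjective j₀ h₀).symm), ?_⟩
        funext m
        simp [Equiv.apply_ofInjective_symm]
      rw [h j hji hr, zero_mul]
    · rw [alternating_stdE_eq_zero α j hji, zero_mul]
  · intro τ
    have h1 : α (fun m => stdE (j₀ (τ m))) = Equiv.Perm.sign τ • α (fun m => stdE (j₀ m)) :=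
      α.map_perm (fun m => stdE (j₀ m)) τ
    have h2 : β (fun m => stdE (j₀ (τ m))) = Equiv.Perm.sign τ • β (fun m => stdE (j₀ m)) :=
      β.map_perm (fun m => stdE (j₀ m)) τ
    rw [h1, h2]
    rcases Int.units_eq_one_or (Equiv.Perm.sign τ) with h | h <;> simp [h]

theorem prod_one_apply (i j : Fin k → Fin n) :
    ∏ m, (1 : Matrix (Fin n) (Fin n) ℝ) (i m) (j m) = if i = j then 1 else 0 := by
  split_ifs with h
  · exact Finset.prod_eq_one fun m _ => by rw [h]; exact Matrix.one_apply_eq _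
  · obtain ⟨m, hm⟩ := Function.ne_iff.mp h
    exact Finset.prod_eq_zero (Finset.mem_univ m) (Matrix.one_apply_ne hm)

theorem formInner_one (α β : (Fin n → ℝ) [⋀^Fin k]→ₗ[ℝ] ℝ) :
    formInner 1 α β = (k.factorial : ℝ)⁻¹ * ∑ i : Fin k → Fin n,
      α (fun m => stdE (i m)) * β (fun m => stdE (i m)) := by
  unfold formInner
  simp only [prod_one_apply, ite_mul, one_mul, zero_mul, Finset.sum_ite_eq, Finset.mem_univ,
    if_true]

theorem hodgeStar_one_apply (h : k + k' = n) (vol : (Fin n → ℝ) [⋀^Fin n]→ₗ[ℝ] ℝ)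
    (β : (Fin n → ℝ) [⋀^Fin k]→ₗ[ℝ] ℝ) (x : Fin k' → Fin n → ℝ) :
    hodgeStar h 1 vol β x = (k.factorial : ℝ)⁻¹ * ∑ i : Fin k → Fin n,
      β (fun m => stdE (i m)) * vol (Sum.elim (fun m => stdE (i m)) x ∘ blockEquiv h) := by
  rw [hodgeStar_real_apply]
  simp only [prod_one_apply, ite_mul, one_mul, zero_mul, Finset.sum_ite_eq, Finset.mem_univ,
    if_true]

/-- The volume form, with the last block of arguments frozen. -/
def volLeft (h : k + k' = n) (vol : (Fin n → ℝ) [⋀^Fin n]→ₗ[ℝ] ℝ) (y : Fin k' → Fin n → ℝ) :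
    (Fin n → ℝ) [⋀^Fin k]→ₗ[ℝ] ℝ :=
  (altEval y).compAlternatingMap (splitAlt (vol.domDomCongr (finCongr h.symm)))

theorem volLeft_apply (h : k + k' = n) (vol : (Fin n → ℝ) [⋀^Fin n]→ₗ[ℝ] ℝ)
    (y : Fin k' → Fin n → ℝ) (x : Fin k → Fin n → ℝ) :
    volLeft h vol y x = vol (Sum.elim x y ∘ blockEquiv h) :=
  splitAlt_blockEquiv h vol x y

theorem elim_stdE (h : k + k' = n) (i : Fin k → Fin n) (j : Fin k' → Fin n) :
    (Sum.elim (fun m => (stdE (i m) : Fin n → ℝ)) (fun m => stdE (j m)) ∘ blockEquiv h) =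
      fun t => stdE ((Sum.elim i j ∘ blockEquiv h) t) := by
  rw [elim_comp_map (fun i : Fin n => (stdE i : Fin n → ℝ))]

theorem stdVol_elim_eq_zero (h : k + k' = n) (i : Fin k → Fin n) (j : Fin k' → Fin n)
    (hij : ¬ Function.Injective (Sum.elim i j)) :
    stdVol n (Sum.elim (fun m => stdE (i m)) (fun m => stdE (j m)) ∘ blockEquiv h) = 0 := by
  rw [elim_stdE h]
  refine alternating_stdE_eq_zero _ _ fun hinj => hij ?_
  have := hinj.comp (blockEquiv h).symm.injective
  rwa [Function.comp_assoc, Equiv.self_comp_symm, Function.comp_id] at this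

theorem range_eq_of_elim_bijective {i l : Fin k → Fin n} {j : Fin k' → Fin n} (h : k + k' = n)
    (hi : Function.Injective (Sum.elim i j)) (hl : Function.Injective (Sum.elim l j)) :
    Set.range i = Set.range l := by
  have key : ∀ i : Fin k → Fin n, Function.Injective (Sum.elim i j) →
      Set.range i = (Set.range j)ᶜ := by
    intro i hi
    have hs : Function.Surjective (Sum.elim i j ∘ blockEquiv h) :=
      Finite.injective_iff_surjective.mp (hi.comp (blockEquiv h).injective)
    ext t
    constructor
    · rintro ⟨a, rfl⟩ ⟨b, hb⟩
      have := hi (a₁ := Sum.inl a) (a₂ := Sum.inr b) (by simpa using hb.symm)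
      simp at this
    · intro ht
      obtain ⟨s, hs⟩ := hs t
      simp only [Function.comp] at hs
      rcases hb : blockEquiv h s with a | b
      · exact ⟨a, by simpa [hb] using hs⟩
      · exact absurd ⟨b, by simpa [hb] using hs⟩ ht
  rw [key i hi, key l hl]

theorem range_eq_of_elim_bijective' {i : Fin k → Fin n} {j l : Fin k' → Fin n} (h : k + k' = n)
    (hi : Function.Injective (Sum.elim i j)) (hl : Function.Injective (Sum.elim i l)) :
    Set.range j = Set.range l := by
  have hsw : ∀ j : Fin k' → Fin n, Function.Injective (Sum.elim i j) →
      Function.Injective (Sum.elim j i) := by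
    intro j hj
    have : Sum.elim j i = Sum.elim i j ∘ Sum.swap := by
      funext t; cases t <;> rfl
    rw [this]
    exact hj.comp Sum.swap_leftInverse.injective
  exact range_eq_of_elim_bijective (by omega : k' + k = n) (hsw j hi) (hsw l hl)

theorem exists_complement (h : k + k' = n) (i : Fin k → Fin n) (hi : Function.Injective i) :
    ∃ j : Fin k' → Fin n, Function.Injective (Sum.elim i j) := by
  classical
  have hc : ((Finset.univ.image i)ᶜ).card = k' := by
    rw [Finset.card_compl, Finset.card_image_of_injective _ hi]
    simp; omega
  refine ⟨((Finset.univ.image i)ᶜ).orderEmbOfFin hc, ?_⟩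
  refine hi.sumElim (Function.Embedding.injective _) fun a b hab => ?_
  have := Finset.orderEmbOfFin_mem ((Finset.univ.image i)ᶜ) hc b
  rw [← hab] at this
  simp at this

/-- The transposed standard star operator inverts the standard star operator. -/
theorem sum_stdVol_hodgeStar (h : k + k' = n) (α : (Fin n → ℝ) [⋀^Fin k]→ₗ[ℝ] ℝ)
    (i : Fin k → Fin n) :
    (k'.factorial : ℝ)⁻¹ * ∑ j : Fin k' → Fin n,
      stdVol n (Sum.elim (fun m => stdE (i m)) (fun m => stdE (j m)) ∘ blockEquiv h) *
        hodgeStar h 1 (stdVol n) α (fun m => stdE (j m)) = α (fun m => stdE (i m)) := by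
  classical
  have hk : (k.factorial : ℝ) ≠ 0 := Nat.cast_ne_zero.mpr (Nat.factorial_ne_zero k)
  have hk' : (k'.factorial : ℝ) ≠ 0 := Nat.cast_ne_zero.mpr (Nat.factorial_ne_zero k')
  by_cases hi : Function.Injective i
  swap
  · rw [alternating_stdE_eq_zero α i hi]
    have : ∀ j : Fin k' → Fin n, ¬ Function.Injective (Sum.elim i j) :=
      fun j hj => hi fun a b hab => by
        have := hj (a₁ := Sum.inl a) (a₂ := Sum.inl b) (by simpa using hab)
        simpa using this
    simp [stdVol_elim_eq_zero h i _ (this _)]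
  -- For j complementary to i, the sum that defines the star of α at j contains only the
  -- rearrangements of i. It reduces to one term, which carries a second copy of the same volume
  -- coefficient.
  · have hterm : ∀ j : Fin k' → Fin n,
        stdVol n (Sum.elim (fun m => stdE (i m)) (fun m => stdE (j m)) ∘ blockEquiv h) *
          hodgeStar h 1 (stdVol n) α (fun m => stdE (j m)) =
        (stdVol n (Sum.elim (fun m => stdE (i m)) (fun m => stdE (j m)) ∘ blockEquiv h) *
        stdVol n (Sum.elim (fun m => stdE (i m)) (fun m => stdE (j m)) ∘ blockEquiv h)) *
          α (fun m => stdE (i m)) := by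
      intro j
      by_cases hij : Function.Injective (Sum.elim i j)
      · have := sum_mul_eq_factorial (volLeft h (stdVol n) (fun m => stdE (j m))) α i hi (by
          intro l _ hr
          rw [volLeft_apply]
          refine stdVol_elim_eq_zero h l j fun hl => hr ?_
          exact range_eq_of_elim_bijective h hl hij)
        simp only [volLeft_apply] at this
        rw [hodgeStar_one_apply]
        simp only [mul_comm (α _)]
        rw [this]
        field_simp
      · rw [stdVol_elim_eq_zero h i j hij]; simp
    rw [Finset.sum_congr rfl fun j _ => hterm j, ← Finset.sum_mul]
    obtain ⟨j₀, hj₀⟩ := exists_complement h i hi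
    have hj₀' : Function.Injective j₀ := fun a b hab => by
      have := hj₀ (a₁ := Sum.inr a) (a₂ := Sum.inr b) (by simpa using hab)
      simpa using this
    -- What remains is the sum over j of the squared volume coefficients: the k'! rearrangements of
    -- one complement j₀, each contributing 1.
    have := sum_mul_eq_factorial
      (splitAlt ((stdVol n).domDomCongr (finCongr h.symm)) (fun m => stdE (i m)))
      (splitAlt ((stdVol n).domDomCongr (finCongr h.symm)) (fun m => stdE (i m))) j₀ hj₀' (by
          intro l _ hr
          rw [splitAlt_blockEquiv h]
          refine stdVol_elim_eq_zero h i l fun hl => hr ?_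
          exact range_eq_of_elim_bijective' h hl hj₀)
    simp only [splitAlt_blockEquiv h] at this
    rw [this, elim_stdE h, stdVol_perm_sq _ (hj₀.comp (blockEquiv h).injective)]
    field_simp

/-- Replacing β by its inversion formula turns the right side into the double sum on the left: the
inverse of the star is its transpose. -/
theorem formInner_hodgeStar_one (h : k + k' = n) (α β : (Fin n → ℝ) [⋀^Fin k]→ₗ[ℝ] ℝ) :
    formInner 1 (hodgeStar h 1 (stdVol n) α) (hodgeStar h 1 (stdVol n) β) = formInner 1 α β := by
  rw [formInner_one, formInner_one]
  conv_rhs =>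
    enter [2, 2, i]
    rw [← sum_stdVol_hodgeStar h β i]
  conv_lhs =>
    enter [2, 2, j]
    rw [hodgeStar_one_apply]
  simp only [Finset.mul_sum, Finset.sum_mul]
  rw [Finset.sum_comm]
  refine Finset.sum_congr rfl fun i _ => Finset.sum_congr rfl fun j _ => ?_
  ring

/-- The sign of the exchange of two blocks of arguments. -/
theorem exists_sign_swap (h : k + k' = n) (h' : k' + k = n) : ∃ c : ℝ, c * c = 1 ∧
    ∀ (vol : (Fin n → ℝ) [⋀^Fin n]→ₗ[ℝ] ℝ) (x : Fin k → Fin n → ℝ) (y : Fin k' → Fin n → ℝ),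
      vol (Sum.elim y x ∘ blockEquiv h') = c * vol (Sum.elim x y ∘ blockEquiv h) := by
  let σ : Equiv.Perm (Fin n) :=
    ((blockEquiv h').trans (Equiv.sumComm _ _)).trans (blockEquiv h).symm
  refine ⟨((Equiv.Perm.sign σ : ℤ) : ℝ), ?_, fun vol x y => ?_⟩
  · rcases Int.units_eq_one_or (Equiv.Perm.sign σ) with h | h <;> simp [h]
  · have := vol.map_perm (Sum.elim x y ∘ blockEquiv h) σ
    have e : Sum.elim y x ∘ blockEquiv h' = (Sum.elim x y ∘ blockEquiv h) ∘ σ := by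
      funext t
      simp only [σ, Function.comp, Equiv.trans_apply, Equiv.apply_symm_apply]
      cases blockEquiv h' t <;> rfl
    rw [e, this, Units.smul_def, zsmul_eq_mul]

/-- Exchanging the two blocks of arguments turns the outer star into the transposed star, which
inverts the inner one. The constant is the sign of the exchange, and only its square is used later.
-/
theorem hodgeStar_one_hodgeStar_one (h : k + k' = n) (h' : k' + k = n) : ∃ c : ℝ, c * c = 1 ∧
    ∀ α : (Fin n → ℝ) [⋀^Fin k]→ₗ[ℝ] ℝ,
      hodgeStar h' 1 (stdVol n) (hodgeStar h 1 (stdVol n) α) = c • α := by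
  obtain ⟨c, hc, hs⟩ := exists_sign_swap h h'
  refine ⟨c, hc, fun α => ?_⟩
  refine Module.Basis.ext_alternating (Pi.basisFun ℝ (Fin n)) fun i _ => ?_
  have e : (fun m => Pi.basisFun ℝ (Fin n) (i m)) = fun m => stdE (i m) := by
    funext m; simp
  rw [e, hodgeStar_one_apply, AlternatingMap.smul_apply, ← sum_stdVol_hodgeStar h α i]
  simp only [hs, smul_eq_mul, Finset.mul_sum]
  refine Finset.sum_congr rfl fun j _ => ?_
  ring

/-- Exterior multiplication by ξ is dual to contraction with ξ. The k + 1 terms of the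
alternatization agree, because bringing slot m of δ to the front costs the same sign (-1)^m that the
term already carries. -/
theorem sum_mul_altWedge (δ : (Fin n → ℝ) [⋀^Fin (k + 1)]→ₗ[ℝ] ℝ) (ξ : (Fin n → ℝ) →ₗ[ℝ] ℝ)
    (γ : (Fin n → ℝ) [⋀^Fin k]→ₗ[ℝ] ℝ) :
    ∑ i : Fin (k + 1) → Fin n, δ (fun m => stdE (i m)) * altWedge ξ γ (fun m => stdE (i m)) =
      ((k + 1 : ℕ) : ℝ) * ∑ a : Fin n, ∑ i : Fin k → Fin n,
        ξ (stdE a) * δ (Fin.cons (stdE a) (fun m => stdE (i m))) * γ (fun m => stdE (i m)) := by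
  simp only [altWedge_apply, Finset.mul_sum]
  rw [Finset.sum_comm]
  have key : ∀ m : Fin (k + 1), ∑ i : Fin (k + 1) → Fin n, δ (fun m => stdE (i m)) *
      ((-1 : ℝ) ^ (m : ℕ) * (ξ (stdE (i m)) * γ (m.removeNth fun m => stdE (i m)))) =
      ∑ a : Fin n, ∑ i : Fin k → Fin n,
        ξ (stdE a) * δ (Fin.cons (stdE a) (fun m => stdE (i m))) * γ (fun m => stdE (i m)) := by
    intro m
    rw [← Fintype.sum_prod_type', ← (Fin.insertNthEquiv (fun _ => Fin n) m).sum_comp]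
    refine Finset.sum_congr rfl fun x _ => ?_
    have e : (fun t => (stdE (Fin.insertNthEquiv (fun _ => Fin n) m x t) : Fin n → ℝ)) =
        m.insertNth (stdE x.1) (fun t => stdE (x.2 t)) := by
      funext t
      refine Fin.succAboveCases m ?_ (fun t => ?_) t <;> simp [Fin.insertNthEquiv]
    rw [e, AlternatingMap.map_insertNth, Fin.removeNth_insertNth]
    have e2 : Fin.insertNthEquiv (fun _ => Fin n) m x m = x.1 := by simp [Fin.insertNthEquiv]
    rw [e2]
    have hs : ((-1 : ℝ) ^ (m : ℕ)) * (-1 : ℝ) ^ (m : ℕ) = 1 := by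
      rw [← mul_pow]; simp
    have hv : δ (Matrix.vecCons (stdE x.1) (fun t => stdE (x.2 t))) =
      δ (Fin.cons (stdE x.1) (fun m => stdE (x.2 m))) := rfl
    rw [hv, zsmul_eq_mul]
    push_cast
    linear_combination (ξ (stdE x.1) * δ (Fin.cons (stdE x.1) (fun m => stdE (x.2 m))) *
      γ (fun m => stdE (x.2 m))) * hs
  rw [Finset.sum_congr rfl fun m _ => key m]
  simp [Finset.mul_sum]

/-- The sign of the transport of an argument over a block of arguments. -/
theorem exists_sign_cons {v v' : ℕ} (h : v + 1 + v' = n) (h' : v + (v' + 1) = n) :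
    ∃ c : ℝ, c * c = 1 ∧ ∀ (vol : (Fin n → ℝ) [⋀^Fin n]→ₗ[ℝ] ℝ) (a : Fin n → ℝ)
      (y : Fin v → Fin n → ℝ) (x : Fin v' → Fin n → ℝ),
      vol (Sum.elim (Fin.cons a y : Fin (v + 1) → Fin n → ℝ) x ∘ blockEquiv h) =
        c * vol (Sum.elim y (Fin.cons a x : Fin (v' + 1) → Fin n → ℝ) ∘ blockEquiv h') := by
  let θ : Fin (v + 1) ⊕ Fin v' ≃ Fin v ⊕ Fin (v' + 1) :=
    { toFun := Sum.elim (Fin.cons (Sum.inr 0) Sum.inl : Fin (v + 1) → Fin v ⊕ Fin (v' + 1))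
        (fun j => Sum.inr j.succ)
      invFun := Sum.elim (fun i => Sum.inl i.succ)
        (Fin.cons (Sum.inl 0) Sum.inr : Fin (v' + 1) → Fin (v + 1) ⊕ Fin v')
      left_inv := by
        rintro (i | i)
        · refine Fin.cases ?_ (fun i => ?_) i <;> simp
        · simp
      right_inv := by
        rintro (i | i)
        · simp
        · refine Fin.cases ?_ (fun i => ?_) i <;> simp }
  let σ : Equiv.Perm (Fin n) := ((blockEquiv h).trans θ).trans (blockEquiv h').symm
  refine ⟨((Equiv.Perm.sign σ : ℤ) : ℝ), ?_, fun vol a y x => ?_⟩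
  · rcases Int.units_eq_one_or (Equiv.Perm.sign σ) with h | h <;> simp [h]
  · have := vol.map_perm (Sum.elim y (Fin.cons a x : Fin (v' + 1) → Fin n → ℝ) ∘ blockEquiv h') σ
    have e : Sum.elim (Fin.cons a y : Fin (v + 1) → Fin n → ℝ) x ∘ blockEquiv h =
        (Sum.elim y (Fin.cons a x : Fin (v' + 1) → Fin n → ℝ) ∘ blockEquiv h') ∘ σ := by
      funext t
      simp only [σ, Function.comp, Equiv.trans_apply, Equiv.apply_symm_apply]
      rcases blockEquiv h t with i | i
      · refine Fin.cases ?_ (fun i => ?_) i <;> simp [θ]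
      · simp [θ]
    rw [e, this, Units.smul_def, zsmul_eq_mul]

/-- The pairing `α ∧ γ` of forms of complementary degrees, for the standard volume form. -/
def wedgePairing (h : k + k' = n) (α : (Fin n → ℝ) [⋀^Fin k]→ₗ[ℝ] ℝ)
    (γ : (Fin n → ℝ) [⋀^Fin k']→ₗ[ℝ] ℝ) : ℝ :=
  formInner 1 (hodgeStar h 1 (stdVol n) α) γ

/-- This is ξ ∧ α ∧ γ = ± α ∧ ξ ∧ γ: the covector ξ is carried over the v arguments of α. The sign
depends on the degrees alone, which lets it be extracted from sums and integrals. -/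
theorem exists_wedgePairing_altWedge {v v' : ℕ} (h : v + 1 + v' = n) (h' : v + (v' + 1) = n) :
    ∃ c : ℝ, c * c = 1 ∧ ∀ (ξ : (Fin n → ℝ) →ₗ[ℝ] ℝ) (α : (Fin n → ℝ) [⋀^Fin v]→ₗ[ℝ] ℝ)
      (γ : (Fin n → ℝ) [⋀^Fin v']→ₗ[ℝ] ℝ),
      wedgePairing h (altWedge ξ α) γ = c * wedgePairing h' α (altWedge ξ γ) := by
  obtain ⟨c, hc, hs⟩ := exists_sign_cons h h'
  refine ⟨c, hc, fun ξ α γ => ?_⟩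
  -- The factor m + 1 produced by `sum_mul_altWedge` converts the normalisation of degree m + 1 into
  -- that of degree m.
  have hf : ∀ m : ℕ, ((m + 1).factorial : ℝ)⁻¹ * ((m + 1 : ℕ) : ℝ) = (m.factorial : ℝ)⁻¹ := by
    intro m
    have h1 : ((m + 1 : ℕ) : ℝ) ≠ 0 := Nat.cast_ne_zero.mpr (Nat.succ_ne_zero m)
    have h2 : (m.factorial : ℝ) ≠ 0 := Nat.cast_ne_zero.mpr (Nat.factorial_ne_zero m)
    rw [Nat.factorial_succ, Nat.cast_mul]
    field_simp
  unfold wedgePairing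
  rw [formInner_one, formInner_one, sum_mul_altWedge, ← mul_assoc (_⁻¹) _ (Finset.sum _ _), hf]
  have e1 : ∀ j : Fin v' → Fin n, hodgeStar h 1 (stdVol n) (altWedge ξ α) (fun m => stdE (j m)) =
      (v.factorial : ℝ)⁻¹ * ∑ a : Fin n, ∑ i : Fin v → Fin n, ξ (stdE a) *
        (c * stdVol n (Sum.elim (fun m => stdE (i m))
          (Fin.cons (stdE a) (fun m => stdE (j m)) : Fin (v' + 1) → Fin n → ℝ) ∘ blockEquiv h')) *
            α (fun m => stdE (i m)) := by
    intro j
    have := sum_mul_altWedge (volLeft h (stdVol n) (fun m => stdE (j m))) ξ α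
    rw [hodgeStar_one_apply]
    simp only [volLeft_apply, hs] at this
    simp only [mul_comm (altWedge ξ α _)]
    rw [this, ← mul_assoc, hf]
  simp only [e1, hodgeStar_one_apply, Finset.mul_sum, Finset.sum_mul]
  rw [Finset.sum_comm]
  refine Finset.sum_congr rfl fun a _ => ?_
  refine Finset.sum_congr rfl fun j _ => Finset.sum_congr rfl fun i _ => ?_
  ring

-- A positive definite matrix has the form BᴴB, and A is the transpose of B. The factor 1 is kept so
-- that the equation matches the naturality lemmas with standard metric H = 1.
open scoped MatrixOrder in
theorem exists_mul_transpose_eq {H : Matrix (Fin n) (Fin n) ℝ} (hH : H.PosDef) :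
    ∃ A : Matrix (Fin n) (Fin n) ℝ, A * 1 * A.transpose = H ∧
      Function.Surjective A.mulVecLin := by
  obtain ⟨B, hB⟩ := CStarAlgebra.nonneg_iff_eq_star_mul_self.mp hH.posSemidef.nonneg
  have e : B.transpose * 1 * B.transpose.transpose = H := by
    rw [hB, mul_one, Matrix.transpose_transpose, Matrix.star_eq_conjTranspose,
      Matrix.conjTranspose_eq_transpose_of_trivial]
  refine ⟨B.transpose, e, ?_⟩
  have hdet : IsUnit B.transpose.det := by
    have h1 := hH.det_pos
    rw [← e, mul_one, Matrix.det_mul] at h1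
    exact isUnit_iff_ne_zero.mpr fun h0 => by simp [h0] at h1
  intro y
  refine ⟨(B.transpose)⁻¹.mulVec y, ?_⟩
  rw [Matrix.mulVecLin_apply, Matrix.mulVec_mulVec, Matrix.mul_nonsing_inv _ hdet,
    Matrix.one_mulVec]

theorem formInner_smul_left (H : Matrix (Fin n) (Fin n) ℝ) (c : ℝ)
    (α β : (Fin n → ℝ) [⋀^Fin k]→ₗ[ℝ] ℝ) : formInner H (c • α) β = c * formInner H α β := by
  simp only [formInner, AlternatingMap.smul_apply, smul_eq_mul, Finset.mul_sum]
  refine Finset.sum_congr rfl fun i _ => Finset.sum_congr rfl fun j _ => ?_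
  ring

theorem formInner_smul_right (H : Matrix (Fin n) (Fin n) ℝ) (c : ℝ)
    (α β : (Fin n → ℝ) [⋀^Fin k]→ₗ[ℝ] ℝ) : formInner H α (c • β) = c * formInner H α β := by
  simp only [formInner, AlternatingMap.smul_apply, smul_eq_mul, Finset.mul_sum]
  refine Finset.sum_congr rfl fun i _ => Finset.sum_congr rfl fun j _ => ?_
  ring

theorem formInner_add_left (H : Matrix (Fin n) (Fin n) ℝ)
    (α α' β : (Fin n → ℝ) [⋀^Fin k]→ₗ[ℝ] ℝ) :
    formInner H (α + α') β = formInner H α β + formInner H α' β := by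
  simp only [formInner, AlternatingMap.add_apply, ← mul_add, ← Finset.sum_add_distrib]
  congr 1
  refine Finset.sum_congr rfl fun i _ => Finset.sum_congr rfl fun j _ => ?_
  ring

theorem formInner_add_right (H : Matrix (Fin n) (Fin n) ℝ)
    (α β β' : (Fin n → ℝ) [⋀^Fin k]→ₗ[ℝ] ℝ) :
    formInner H α (β + β') = formInner H α β + formInner H α β' := by
  simp only [formInner, AlternatingMap.add_apply, ← mul_add, ← Finset.sum_add_distrib]

theorem formInner_comm {H : Matrix (Fin n) (Fin n) ℝ} (hH : H.transpose = H)
    (α β : (Fin n → ℝ) [⋀^Fin k]→ₗ[ℝ] ℝ) : formInner H α β = formInner H β α := by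
  have hs : ∀ a b, H a b = H b a := fun a b => by
    conv_lhs => rw [← hH]
    rfl
  unfold formInner
  rw [Finset.sum_comm]
  congr 1
  refine Finset.sum_congr rfl fun i _ => Finset.sum_congr rfl fun j _ => ?_
  rw [Finset.prod_congr rfl fun m _ => hs (j m) (i m)]
  ring

theorem hodgeStar_smul_vol (h : k + k' = n) (H : Matrix (Fin n) (Fin n) ℝ) (c : ℝ)
    (vol : (Fin n → ℝ) [⋀^Fin n]→ₗ[ℝ] ℝ) (β : (Fin n → ℝ) [⋀^Fin k]→ₗ[ℝ] ℝ) :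
    hodgeStar h H (c • vol) β = c • hodgeStar h H vol β := by
  ext x
  rw [AlternatingMap.smul_apply, hodgeStar_real_apply, hodgeStar_real_apply]
  simp only [AlternatingMap.smul_apply, smul_eq_mul, Finset.mul_sum]
  refine Finset.sum_congr rfl fun i _ => Finset.sum_congr rfl fun j _ => ?_
  ring

theorem formInner_stdVol : formInner 1 (stdVol n) (stdVol n) = 1 := by
  rw [formInner_one, sum_mul_eq_factorial _ _ id Function.injective_id]
  · have : stdVol n (fun m => stdE (id m)) = 1 := stdVol_stdE
    rw [this]
    have : (n.factorial : ℝ) ≠ 0 := Nat.cast_ne_zero.mpr (Nat.factorial_ne_zero n)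
    field_simp
  · intro j hj hr
    refine absurd ?_ hr
    rw [(Finite.injective_iff_surjective.mp hj).range_eq, Set.range_id]

/-- An orthonormal frame for `H` carries a volume form of length one to `± stdVol`. -/
theorem exists_frame {H : Matrix (Fin n) (Fin n) ℝ} (hH : H.PosDef)
    {vol : (Fin n → ℝ) [⋀^Fin n]→ₗ[ℝ] ℝ} (hvol : formInner H vol vol = 1) :
    ∃ (A : Matrix (Fin n) (Fin n) ℝ) (t : ℝ), A * 1 * A.transpose = H ∧
      Function.Surjective A.mulVecLin ∧ t * t = 1 ∧ vol.compLinearMap A.mulVecLin = t • stdVol n := by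
  obtain ⟨A, hA, hs⟩ := exists_mul_transpose_eq hH
  have hv := vol_eq_smul_stdVol (vol.compLinearMap A.mulVecLin)
  refine ⟨A, _, hA, hs, ?_, hv⟩
  rw [← hA, ← formInner_comp, hv, formInner_smul_left, formInner_smul_right,
    formInner_stdVol, mul_one] at hvol
  exact hvol

/-- In an orthonormal frame this is the standard case. The sign t relating the volume form to the
standard one occurs in both arguments and cancels. -/
theorem formInner_hodgeStar (h : k + k' = n) {H : Matrix (Fin n) (Fin n) ℝ} (hH : H.PosDef)
    {vol : (Fin n → ℝ) [⋀^Fin n]→ₗ[ℝ] ℝ} (hvol : formInner H vol vol = 1)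
    (α β : (Fin n → ℝ) [⋀^Fin k]→ₗ[ℝ] ℝ) :
    formInner H (hodgeStar h H vol α) (hodgeStar h H vol β) = formInner H α β := by
  obtain ⟨A, t, rfl, hs, ht, hv⟩ := exists_frame hH hvol
  rw [← formInner_comp, ← hodgeStar_comp, ← hodgeStar_comp, hv, hodgeStar_smul_vol,
    hodgeStar_smul_vol, formInner_smul_left, formInner_smul_right, formInner_hodgeStar_one,
    formInner_comp, ← mul_assoc, ht, one_mul]

/-- The constant is chosen before H and the volume form, so it is the same at all points of the
manifold. -/
theorem exists_hodgeStar_hodgeStar (h : k + k' = n) (h' : k' + k = n) : ∃ c : ℝ, c * c = 1 ∧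
    ∀ {H : Matrix (Fin n) (Fin n) ℝ} (_ : H.PosDef)
      {vol : (Fin n → ℝ) [⋀^Fin n]→ₗ[ℝ] ℝ} (_ : formInner H vol vol = 1)
      (α : (Fin n → ℝ) [⋀^Fin k]→ₗ[ℝ] ℝ),
      hodgeStar h' H vol (hodgeStar h H vol α) = c • α := by
  obtain ⟨c, hc, hcs⟩ := hodgeStar_one_hodgeStar_one h h'
  refine ⟨c, hc, fun {H} hH {vol} hvol α => ?_⟩
  obtain ⟨A, t, rfl, hs, ht, hv⟩ := exists_frame hH hvol
  have hinj : ∀ β γ : (Fin n → ℝ) [⋀^Fin k]→ₗ[ℝ] ℝ,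
      β.compLinearMap A.mulVecLin = γ.compLinearMap A.mulVecLin → β = γ := by
    intro β γ hβ
    ext x
    choose y hy using hs
    have hx : x = fun m => A.mulVecLin (y (x m)) := by funext m; rw [hy]
    rw [hx]
    exact congrArg (fun f : (Fin n → ℝ) [⋀^Fin k]→ₗ[ℝ] ℝ => f fun m => y (x m)) hβ
  apply hinj
  rw [← hodgeStar_comp, ← hodgeStar_comp, hv, hodgeStar_smul_vol, hodgeStar_smul_vol, map_smul,
    hcs, smul_smul, ht, one_smul]
  rfl

/-- The metric enters the star only by raising the indices of β. -/
theorem hodgeStar_eq_comp (h : k + k' = n) (H : Matrix (Fin n) (Fin n) ℝ)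
    (vol : (Fin n → ℝ) [⋀^Fin n]→ₗ[ℝ] ℝ) (β : (Fin n → ℝ) [⋀^Fin k]→ₗ[ℝ] ℝ) :
    hodgeStar h H vol β = hodgeStar h 1 vol (β.compLinearMap H.mulVecLin) := by
  ext x
  rw [hodgeStar_one_apply, hodgeStar_real_apply, Finset.sum_comm]
  congr 1
  refine Finset.sum_congr rfl fun j _ => ?_
  have := multilinear_mulVec H β.toMultilinearMap j
  change β (fun m => H.mulVecLin (stdE (j m))) = _ at this
  rw [AlternatingMap.compLinearMap_apply, this, Finset.sum_mul]
  rfl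

theorem formInner_eq_comp (H : Matrix (Fin n) (Fin n) ℝ)
    (α β : (Fin n → ℝ) [⋀^Fin k]→ₗ[ℝ] ℝ) :
    formInner H β α = formInner 1 (β.compLinearMap H.mulVecLin) α := by
  rw [formInner_one]
  unfold formInner
  rw [Finset.sum_comm]
  congr 1
  refine Finset.sum_congr rfl fun j _ => ?_
  have := multilinear_mulVec H β.toMultilinearMap j
  change β (fun m => H.mulVecLin (stdE (j m))) = _ at this
  rw [AlternatingMap.compLinearMap_apply, this, Finset.sum_mul]
  rfl

/-- The defining relation ⟨α, β⟩ vol = α ∧ ⋆β in coordinates. On the right the pairing itself is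
free of metric and volume form, which is what makes the Leibniz rule available. After raising
indices it is the isometry property of the standard star, so symmetry of H suffices. -/
theorem vol_mul_formInner (h : k + k' = n) {H : Matrix (Fin n) (Fin n) ℝ}
    (hH : H.transpose = H) (vol : (Fin n → ℝ) [⋀^Fin n]→ₗ[ℝ] ℝ)
    (α β : (Fin n → ℝ) [⋀^Fin k]→ₗ[ℝ] ℝ) :
    vol (fun i => stdE i) * formInner H α β = wedgePairing h α (hodgeStar h H vol β) := by
  unfold wedgePairing
  rw [formInner_comm hH, formInner_comm (Matrix.transpose_one), formInner_eq_comp,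
    hodgeStar_eq_comp, ← formInner_hodgeStar_one h]
  conv_rhs => rw [vol_eq_smul_stdVol vol, hodgeStar_smul_vol, formInner_smul_left]

end Star

/-! ### Bigraded alternating forms -/

section BiForms

variable {p q u v : ℕ}

/-- The scalar product on `Λ^u N^* ⊗ Λ^v T^*` for the inverse Gram matrices `N` and `H`. -/
def biForm (N : Matrix (Fin q) (Fin q) ℝ) (H : Matrix (Fin p) (Fin p) ℝ)
    (a a' : BiAlt p q u v) : ℝ :=
  (u.factorial : ℝ)⁻¹ * ∑ c : Fin u → Fin q, ∑ c' : Fin u → Fin q,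
    (∏ m, N (c m) (c' m)) * formInner H (a fun m => stdE (c m)) (a' fun m => stdE (c' m))

theorem biInner_eq_biForm (b : Bilin p q) (a a' : BiAlt p q u v) :
    biInner b a a' = biForm (normalGram b)⁻¹ (leafGram b)⁻¹ a a' := by
  unfold biInner biForm formInner
  simp only [Finset.mul_sum]
  refine Finset.sum_congr rfl fun c _ => Finset.sum_congr rfl fun c' _ =>
    Finset.sum_congr rfl fun i _ => Finset.sum_congr rfl fun i' _ => ?_
  rw [mul_inv]
  ring

/-- The form in the normal arguments that is left when the leafwise arguments are frozen. -/
def leafEval (a : BiAlt p q u v) (x : Fin v → Fin p → ℝ) : (Fin q → ℝ) [⋀^Fin u]→ₗ[ℝ] ℝ :=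
  (altEval x).compAlternatingMap a

theorem leafEval_apply (a : BiAlt p q u v) (x : Fin v → Fin p → ℝ) (y : Fin u → Fin q → ℝ) :
    leafEval a x y = a y x := rfl

/-- The order of summation is exchanged, so that statements about normal forms can be applied with
the leafwise arguments frozen. -/
theorem biForm_eq_leafEval (N : Matrix (Fin q) (Fin q) ℝ) (H : Matrix (Fin p) (Fin p) ℝ)
    (a a' : BiAlt p q u v) :
    biForm N H a a' = (v.factorial : ℝ)⁻¹ * ∑ i : Fin v → Fin p, ∑ i' : Fin v → Fin p,
      (∏ m, H (i m) (i' m)) *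
        formInner N (leafEval a fun m => stdE (i m)) (leafEval a' fun m => stdE (i' m)) := by
  unfold biForm formInner
  simp only [Finset.mul_sum, leafEval_apply]
  rw [sum_comm_four]
  refine Finset.sum_congr rfl fun c _ => Finset.sum_congr rfl fun c' _ =>
    Finset.sum_congr rfl fun i _ => Finset.sum_congr rfl fun i' _ => ?_
  ring

/-- The pullback of bigraded forms under matrices. -/
def biPull (A : Matrix (Fin p) (Fin p) ℝ) (B : Matrix (Fin q) (Fin q) ℝ) (a : BiAlt p q u v) :
    BiAlt p q u v :=
  ((altPullback A.mulVecLin).compAlternatingMap a).compLinearMap B.mulVecLin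

theorem biPull_apply (A : Matrix (Fin p) (Fin p) ℝ) (B : Matrix (Fin q) (Fin q) ℝ)
    (a : BiAlt p q u v) (y : Fin u → Fin q → ℝ) (x : Fin v → Fin p → ℝ) :
    biPull A B a y x = a (fun i => B.mulVec (y i)) (fun j => A.mulVec (x j)) := rfl

theorem biAlt_ext {a a' : BiAlt p q u v}
    (h : ∀ y x, a y x = a' y x) : a = a' := by
  ext y x
  exact h y x

theorem biForm_biPull (A H : Matrix (Fin p) (Fin p) ℝ) (B N : Matrix (Fin q) (Fin q) ℝ)
    (a a' : BiAlt p q u v) :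
    biForm N H (biPull A B a) (biPull A B a') =
      biForm (B * N * B.transpose) (A * H * A.transpose) a a' := by
  have h1 : biForm N H (biPull A B a) (biPull A B a') =
      biForm N (A * H * A.transpose) (biPull 1 B a) (biPull 1 B a') := by
    unfold biForm
    congr 1
    refine Finset.sum_congr rfl fun c _ => Finset.sum_congr rfl fun c' _ => ?_
    rw [← formInner_comp]
    congr 2
    · ext x; simp [biPull_apply]
    · ext x; simp [biPull_apply]
  rw [h1, biForm_eq_leafEval, biForm_eq_leafEval]
  have h2 : ∀ (a : BiAlt p q u v) (x : Fin v → Fin p → ℝ),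
      leafEval (biPull 1 B a) x = (leafEval a x).compLinearMap B.mulVecLin := by
    intro a x
    ext y
    simp [biPull_apply, leafEval_apply]
  refine congrArg _ (Finset.sum_congr rfl fun c _ => Finset.sum_congr rfl fun c' _ => ?_)
  rw [h2, h2, formInner_comp]

theorem biForm_hodgeStar_leaf {v' : ℕ} (hv : v + v' = p) (N : Matrix (Fin q) (Fin q) ℝ)
    {H : Matrix (Fin p) (Fin p) ℝ} (hH : H.PosDef) {vol : (Fin p → ℝ) [⋀^Fin p]→ₗ[ℝ] ℝ}
    (hvol : formInner H vol vol = 1) (a a' : BiAlt p q u v) :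
    biForm N H ((hodgeStar hv H vol).compAlternatingMap a)
      ((hodgeStar hv H vol).compAlternatingMap a') = biForm N H a a' := by
  unfold biForm
  congr 1
  refine Finset.sum_congr rfl fun c _ => Finset.sum_congr rfl fun c' _ => ?_
  simp only [LinearMap.compAlternatingMap_apply]
  rw [formInner_hodgeStar hv hH hvol]

theorem leafEval_hodgeStar {u' : ℕ} (hu : u + u' = q) (N : Matrix (Fin q) (Fin q) ℝ)
    (vol : (Fin q → ℝ) [⋀^Fin q]→ₗ[ℝ] ℝ) (a : BiAlt p q u v) (x : Fin v → Fin p → ℝ) :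
    leafEval (hodgeStar hu N vol a) x = hodgeStar hu N vol (leafEval a x) := by
  ext y
  exact map_hodgeStar hu N vol a (altEval x) y

theorem biForm_hodgeStar_perp {u' : ℕ} (hu : u + u' = q) (H : Matrix (Fin p) (Fin p) ℝ)
    {N : Matrix (Fin q) (Fin q) ℝ} (hN : N.PosDef) {vol : (Fin q → ℝ) [⋀^Fin q]→ₗ[ℝ] ℝ}
    (hvol : formInner N vol vol = 1) (a a' : BiAlt p q u v) :
    biForm N H (hodgeStar hu N vol a) (hodgeStar hu N vol a') = biForm N H a a' := by
  rw [biForm_eq_leafEval, biForm_eq_leafEval]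
  congr 1
  refine Finset.sum_congr rfl fun c _ => Finset.sum_congr rfl fun c' _ => ?_
  rw [leafEval_hodgeStar, leafEval_hodgeStar, formInner_hodgeStar hu hN hvol]

theorem hodgeStar_biPull_perp {u' : ℕ} (hu : u + u' = q) (A : Matrix (Fin p) (Fin p) ℝ)
    (B N : Matrix (Fin q) (Fin q) ℝ) (vol : (Fin q → ℝ) [⋀^Fin q]→ₗ[ℝ] ℝ) (a : BiAlt p q u v) :
    hodgeStar hu N (vol.compLinearMap B.mulVecLin) (biPull A B a) =
      biPull A B (hodgeStar hu (B * N * B.transpose) vol a) := by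
  refine biAlt_ext fun y x => ?_
  rw [← leafEval_apply, leafEval_hodgeStar, biPull_apply, ← leafEval_apply _ (fun j => _),
    leafEval_hodgeStar]
  exact congrArg (fun f : (Fin q → ℝ) [⋀^Fin u']→ₗ[ℝ] ℝ => f y)
    (hodgeStar_comp hu B N vol (leafEval a fun j => A.mulVec (x j)))

theorem hodgeStar_biPull_leaf {v' : ℕ} (hv : v + v' = p) (A H : Matrix (Fin p) (Fin p) ℝ)
    (B : Matrix (Fin q) (Fin q) ℝ) (vol : (Fin p → ℝ) [⋀^Fin p]→ₗ[ℝ] ℝ) (a : BiAlt p q u v) :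
    (hodgeStar hv H (vol.compLinearMap A.mulVecLin)).compAlternatingMap (biPull A B a) =
      biPull A B ((hodgeStar hv (A * H * A.transpose) vol).compAlternatingMap a) := by
  refine biAlt_ext fun y x => ?_
  exact congrArg (fun f : (Fin p → ℝ) [⋀^Fin v']→ₗ[ℝ] ℝ => f x)
    (hodgeStar_comp hv A H vol (a fun j => B.mulVec (y j)))

theorem biForm_smul_right (N : Matrix (Fin q) (Fin q) ℝ) (H : Matrix (Fin p) (Fin p) ℝ) (c : ℝ)
    (a a' : BiAlt p q u v) : biForm N H a (c • a') = c * biForm N H a a' := by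
  simp only [biForm, AlternatingMap.smul_apply, formInner_smul_right, Finset.mul_sum]
  refine Finset.sum_congr rfl fun i _ => Finset.sum_congr rfl fun j _ => ?_
  ring

theorem biForm_add_right (N : Matrix (Fin q) (Fin q) ℝ) (H : Matrix (Fin p) (Fin p) ℝ)
    (a a' a'' : BiAlt p q u v) :
    biForm N H a (a' + a'') = biForm N H a a' + biForm N H a a'' := by
  simp only [biForm, AlternatingMap.add_apply, formInner_add_right, mul_add,
    Finset.sum_add_distrib]

theorem biForm_comm {N : Matrix (Fin q) (Fin q) ℝ} {H : Matrix (Fin p) (Fin p) ℝ}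
    (hN : N.transpose = N) (hH : H.transpose = H) (a a' : BiAlt p q u v) :
    biForm N H a a' = biForm N H a' a := by
  have hs : ∀ a b, N a b = N b a := fun a b => by
    conv_lhs => rw [← hN]
    rfl
  unfold biForm
  rw [Finset.sum_comm]
  congr 1
  refine Finset.sum_congr rfl fun i _ => Finset.sum_congr rfl fun j _ => ?_
  rw [Finset.prod_congr rfl fun m _ => hs (j m) (i m), formInner_comm hH]

theorem biForm_one_self (a : BiAlt p q u v) : biForm 1 1 a a =
    (u.factorial : ℝ)⁻¹ * ∑ c : Fin u → Fin q, (v.factorial : ℝ)⁻¹ * ∑ i : Fin v → Fin p,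
      a (fun m => stdE (c m)) (fun m => stdE (i m)) *
        a (fun m => stdE (c m)) (fun m => stdE (i m)) := by
  unfold biForm
  simp only [prod_one_apply, ite_mul, one_mul, zero_mul, Finset.sum_ite_eq, Finset.mem_univ,
    if_true, formInner_one]

theorem biForm_self_nonneg {N : Matrix (Fin q) (Fin q) ℝ} {H : Matrix (Fin p) (Fin p) ℝ}
    (hN : N.PosDef) (hH : H.PosDef) (a : BiAlt p q u v) : 0 ≤ biForm N H a a := by
  obtain ⟨A, rfl, -⟩ := exists_mul_transpose_eq hH
  obtain ⟨B, rfl, -⟩ := exists_mul_transpose_eq hN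
  rw [← biForm_biPull, biForm_one_self]
  refine mul_nonneg (by positivity) (Finset.sum_nonneg fun c _ => mul_nonneg (by positivity)
    (Finset.sum_nonneg fun i _ => mul_self_nonneg _))

theorem biAlt_eq_zero_of_stdE {a : BiAlt p q u v}
    (h : ∀ (c : Fin u → Fin q) (i : Fin v → Fin p),
      a (fun m => stdE (c m)) (fun m => stdE (i m)) = 0) : a = 0 := by
  refine Module.Basis.ext_alternating (Pi.basisFun ℝ (Fin q)) fun c _ => ?_
  refine Module.Basis.ext_alternating (Pi.basisFun ℝ (Fin p)) fun i _ => ?_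
  have e1 : (fun m => Pi.basisFun ℝ (Fin q) (c m)) = fun m => stdE (c m) := by
    funext m; simp
  have e2 : (fun m => Pi.basisFun ℝ (Fin p) (i m)) = fun m => stdE (i m) := by
    funext m; simp
  rw [e1, e2, h]
  rfl

theorem eq_zero_of_biForm_self {N : Matrix (Fin q) (Fin q) ℝ} {H : Matrix (Fin p) (Fin p) ℝ}
    (hN : N.PosDef) (hH : H.PosDef) {a : BiAlt p q u v} (h : biForm N H a a = 0) : a = 0 := by
  obtain ⟨A, rfl, hA⟩ := exists_mul_transpose_eq hH
  obtain ⟨B, rfl, hB⟩ := exists_mul_transpose_eq hN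
  rw [← biForm_biPull, biForm_one_self] at h
  have hu : (u.factorial : ℝ)⁻¹ ≠ 0 := inv_ne_zero (Nat.cast_ne_zero.mpr (Nat.factorial_ne_zero u))
  have hv : (v.factorial : ℝ)⁻¹ ≠ 0 := inv_ne_zero (Nat.cast_ne_zero.mpr (Nat.factorial_ne_zero v))
  have h0 : biPull A B a = 0 := by
    refine biAlt_eq_zero_of_stdE fun c i => ?_
    have h1 := (mul_eq_zero.mp h).resolve_left hu
    rw [Finset.sum_eq_zero_iff_of_nonneg (fun c _ => mul_nonneg (by positivity)
      (Finset.sum_nonneg fun i _ => mul_self_nonneg _))] at h1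
    have h2 := (mul_eq_zero.mp (h1 c (Finset.mem_univ _))).resolve_left hv
    rw [Finset.sum_eq_zero_iff_of_nonneg (fun i _ => mul_self_nonneg _)] at h2
    exact mul_self_eq_zero.mp (h2 i (Finset.mem_univ _))
  refine biAlt_ext fun y x => ?_
  choose f hf using hA
  choose g hg using hB
  have := congrArg (fun a : BiAlt p q u v => a (fun i => g (y i)) (fun j => f (x j))) h0
  simp only [biPull_apply] at this
  simp only [Matrix.mulVecLin_apply] at hf hg
  simpa [hf, hg] using this

end BiForms

/-! ### Scalar products on a flagged vector space -/

section Flag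

variable {p q u v : ℕ}

/-- Symmetric positive definite bilinear forms. -/
structure IsScalarProduct (b : Bilin p q) : Prop where
  symm : ∀ v w, b v w = b w v
  pos : ∀ v, v ≠ 0 → 0 < b v v

/-- A linear map that preserves the flag `ℝ^p × 0`, with diagonal blocks `A` and `B`. -/
structure IsFlagMap (D : Model p q →L[ℝ] Model p q) (A : Matrix (Fin p) (Fin p) ℝ)
    (B : Matrix (Fin q) (Fin q) ℝ) : Prop where
  inl : ∀ X, D (X, 0) = (A.mulVec X, 0)
  inr : ∀ Y, (D (0, Y)).2 = B.mulVec Y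
  unit_leaf : IsUnit A.det
  unit_normal : IsUnit B.det

theorem IsFlagMap.snd {D : Model p q →L[ℝ] Model p q} {A : Matrix (Fin p) (Fin p) ℝ}
    {B : Matrix (Fin q) (Fin q) ℝ} (hD : IsFlagMap D A B) (w : Model p q) :
    (D w).2 = B.mulVec w.2 := by
  have : w = (w.1, 0) + (0, w.2) := by simp
  rw [this, map_add, hD.inl, Prod.snd_add, hD.inr]
  simp

theorem mulVec_injective {n : ℕ} {A : Matrix (Fin n) (Fin n) ℝ} (hA : IsUnit A.det) :
    Function.Injective A.mulVec :=
  Matrix.mulVec_injective_iff_isUnit.mpr ((Matrix.isUnit_iff_isUnit_det A).mpr hA)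

theorem IsFlagMap.injective {D : Model p q →L[ℝ] Model p q} {A : Matrix (Fin p) (Fin p) ℝ}
    {B : Matrix (Fin q) (Fin q) ℝ} (hD : IsFlagMap D A B) : Function.Injective D := by
  rw [injective_iff_map_eq_zero]
  intro w hw
  have h2 : w.2 = 0 := by
    apply mulVec_injective hD.unit_normal
    rw [← hD.snd, hw, Matrix.mulVec_zero]; rfl
  have hw' : w = (w.1, 0) := by rw [← h2]
  have h1 : w.1 = 0 := by
    apply mulVec_injective hD.unit_leaf
    rw [hw', hD.inl] at hw
    rw [Matrix.mulVec_zero]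
    exact congrArg Prod.fst hw
  rw [hw', h1]; rfl

theorem IsScalarProduct.comp {b : Bilin p q} (hb : IsScalarProduct b)
    {D : Model p q →L[ℝ] Model p q} (hD : Function.Injective D) :
    IsScalarProduct (b.bilinearComp D D) where
  symm _ _ := hb.symm _ _
  pos _ hv := hb.pos _ fun h => hv (hD (Eq.trans h (map_zero D).symm))

/-- The Gram matrix of a positive definite form on linearly independent vectors. -/
theorem posDef_gram {n : ℕ} {b : Bilin p q} (hb : IsScalarProduct b)
    (f : (Fin n → ℝ) →ₗ[ℝ] Model p q) (hf : Function.Injective f) :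
    (Matrix.of fun i j => b (f (stdE i)) (f (stdE j))).PosDef := by
  have hx : ∀ x : Fin n → ℝ, f x = ∑ i, x i • f (stdE i) := by
    intro x
    conv_lhs => rw [← Finset.univ_sum_single x]
    rw [map_sum]
    refine Finset.sum_congr rfl fun i _ => ?_
    rw [← map_smul]
    congr 1
    rw [← Pi.single_smul]; simp
  refine Matrix.PosDef.of_dotProduct_mulVec_pos ?_ ?_
  · ext i j
    simp [hb.symm (f (stdE i))]
  · intro x hx0
    have h := hb.pos (f x) fun h => hx0 (hf (by rw [h, map_zero]))
    have e : star x ⬝ᵥ (Matrix.of fun i j => b (f (stdE i)) (f (stdE j))).mulVec x =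
        b (f x) (f x) := by
      rw [hx x]
      simp only [map_sum, map_smul, sum_apply, smul_apply,
        dotProduct, Matrix.mulVec, Matrix.of_apply, star_trivial, smul_eq_mul]
      simp only [Finset.mul_sum]
      rw [Finset.sum_comm]
      refine Finset.sum_congr rfl fun i _ => Finset.sum_congr rfl fun j _ => ?_
      ring
    rw [e]
    exact h

theorem normalLift_snd (b : Bilin p q) (y : Fin q → ℝ) : (normalLift b y).2 = y := rfl

theorem leafGram_posDef {b : Bilin p q} (hb : IsScalarProduct b) : (leafGram b).PosDef :=
  posDef_gram hb (LinearMap.inl ℝ _ _) LinearMap.inl_injective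

theorem normalGram_posDef {b : Bilin p q} (hb : IsScalarProduct b) : (normalGram b).PosDef :=
  posDef_gram hb (normalLift b) fun y y' h => by
    simpa [normalLift_snd] using congrArg Prod.snd h

theorem inl_eq_sum (X : Fin p → ℝ) :
    ((X, 0) : Model p q) = ∑ i, X i • ((stdE i, 0) : Model p q) := by
  have h : (LinearMap.inl ℝ (Fin p → ℝ) (Fin q → ℝ)) X =
      ∑ i, X i • (LinearMap.inl ℝ (Fin p → ℝ) (Fin q → ℝ)) (stdE i) := by
    simp only [← map_smul, ← map_sum]
    congr 1
    conv_lhs => rw [← Finset.univ_sum_single X]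
    refine Finset.sum_congr rfl fun i _ => ?_
    rw [← Pi.single_smul]; simp
  simpa using h

theorem leafGram_mulVec (b : Bilin p q) (X : Fin p → ℝ) (i : Fin p) :
    (leafGram b).mulVec X i = b (stdE i, 0) (X, 0) := by
  conv_rhs => rw [inl_eq_sum X]
  simp only [Matrix.mulVec, dotProduct, leafGram, map_sum, map_smul, Matrix.of_apply, smul_eq_mul,
    mul_comm (X _)]

theorem normalLift_orthogonal {b : Bilin p q} (hb : IsScalarProduct b) (y : Fin q → ℝ)
    (X : Fin p → ℝ) : b (X, 0) (normalLift b y) = 0 := by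
  have key : ∀ i, b (stdE i, 0) (normalLift b y) = 0 := by
    intro i
    have hdet : IsUnit (leafGram b).det := isUnit_iff_ne_zero.mpr (leafGram_posDef hb).det_pos.ne'
    set t : Fin p → ℝ := fun i => b (stdE i, 0) (0, y) with ht
    have e : normalLift b y = (-((leafGram b)⁻¹.mulVec t), 0) + (0, y) := by
      refine Prod.ext ?_ (by simp [normalLift_snd])
      simp only [Prod.fst_add, add_zero]
      rfl
    rw [e, map_add, ← leafGram_mulVec b, Matrix.mulVec_neg, Matrix.mulVec_mulVec,
      Matrix.mul_nonsing_inv _ hdet, Matrix.one_mulVec]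
    simp [ht]
  rw [inl_eq_sum X]
  simp only [map_sum, map_smul, sum_apply, smul_apply, key, smul_zero, Finset.sum_const_zero]

theorem eq_normalLift {b : Bilin p q} (hb : IsScalarProduct b) (w : Model p q)
    (hw : ∀ X, b (X, 0) w = 0) : w = normalLift b w.2 := by
  by_contra hne
  have hsub : w - normalLift b w.2 ≠ 0 := sub_ne_zero.mpr hne
  have h0 : w - normalLift b w.2 = ((w - normalLift b w.2).1, 0) := by
    ext <;> simp [normalLift_snd]
  have := hb.pos _ hsub
  have hz : b ((w - normalLift b w.2).1, 0) (w - normalLift b w.2) = 0 := by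
    rw [map_sub, hw, normalLift_orthogonal hb, sub_zero]
  rw [← h0] at hz
  exact this.ne' hz

theorem eq_leafProj_add (b : Bilin p q) (w : Model p q) :
    w = (leafProj b w, 0) + normalLift b w.2 := by
  refine Prod.ext ?_ ?_
  · simp [leafProj]
  · simp [normalLift_snd]

theorem leafProj_inl (b : Bilin p q) (X : Fin p → ℝ) : leafProj b (X, 0) = X := by
  simp [leafProj]

theorem leafProj_normalLift (b : Bilin p q) (y : Fin q → ℝ) : leafProj b (normalLift b y) = 0 := by
  simp [leafProj, normalLift_snd]

/-- D maps the leafwise space onto itself, hence maps the orthogonal complement for the pulled-back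
product into the complement for b; the vector is then identified by its transverse part. So the
off-diagonal block of D plays no role for bigraded forms. -/
theorem IsFlagMap.normalLift {b : Bilin p q} (hb : IsScalarProduct b)
    {D : Model p q →L[ℝ] Model p q} {A : Matrix (Fin p) (Fin p) ℝ} {B : Matrix (Fin q) (Fin q) ℝ}
    (hD : IsFlagMap D A B) (y : Fin q → ℝ) :
    D (normalLift (b.bilinearComp D D) y) = FoliatedHodge.normalLift b (B.mulVec y) := by
  have h := eq_normalLift hb (D (FoliatedHodge.normalLift (b.bilinearComp D D) y)) (by
    intro X
    have hX : X = A.mulVec (A⁻¹.mulVec X) := by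
      rw [Matrix.mulVec_mulVec, Matrix.mul_nonsing_inv _ hD.unit_leaf, Matrix.one_mulVec]
    rw [hX, ← hD.inl]
    exact normalLift_orthogonal (hb.comp hD.injective) y (A⁻¹.mulVec X))
  rw [h, hD.snd, normalLift_snd]

theorem IsFlagMap.leafProj {b : Bilin p q} (hb : IsScalarProduct b)
    {D : Model p q →L[ℝ] Model p q} {A : Matrix (Fin p) (Fin p) ℝ} {B : Matrix (Fin q) (Fin q) ℝ}
    (hD : IsFlagMap D A B) (w : Model p q) :
    leafProj b (D w) = A.mulVec (FoliatedHodge.leafProj (b.bilinearComp D D) w) := by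
  conv_lhs => rw [eq_leafProj_add (b.bilinearComp D D) w, map_add, hD.inl, hD.normalLift hb]
  rw [map_add, leafProj_inl, leafProj_normalLift, add_zero]

theorem IsFlagMap.leafGram (b : Bilin p q) {D : Model p q →L[ℝ] Model p q}
    {A : Matrix (Fin p) (Fin p) ℝ} {B : Matrix (Fin q) (Fin q) ℝ} (hD : IsFlagMap D A B) :
    leafGram (b.bilinearComp D D) = A.transpose * leafGram b * A := by
  ext i j
  have h : ∀ i, D (stdE i, 0) = ∑ a, A a i • ((stdE a, 0) : Model p q) := by
    intro i
    rw [hD.inl, inl_eq_sum]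
    simp
  change b (D (stdE i, 0)) (D (stdE j, 0)) = _
  rw [h, h]
  simp only [map_sum, map_smul, sum_apply, smul_apply, Matrix.mul_apply, Matrix.transpose_apply,
    smul_eq_mul, Finset.sum_mul, Finset.mul_sum]
  refine Finset.sum_congr rfl fun a _ => Finset.sum_congr rfl fun c _ => ?_
  change _ = A c i * b (stdE c, 0) (stdE a, 0) * A a j
  ring

theorem IsFlagMap.normalGram {b : Bilin p q} (hb : IsScalarProduct b)
    {D : Model p q →L[ℝ] Model p q} {A : Matrix (Fin p) (Fin p) ℝ} {B : Matrix (Fin q) (Fin q) ℝ}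
    (hD : IsFlagMap D A B) :
    normalGram (b.bilinearComp D D) = B.transpose * normalGram b * B := by
  ext i j
  have h : ∀ i, D (FoliatedHodge.normalLift (b.bilinearComp D D) (stdE i)) =
      ∑ a, B a i • FoliatedHodge.normalLift b (stdE a) := by
    intro i
    rw [hD.normalLift hb, ← Finset.univ_sum_single (B.mulVec (stdE i)), map_sum]
    refine Finset.sum_congr rfl fun a _ => ?_
    rw [← map_smul]
    congr 1
    rw [← Pi.single_smul]
    simp
  change b (D (FoliatedHodge.normalLift (b.bilinearComp D D) (stdE i)))
    (D (FoliatedHodge.normalLift (b.bilinearComp D D) (stdE j))) = _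
  rw [h, h]
  simp only [map_sum, map_smul, sum_apply, smul_apply, Matrix.mul_apply, Matrix.transpose_apply,
    smul_eq_mul, Finset.sum_mul, Finset.mul_sum]
  refine Finset.sum_congr rfl fun a _ => Finset.sum_congr rfl fun c _ => ?_
  change _ = B c i * b (FoliatedHodge.normalLift b (stdE c)) (FoliatedHodge.normalLift b (stdE a)) *
    B a j
  ring

theorem mul_inv_conj_mul {n : ℕ} {A G : Matrix (Fin n) (Fin n) ℝ} (hA : IsUnit A.det) :
    A * (A.transpose * G * A)⁻¹ * A.transpose = G⁻¹ := by
  have hA' : IsUnit A.transpose.det := by rwa [Matrix.det_transpose]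
  rw [Matrix.mul_inv_rev, Matrix.mul_inv_rev, ← mul_assoc, ← mul_assoc,
    Matrix.mul_nonsing_inv _ hA, one_mul, mul_assoc, Matrix.nonsing_inv_mul _ hA', mul_one]

theorem toBi_apply (b : Bilin p q) (f : Model p q [⋀^Fin (u + v)]→L[ℝ] ℝ)
    (y : Fin u → Fin q → ℝ) (x : Fin v → Fin p → ℝ) :
    toBi b f y x = f (Fin.append (fun i => normalLift b (y i)) (fun j => (x j, 0))) := by
  exact splitAlt_apply f.toAlternatingMap _ _

theorem toForm_apply (b : Bilin p q) (a : BiAlt p q u v) (w : Fin (u + v) → Model p q) :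
    toForm b a w = ((u.factorial : ℝ) * (v.factorial : ℝ))⁻¹ *
      ∑ σ : Equiv.Perm (Fin (u + v)), (Equiv.Perm.sign σ : ℤ) *
        a (fun i => (w (σ (Fin.castAdd v i))).2)
          (fun j => leafProj b (w (σ (Fin.natAdd u j)))) := by
  change ((((u.factorial : ℝ) * (v.factorial : ℝ))⁻¹) • MultilinearMap.alternatization _) w = _
  rw [AlternatingMap.smul_apply, MultilinearMap.alternatization_apply, smul_eq_mul]
  congr 1
  refine Finset.sum_congr rfl fun σ _ => ?_
  rw [Units.smul_def, zsmul_eq_mul]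
  rfl

theorem toBi_comp {b : Bilin p q} (hb : IsScalarProduct b)
    {D : Model p q →L[ℝ] Model p q} {A : Matrix (Fin p) (Fin p) ℝ} {B : Matrix (Fin q) (Fin q) ℝ}
    (hD : IsFlagMap D A B) (f : Model p q [⋀^Fin (u + v)]→L[ℝ] ℝ) :
    toBi (b.bilinearComp D D) (f.compContinuousLinearMap D) = biPull A B (toBi b f) := by
  refine biAlt_ext fun y x => ?_
  rw [toBi_apply, biPull_apply, toBi_apply, ContinuousAlternatingMap.compContinuousLinearMap_apply]
  congr 1
  funext t
  refine Fin.addCases (fun i => ?_) (fun i => ?_) t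
  · simp [hD.normalLift hb]
  · simp [hD.inl]

theorem toForm_comp {b : Bilin p q} (hb : IsScalarProduct b)
    {D : Model p q →L[ℝ] Model p q} {A : Matrix (Fin p) (Fin p) ℝ} {B : Matrix (Fin q) (Fin q) ℝ}
    (hD : IsFlagMap D A B) (a : BiAlt p q u v) :
    (toForm b a).compContinuousLinearMap D = toForm (b.bilinearComp D D) (biPull A B a) := by
  ext w
  rw [ContinuousAlternatingMap.compContinuousLinearMap_apply, toForm_apply, toForm_apply]
  congr 1
  refine Finset.sum_congr rfl fun σ _ => ?_
  rw [biPull_apply]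
  simp only [Function.comp, hD.snd, hD.leafProj hb]

theorem biInner_comp {b : Bilin p q} (hb : IsScalarProduct b)
    {D : Model p q →L[ℝ] Model p q} {A : Matrix (Fin p) (Fin p) ℝ} {B : Matrix (Fin q) (Fin q) ℝ}
    (hD : IsFlagMap D A B) (a a' : BiAlt p q u v) :
    biInner (b.bilinearComp D D) (biPull A B a) (biPull A B a') = biInner b a a' := by
  rw [biInner_eq_biForm, biInner_eq_biForm, biForm_biPull, hD.leafGram, hD.normalGram hb,
    mul_inv_conj_mul hD.unit_leaf, mul_inv_conj_mul hD.unit_normal]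

/-- A tuple of vectors each of which is leafwise or normal. -/
def pureTuple (b : Bilin p q) {k : ℕ} (s : Fin k → (Fin p → ℝ) ⊕ (Fin q → ℝ)) :
    Fin k → Model p q :=
  fun t => Sum.elim (fun X => (X, 0)) (fun Y => normalLift b Y) (s t)

/-- On normal vectors followed by leafwise ones, a permutation that mixes the blocks puts a leafwise
vector into a normal slot and contributes zero. The u! v! block permutations contribute equal terms,
and the normalising factor cancels their number. -/
theorem toBi_toForm (b : Bilin p q) (a : BiAlt p q u v) : toBi b (toForm b a) = a := by
  classical
  refine biAlt_ext fun y x => ?_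
  rw [toBi_apply, toForm_apply]
  set w : Fin (u + v) → Model p q :=
    Fin.append (fun i => normalLift b (y i)) (fun j => (x j, 0)) with hw
  have hwl : ∀ i, w (Fin.castAdd v i) = normalLift b (y i) := fun i => by simp [hw]
  have hwr : ∀ j, w (Fin.natAdd u j) = (x j, 0) := fun j => by simp [hw]
  let E : Equiv.Perm (Fin u) × Equiv.Perm (Fin v) → Equiv.Perm (Fin (u + v)) := fun τ =>
    finSumFinEquiv.permCongr (Equiv.Perm.sumCongrHom _ _ τ)
  have hE : Function.Injective E :=
    finSumFinEquiv.permCongr.injective.comp Equiv.Perm.sumCongrHom_injective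
  have hEl : ∀ τ i, E τ (Fin.castAdd v i) = Fin.castAdd v (τ.1 i) := by
    intro τ i
    simp [E, Equiv.permCongr_apply]
  have hEr : ∀ τ j, E τ (Fin.natAdd u j) = Fin.natAdd u (τ.2 j) := by
    intro τ i
    simp [E, Equiv.permCongr_apply]
  have hf : ((u.factorial : ℝ) * (v.factorial : ℝ)) ≠ 0 :=
    mul_ne_zero (Nat.cast_ne_zero.mpr (Nat.factorial_ne_zero u))
      (Nat.cast_ne_zero.mpr (Nat.factorial_ne_zero v))
  rw [← Fintype.sum_of_injective E hE (fun _ => a y x)]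
  · simp only [Finset.sum_const, Finset.card_univ, Fintype.card_prod, Fintype.card_perm,
      Fintype.card_fin, nsmul_eq_mul, Nat.cast_mul]
    field_simp
  · intro σ hσ
    by_cases h : ∀ i, ∃ i', σ (Fin.castAdd v i) = Fin.castAdd v i'
    · exfalso
      apply hσ
      have hm := Equiv.Perm.mem_sumCongrHom_range_of_perm_mapsTo_inl
        (σ := finSumFinEquiv.symm.permCongr σ) (by
          rintro _ ⟨i, rfl⟩
          obtain ⟨i', hi'⟩ := h i
          exact ⟨i', by simp [Equiv.permCongr_apply, hi']⟩)
      obtain ⟨τ, hτ⟩ := hm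
      refine ⟨τ, ?_⟩
      simp only [E]
      rw [hτ]
      ext t
      simp [Equiv.permCongr_apply]
    · push Not at h
      obtain ⟨i, hi⟩ := h
      have h0 : (w (σ (Fin.castAdd v i))).2 = 0 := by
        generalize σ (Fin.castAdd v i) = t at hi ⊢
        induction t using Fin.addCases with
        | left t => exact absurd rfl (hi t)
        -- A permutation outside the range of E places a leafwise vector in a normal slot, where
        -- only the transverse component, zero, is seen.
        | right t => rw [hwr]
      rw [a.map_coord_zero i h0]
      simp
  · intro τ
    simp only [hEl, hEr, hwl, hwr, leafProj_inl, normalLift_snd]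
    have h1 : a (fun i => y (τ.1 i)) = Equiv.Perm.sign τ.1 • a y := a.map_perm y τ.1
    have h2 : ∀ f : (Fin p → ℝ) [⋀^Fin v]→ₗ[ℝ] ℝ,
        f (fun i => x (τ.2 i)) = Equiv.Perm.sign τ.2 • f x := fun f => f.map_perm x τ.2
    have h3 : Equiv.Perm.sign (E τ) = Equiv.Perm.sign τ.1 * Equiv.Perm.sign τ.2 := by
      simp only [E, Equiv.Perm.sign_permCongr, Equiv.Perm.sumCongrHom_apply,
        Equiv.Perm.sign_sumCongr]
    rw [h1, h3, h2]
    rcases Int.units_eq_one_or (Equiv.Perm.sign τ.1) with h | h <;>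
    rcases Int.units_eq_one_or (Equiv.Perm.sign τ.2) with h' | h' <;> simp [h, h']

end Flag

/-! ### Forms of pure bidegree and multiplication by leafwise covectors -/

section Flag

variable {p q u v : ℕ}

/-- By the pigeonhole principle every permutation feeds one of the u normal slots with a vector that
has no transverse component. -/
theorem toForm_eq_zero_of_card_lt (b : Bilin p q) (a : BiAlt p q u v)
    (w : Fin (u + v) → Model p q) (s : Finset (Fin (u + v))) (hs : s.card < u)
    (hw : ∀ t ∉ s, (w t).2 = 0) : toForm b a w = 0 := by
  classical
  rw [toForm_apply, Finset.sum_eq_zero, mul_zero]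
  intro σ _
  obtain ⟨i, hi⟩ : ∃ i : Fin u, σ (Fin.castAdd v i) ∉ s := by
    by_contra h
    push Not at h
    have := Finset.card_le_card_of_injOn (s := (Finset.univ : Finset (Fin u)))
      (fun i => σ (Fin.castAdd v i)) (fun i _ => h i)
      ((σ.injective.comp (Fin.castAdd_injective u v)).injOn)
    simp at this
    omega
  rw [a.map_coord_zero i (hw _ hi)]
  simp

/-- If every normal slot receives a normal vector and their total number is not u, then some
leafwise slot also receives one, and the orthogonal projection to the leaf kills it. -/
theorem toForm_pureTuple_eq_zero (b : Bilin p q) (a : BiAlt p q u v)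
    (s : Fin (u + v) → (Fin p → ℝ) ⊕ (Fin q → ℝ))
    (hs : (Finset.univ.filter fun t => (s t).isRight).card ≠ u) :
    toForm b a (pureTuple b s) = 0 := by
  classical
  rw [toForm_apply, Finset.sum_eq_zero, mul_zero]
  intro σ _
  by_cases h1 : ∀ i : Fin u, (s (σ (Fin.castAdd v i))).isRight
  · obtain ⟨j, hj⟩ : ∃ j : Fin v, (s (σ (Fin.natAdd u j))).isRight := by
      by_contra h2
      push Not at h2
      apply hs
      have : (Finset.univ.filter fun t => (s t).isRight) =
          Finset.univ.image (fun i : Fin u => σ (Fin.castAdd v i)) := by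
        ext t
        simp only [Finset.mem_filter, Finset.mem_univ, true_and, Finset.mem_image]
        constructor
        · intro ht
          obtain ⟨t', rfl⟩ := σ.surjective t
          induction t' using Fin.addCases with
          | left i => exact ⟨i, rfl⟩
          | right j => exact absurd ht (h2 j)
        · rintro ⟨i, rfl⟩
          exact h1 i
      rw [this]
      exact (Finset.card_image_of_injective _
        (σ.injective.comp (Fin.castAdd_injective u v))).trans (by simp)
    have h0 : leafProj b (pureTuple b s (σ (Fin.natAdd u j))) = 0 := by
      obtain ⟨Y, hY⟩ := Sum.isRight_iff.mp hj
      simp [pureTuple, hY, leafProj_normalLift]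
    rw [AlternatingMap.map_coord_zero _ j h0]
    simp
  · push Not at h1
    obtain ⟨i, hi⟩ := h1
    have h0 : (pureTuple b s (σ (Fin.castAdd v i))).2 = 0 := by
      rw [ne_eq, Bool.not_eq_true, Sum.isRight_eq_false] at hi
      obtain ⟨X, hX⟩ := Sum.isLeft_iff.mp hi
      simp [pureTuple, hX]
    rw [a.map_coord_zero i h0]
    simp

/-- The decomposition of the tangent space into leafwise and normal vectors. -/
def splitEquiv (b : Bilin p q) : Model p q ≃ₗ[ℝ] Model p q where
  toFun w := (w.1, 0) + normalLift b w.2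
  invFun w := (leafProj b w, w.2)
  map_add' w w' := by
    refine Prod.ext ?_ ?_ <;> simp
    abel
  map_smul' c w := by
    refine Prod.ext ?_ ?_ <;> simp
  left_inv w := by
    refine Prod.ext ?_ ?_
    · simp [leafProj_inl, leafProj_normalLift]
    · simp [normalLift_snd]
  right_inv w := (eq_leafProj_add b w).symm

/-- It suffices to compare values on a basis adapted to the splitting. Tuples with a wrong number of
normal vectors give zero on both sides; the others are rearrangements of tuples with the normal
vectors first, and those values are recorded by `toBi`. -/
theorem eq_toForm_toBi (b : Bilin p q) (f : Model p q [⋀^Fin (u + v)]→L[ℝ] ℝ)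
    (hf : ∀ s : Fin (u + v) → (Fin p → ℝ) ⊕ (Fin q → ℝ),
      (Finset.univ.filter fun t => (s t).isRight).card ≠ u → f (pureTuple b s) = 0) :
    f = toForm b (toBi b f) := by
  classical
  apply ContinuousAlternatingMap.toAlternatingMap_injective
  let β := ((Pi.basisFun ℝ (Fin p)).prod (Pi.basisFun ℝ (Fin q))).map (splitEquiv b)
  refine Module.Basis.ext_alternating β fun c _ => ?_
  let s : Fin (u + v) → (Fin p → ℝ) ⊕ (Fin q → ℝ) := fun t => Sum.map stdE stdE (c t)
  have hs : (fun t => β (c t)) = pureTuple b s := by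
    funext t
    simp only [pureTuple, s, β]
    rcases c t with i | i <;> simp [splitEquiv]
  rw [hs]
  change f _ = toForm b (toBi b f) _
  by_cases hc : (Finset.univ.filter fun t => (s t).isRight).card = u
  · have hc' : (Finset.univ.filter fun t => (s t).isRight)ᶜ.card = v := by
      rw [Finset.card_compl, hc]; simp
    -- The permutation lists the positions of the normal vectors first and then the others; both
    -- alternating forms acquire its sign.
    let σ : Equiv.Perm (Fin (u + v)) :=
      finSumFinEquiv.symm.trans (finSumEquivOfFinset hc hc')
    have hl : ∀ i : Fin u, (s (σ (Fin.castAdd v i))).isRight := by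
      intro i
      have : σ (Fin.castAdd v i) ∈ Finset.univ.filter fun t => (s t).isRight := by
        simp only [σ, Equiv.trans_apply, finSumFinEquiv_symm_apply_castAdd,
          finSumEquivOfFinset_inl]
        exact Finset.orderEmbOfFin_mem _ hc i
      exact (Finset.mem_filter.mp this).2
    have hr : ∀ j : Fin v, (s (σ (Fin.natAdd u j))).isLeft := by
      intro i
      have : σ (Fin.natAdd u i) ∈ (Finset.univ.filter fun t => (s t).isRight)ᶜ := by
        simp only [σ, Equiv.trans_apply, finSumFinEquiv_symm_apply_natAdd,
          finSumEquivOfFinset_inr]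
        exact Finset.orderEmbOfFin_mem _ hc' i
      simpa using this
    choose Y hY using fun i => Sum.isRight_iff.mp (hl i)
    choose X hX using fun i => Sum.isLeft_iff.mp (hr i)
    have hw : pureTuple b s ∘ σ =
        Fin.append (fun i => normalLift b (Y i)) (fun j => (X j, 0)) := by
      funext t
      induction t using Fin.addCases with
      | left i => simp [pureTuple, hY]
      | right i => simp [pureTuple, hX]
    have h1 : f (pureTuple b s ∘ σ) = Equiv.Perm.sign σ • f (pureTuple b s) :=
      f.toAlternatingMap.map_perm _ σ
    have h2 : toForm b (toBi b f) (pureTuple b s ∘ σ) =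
        Equiv.Perm.sign σ • toForm b (toBi b f) (pureTuple b s) :=
      (toForm b (toBi b f)).toAlternatingMap.map_perm _ σ
    have h3 : f (pureTuple b s ∘ σ) = toForm b (toBi b f) (pureTuple b s ∘ σ) := by
      rw [hw, ← toBi_apply, ← toBi_apply, toBi_toForm]
    rw [h1, h2] at h3
    exact smul_left_cancel _ h3
  · rw [hf s hc, toForm_pureTuple_eq_zero b _ s hc]

theorem wedgeOne_apply {k : ℕ} (θ : Model p q [⋀^Fin 1]→L[ℝ] ℝ)
    (f : Model p q [⋀^Fin k]→L[ℝ] ℝ) (w : Fin (k + 1) → Model p q) :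
    wedgeOne θ f w =
      ∑ i : Fin (k + 1), (-1 : ℝ) ^ (i : ℕ) * (θ (fun _ => w i) * f (i.removeNth w)) := by
  rw [wedgeOne, ContinuousAlternatingMap.alternatizeUncurryFin_apply]
  refine Finset.sum_congr rfl fun i _ => ?_
  rw [zsmul_eq_mul]
  push_cast
  congr 1

/-- Exterior multiplication by a covector, as a linear map. -/
def altWedgeLM {V : Type*} [AddCommGroup V] [Module ℝ V] {k : ℕ} (ξ : V →ₗ[ℝ] ℝ) :
    (V [⋀^Fin k]→ₗ[ℝ] ℝ) →ₗ[ℝ] (V [⋀^Fin (k + 1)]→ₗ[ℝ] ℝ) where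
  toFun α := altWedge ξ α
  map_add' α β := by
    ext x
    simp only [altWedge_apply, AlternatingMap.add_apply, ← Finset.sum_add_distrib]
    exact Finset.sum_congr rfl fun i _ => by ring
  map_smul' c α := by
    ext x
    simp only [altWedge_apply, AlternatingMap.smul_apply, RingHom.id_apply, smul_eq_mul,
      Finset.mul_sum]
    exact Finset.sum_congr rfl fun i _ => by ring

/-- The leafwise covector of a form of bidegree `(0, 1)`. -/
def leafCovector (e : BiAlt p q 0 1) : (Fin p → ℝ) →ₗ[ℝ] ℝ :=
  (AlternatingMap.ofSubsingleton ℝ (Fin p → ℝ) ℝ (0 : Fin 1)).symm (e 0)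

theorem leafCovector_apply (e : BiAlt p q 0 1) (X : Fin p → ℝ) :
    leafCovector e X = e 0 (fun _ => X) := rfl

/-- Exterior multiplication of bigraded forms by a leafwise covector. -/
def biWedge (ξ : (Fin p → ℝ) →ₗ[ℝ] ℝ) (a : BiAlt p q u v) : BiAlt p q u (v + 1) :=
  (-1 : ℝ) ^ u • (altWedgeLM ξ).compAlternatingMap a

theorem biWedge_apply (ξ : (Fin p → ℝ) →ₗ[ℝ] ℝ) (a : BiAlt p q u v) (y : Fin u → Fin q → ℝ)
    (x : Fin (v + 1) → Fin p → ℝ) : biWedge ξ a y x = (-1 : ℝ) ^ u * altWedge ξ (a y) x := rfl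

theorem removeNth_append_natAdd {X : Type*} (y : Fin u → X) (x : Fin (v + 1) → X)
    (j : Fin (v + 1)) : (Fin.natAdd u j : Fin (u + v + 1)).removeNth
      (Fin.append y x : Fin (u + (v + 1)) → X) = Fin.append y (j.removeNth x) := by
  funext t
  simp only [Fin.removeNth]
  induction t using Fin.addCases with
  | left i =>
    have : (Fin.natAdd u j : Fin (u + v + 1)).succAbove (Fin.castAdd v i) =
        (Fin.castAdd (v + 1) i : Fin (u + (v + 1))) := by
      apply Fin.ext
      rw [Fin.succAbove_of_castSucc_lt]
      · simp
      · simp [Fin.lt_def]; omega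
    rw [this, Fin.append_left, Fin.append_left]
  | right i =>
    have : (Fin.natAdd u j : Fin (u + v + 1)).succAbove (Fin.natAdd u i) =
        (Fin.natAdd u (j.succAbove i) : Fin (u + (v + 1))) := by
      apply Fin.ext
      by_cases h : i.castSucc < j
      · rw [Fin.succAbove_of_castSucc_lt _ _ h, Fin.succAbove_of_castSucc_lt]
        · simp
        · simp only [Fin.lt_def, Fin.val_castSucc, Fin.val_natAdd] at h ⊢; omega
      · rw [Fin.succAbove_of_le_castSucc _ _ (not_lt.mp h), Fin.succAbove_of_le_castSucc]
        · simp [add_assoc]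
        · simp only [Fin.lt_def, Fin.le_def, Fin.val_castSucc, Fin.val_natAdd] at h ⊢; omega
    rw [this, Fin.append_right, Fin.append_right]
    rfl

theorem toForm_zero_one (b : Bilin p q) (e : BiAlt p q 0 1) (w : Model p q) :
    toForm b e (fun _ => w) = leafCovector e (leafProj b w) := by
  rw [toForm_apply]
  rw [leafCovector_apply, Subsingleton.elim (0 : Fin 0 → Fin q → ℝ) (fun _ => w.2)]
  simp

/-- A leafwise covector kills normal vectors, so only the removal of leafwise arguments contributes.
The leafwise argument j stands at position u + j, whence the factor (-1)^u in `biWedge`. -/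
theorem toBi_wedgeOne (b : Bilin p q) (e : BiAlt p q 0 1) (a : BiAlt p q u v) :
    toBi (u := u) (v := v + 1) b (wedgeOne (toForm b e) (toForm b a)) =
      biWedge (leafCovector e) a := by
  refine biAlt_ext fun y x => ?_
  rw [toBi_apply, biWedge_apply, altWedge_apply]
  refine (wedgeOne_apply (k := u + v) _ _ _).trans ?_
  refine (Fin.sum_univ_add (a := u) (b := v + 1) _).trans ?_
  have h1 : ∀ i : Fin u, toForm b e (fun _ : Fin (0 + 1) =>
      (Fin.append (fun i => normalLift b (y i)) (fun j => (x j, 0)) :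
        Fin (u + (v + 1)) → Model p q) (Fin.castAdd (v + 1) i)) = 0 := by
    intro i
    rw [toForm_zero_one, Fin.append_left, leafProj_normalLift, map_zero]
  rw [Finset.sum_eq_zero fun i _ => ?_, zero_add, Finset.mul_sum]
  · refine Finset.sum_congr rfl fun j _ => ?_
    have h2 : toForm b e (fun _ : Fin (0 + 1) =>
      (Fin.append (fun i => normalLift b (y i)) (fun j => (x j, 0)) :
        Fin (u + (v + 1)) → Model p q) (Fin.natAdd u j)) = leafCovector e (x j) := by
      rw [toForm_zero_one, Fin.append_right, leafProj_inl]
    have h3 : toForm b a ((Fin.natAdd u j : Fin (u + v + 1)).removeNth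
        (Fin.append (fun i => normalLift b (y i)) (fun j => (x j, 0)) :
          Fin (u + (v + 1)) → Model p q)) = a y (j.removeNth x) := by
      rw [removeNth_append_natAdd]
      have : (j.removeNth fun j => ((x j, 0) : Model p q)) =
          fun t => (j.removeNth x t, 0) := rfl
      rw [this, ← toBi_apply, toBi_toForm]
    rw [← h2, ← h3, ← mul_assoc ((-1 : ℝ) ^ u), ← pow_add]
    rfl
  · exact mul_eq_zero_of_right _ (mul_eq_zero_of_left (h1 i) _)

/-- The product must be shown to have no other components. On a pure tuple with a number of normal
vectors different from u, removing a leafwise vector leaves the wrong number for the second factor,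
and removing a normal one gives zero in the covector. -/
theorem wedgeOne_toForm (b : Bilin p q) (e : BiAlt p q 0 1) (a : BiAlt p q u v) :
    (wedgeOne (toForm b e) (toForm b a) : Model p q [⋀^Fin (u + (v + 1))]→L[ℝ] ℝ) =
      toForm b (biWedge (leafCovector e) a) := by
  rw [← toBi_wedgeOne b e a]
  refine eq_toForm_toBi (u := u) (v := v + 1) b _ fun s hs => ?_
  refine (wedgeOne_apply (k := u + v) _ _ _).trans (Finset.sum_eq_zero fun i _ => ?_)
  rcases hi : s i with X | Y
  · have : toForm b a (Fin.removeNth (n := u + v) i (pureTuple b s)) = 0 := by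
      refine toForm_pureTuple_eq_zero b a (Fin.removeNth (n := u + v) i s) fun hc => hs ?_
      refine Eq.trans ?_ hc
      have hmap : (Finset.univ.filter fun t => (s t).isRight) =
          (Finset.univ.filter fun t => (Fin.removeNth (n := u + v) i s t).isRight).map
            (Fin.succAboveEmb (n := u + v) i) := by
        ext t
        simp only [Finset.mem_filter, Finset.mem_univ, true_and, Finset.mem_map]
        constructor
        · intro ht
          have hne : t ≠ i := fun h => by rw [h, hi] at ht; simp at ht
          obtain ⟨t', rfl⟩ := Fin.exists_succAbove_eq (n := u + v) hne
          exact ⟨t', ht, rfl⟩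
        · rintro ⟨t', ht', rfl⟩
          exact ht'
      rw [hmap, Finset.card_map]
    exact mul_eq_zero_of_right _ (mul_eq_zero_of_right _ this)
  · have : toForm b e (fun _ : Fin (0 + 1) => pureTuple b s i) = 0 := by
      rw [toForm_zero_one]
      simp only [pureTuple, hi, Sum.elim_inr, leafProj_normalLift, map_zero]
    exact mul_eq_zero_of_right _ (mul_eq_zero_of_left this _)

/-- The value of a form that vanishes on more than `v` leafwise vectors, on `v` leafwise vectors
and `u` other vectors, depends only on the transverse components of the latter. -/
theorem apply_append_eq (f : Model p q [⋀^Fin (u + v)]→L[ℝ] ℝ)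
    (hf : ∀ (w : Fin (u + v) → Model p q) (s : Finset (Fin (u + v))), s.card < u →
      (∀ t ∉ s, (w t).2 = 0) → f w = 0)
    (W W' : Fin u → Model p q) (hW : ∀ i, (W i).2 = (W' i).2) (x : Fin v → Fin p → ℝ) :
    f (Fin.append W (fun j => (x j, 0))) = f (Fin.append W' (fun j => (x j, 0))) := by
  classical
  -- In the multilinear expansion of this sum, any term with a difference vector in some slot has
  -- fewer than u arguments with transverse component, and vanishes.
  have e : W = W' + (W - W') := by abel
  let g := ((altEval (W := ℝ) (fun j => ((x j, 0) : Model p q))).compAlternatingMap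
    (splitAlt f.toAlternatingMap)).toMultilinearMap
  have hg : ∀ Z : Fin u → Model p q, f (Fin.append Z (fun j => (x j, 0))) = g Z := by
    intro Z
    exact (splitAlt_apply f.toAlternatingMap Z (fun j => (x j, 0))).symm
  have hz : ∀ (Z : Fin u → Model p q) (i : Fin u), (Z i).2 = 0 → g Z = 0 := by
    intro Z i hi
    rw [← hg]
    refine hf _ ((Finset.univ.erase i).map (Fin.castAddEmb v)) ?_ ?_
    · rw [Finset.card_map, Finset.card_erase_of_mem (Finset.mem_univ i)]
      have : 0 < u := i.pos
      simp
      omega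
    · intro t ht
      induction t using Fin.addCases with
      | left t =>
        have : t = i := by
          by_contra hne
          apply ht
          rw [Finset.mem_map]
          exact ⟨t, by simp [hne], rfl⟩
        rw [this, Fin.append_left, hi]
      | right t => rw [Fin.append_right]
  rw [hg, hg, e, g.map_add_univ, Finset.sum_eq_single Finset.univ]
  · simp
  · intro s _ hs
    obtain ⟨i, hi⟩ : ∃ i, i ∉ s := by
      by_contra h
      push Not at h
      exact hs (Finset.eq_univ_iff_forall.mpr h)
    refine hz _ i ?_
    rw [Finset.piecewise_eq_of_notMem _ _ _ hi]
    simp [hW i]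
  · simp

end Flag

/-! ### Changes of charts -/

section Charts

variable {p q : ℕ} {M : Type*} [TopologicalSpace M] [ChartedSpace (Model p q) M]

theorem two_le_infty : (2 : WithTop ℕ∞) ≤ ∞ :=
  WithTop.coe_le_coe.mpr (le_top : (2 : ℕ∞) ≤ ⊤)

theorem contDiffOn_transition [IsManifold 𝓘(ℝ, Model p q) ∞ M]
    {c c' : OpenPartialHomeomorph M (Model p q)} (hc : c ∈ atlas (Model p q) M)
    (hc' : c' ∈ atlas (Model p q) M) :
    ContDiffOn ℝ ∞ (c' ∘ c.symm) (c.symm.trans c').source := by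
  have h := (contDiffGroupoid ∞ 𝓘(ℝ, Model p q)).compatible hc hc'
  have := contMDiffOn_of_mem_contDiffGroupoid h
  exact contMDiffOn_iff_contDiffOn.mp this

theorem contDiffAt_transition [IsManifold 𝓘(ℝ, Model p q) ∞ M]
    {c c' : OpenPartialHomeomorph M (Model p q)} (hc : c ∈ atlas (Model p q) M)
    (hc' : c' ∈ atlas (Model p q) M) {z : Model p q} (hz : z ∈ (c.symm.trans c').source) :
    ContDiffAt ℝ ∞ (c' ∘ c.symm) z :=
  (contDiffOn_transition hc hc').contDiffAt ((c.symm.trans c').open_source.mem_nhds hz)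

theorem mdifferentiableAt_chart_symm [IsManifold 𝓘(ℝ, Model p q) ∞ M]
    {c : OpenPartialHomeomorph M (Model p q)} (hc : c ∈ atlas (Model p q) M)
    {z : Model p q} (hz : z ∈ c.target) :
    MDifferentiableAt 𝓘(ℝ, Model p q) 𝓘(ℝ, Model p q) c.symm z :=
  ((contMDiffOn_symm_of_mem_maximalAtlas
    (IsManifold.subset_maximalAtlas (I := 𝓘(ℝ, Model p q)) (n := ∞) hc)).contMDiffAt
      (c.open_target.mem_nhds hz)).mdifferentiableAt (by simp)

theorem chartInvDeriv_eq_fderiv [IsManifold 𝓘(ℝ, Model p q) ∞ M]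
    {c : OpenPartialHomeomorph M (Model p q)} (hc : c ∈ atlas (Model p q) M)
    {z : Model p q} (hz : z ∈ c.target) :
    chartInvDeriv c z = fderiv ℝ (chartAt (Model p q) (c.symm z) ∘ c.symm) z := by
  unfold chartInvDeriv
  rw [(mdifferentiableAt_chart_symm hc hz).mfderiv]
  simp only [writtenInExtChartAt, mfld_simps, fderivWithin_univ]
  rfl

theorem mem_transition_source {S : Type*} [TopologicalSpace S]
    {c c' : OpenPartialHomeomorph S (Model p q)} {z : Model p q}
    (hz : z ∈ c.target) (hz' : c.symm z ∈ c'.source) : z ∈ (c.symm.trans c').source := by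
  simp only [mfld_simps, Set.mem_preimage]
  exact ⟨hz, hz'⟩

theorem chartInvDeriv_comp [IsManifold 𝓘(ℝ, Model p q) ∞ M]
    {c c' : OpenPartialHomeomorph M (Model p q)} (hc : c ∈ atlas (Model p q) M)
    (hc' : c' ∈ atlas (Model p q) M) {z : Model p q} (hz : z ∈ (c.symm.trans c').source) :
    chartInvDeriv c z =
      (chartInvDeriv c' (c' (c.symm z))).comp (fderiv ℝ (c' ∘ c.symm) z) := by
  have hz1 : z ∈ c.target := hz.1
  have hz2 : c.symm z ∈ c'.source := hz.2
  have hx : c'.symm (c' (c.symm z)) = c.symm z := c'.left_inv hz2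
  have hev : c.symm =ᶠ[𝓝 z] c'.symm ∘ (c' ∘ c.symm) := by
    filter_upwards [(c.symm.trans c').open_source.mem_nhds hz] with y hy
    exact (c'.left_inv hy.2).symm
  have ht : MDifferentiableAt 𝓘(ℝ, Model p q) 𝓘(ℝ, Model p q) (c' ∘ c.symm) z :=
    ((contDiffAt_transition hc hc' hz).differentiableAt (by simp)).mdifferentiableAt
  have hs : MDifferentiableAt 𝓘(ℝ, Model p q) 𝓘(ℝ, Model p q) c'.symm ((c' ∘ c.symm) z) :=
    mdifferentiableAt_chart_symm hc' (c'.map_source hz2)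
  unfold chartInvDeriv
  rw [hev.mfderiv_eq, mfderiv_comp z hs ht, mfderiv_eq_fderiv]
  rfl

/-- Tangent vectors at x are by definition read in the preferred chart at x, so its derivative there
is the identity. -/
theorem mfderiv_chartAt_self [IsManifold 𝓘(ℝ, Model p q) ∞ M] (x : M) :
    mfderiv 𝓘(ℝ, Model p q) 𝓘(ℝ, Model p q) (chartAt (Model p q) x) x =
      ContinuousLinearMap.id ℝ (Model p q) := by
  have h : MDifferentiableAt 𝓘(ℝ, Model p q) 𝓘(ℝ, Model p q) (chartAt (Model p q) x) x :=
    mdifferentiableAt_atlas (chart_mem_atlas _ x) (mem_chart_source _ x)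
  rw [h.mfderiv]
  simp only [writtenInExtChartAt, mfld_simps, fderivWithin_univ]
  have hev : (chartAt (Model p q) x ∘ (chartAt (Model p q) x).symm) =ᶠ[𝓝 (chartAt (Model p q) x x)]
      id := by
    filter_upwards [(chartAt (Model p q) x).open_target.mem_nhds
      (mem_chart_target (Model p q) x)] with y hy
    exact (chartAt (Model p q) x).right_inv hy
  exact (Filter.EventuallyEq.fderiv_eq (𝕜 := ℝ) hev).trans fderiv_id

theorem chartRep_comp [IsManifold 𝓘(ℝ, Model p q) ∞ M]
    {c c' : OpenPartialHomeomorph M (Model p q)} (hc : c ∈ atlas (Model p q) M)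
    (hc' : c' ∈ atlas (Model p q) M) {k : ℕ} (α : FormField p q M k) {z : Model p q}
    (hz : z ∈ (c.symm.trans c').source) :
    chartRep c α z = (chartRep c' α (c' (c.symm z))).compContinuousLinearMap
      (fderiv ℝ (c' ∘ c.symm) z) := by
  have hx : c'.symm (c' (c.symm z)) = c.symm z := c'.left_inv hz.2
  unfold chartRep
  rw [chartInvDeriv_comp hc hc' hz, hx]
  rfl

/-- `extD` uses a different chart at each point. Naturality of the exterior derivative under changes
of charts allows it to be computed in one fixed chart. -/
theorem chartRep_extD [IsManifold 𝓘(ℝ, Model p q) ∞ M]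
    {c : OpenPartialHomeomorph M (Model p q)} (hc : c ∈ atlas (Model p q) M) {k : ℕ}
    {α : FormField p q M k} (hα : IsSmoothForm α) {z : Model p q} (hz : z ∈ c.target) :
    chartRep c (extD α) z = extDeriv (chartRep c α) z := by
  set x := c.symm z with hx
  have hxs : c.symm z ∈ (chartAt (Model p q) x).source := mem_chart_source _ x
  have hz' := mem_transition_source hz hxs
  have h1 : extDeriv (chartRep c α) z =
      (extDeriv (chartRep (chartAt (Model p q) x) α)
        ((chartAt (Model p q) x ∘ c.symm) z)).compContinuousLinearMap
          (fderiv ℝ (chartAt (Model p q) x ∘ c.symm) z) := by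
    rw [← extDeriv_pullback (r := ∞) _ (contDiffAt_transition hc (chart_mem_atlas _ x) hz')
      (by rw [minSmoothness_of_isRCLikeNormedField]; exact two_le_infty)]
    · apply Filter.EventuallyEq.extDeriv_eq
      filter_upwards [(c.symm.trans (chartAt (Model p q) x)).open_source.mem_nhds hz'] with y hy
      exact chartRep_comp hc (chart_mem_atlas _ x) α hy
    · exact ((hα _ (chart_mem_atlas _ x)).contDiffAt
        ((chartAt (Model p q) x).open_target.mem_nhds
          ((chartAt (Model p q) x).map_source hxs))).differentiableAt (by simp)
  rw [h1]
  unfold chartRep extD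
  rw [chartInvDeriv_eq_fderiv hc hz, ← hx, mfderiv_chartAt_self]
  rfl

/-- The transverse component of the change of charts is constant on a small segment z + t (X, 0),
which lies in one plaque. -/
theorem fderiv_transition_inl (hF : IsFoliatedAtlas p q M) [IsManifold 𝓘(ℝ, Model p q) ∞ M]
    {c c' : OpenPartialHomeomorph M (Model p q)} (hc : c ∈ atlas (Model p q) M)
    (hc' : c' ∈ atlas (Model p q) M) {z : Model p q} (hz : z ∈ (c.symm.trans c').source)
    (X : Fin p → ℝ) : (fderiv ℝ (c' ∘ c.symm) z (X, 0)).2 = 0 := by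
  obtain ⟨U, hU, h⟩ := hF c hc c' hc' z hz
  have hd : HasFDerivAt (c' ∘ c.symm) (fderiv ℝ (c' ∘ c.symm) z) z :=
    ((contDiffAt_transition hc hc' hz).differentiableAt (by simp)).hasFDerivAt
  have hl : HasDerivAt (fun t : ℝ => z + t • ((X, 0) : Model p q)) ((X, 0) : Model p q) 0 := by
    simpa using ((hasDerivAt_id (0 : ℝ)).smul_const ((X, 0) : Model p q)).const_add z
  have h1 : HasDerivAt (fun t : ℝ => ((c' ∘ c.symm) (z + t • ((X, 0) : Model p q))).2)
      (fderiv ℝ (c' ∘ c.symm) z (X, 0)).2 0 := by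
    have hd' : HasFDerivAt (c' ∘ c.symm) (fderiv ℝ (c' ∘ c.symm) z)
      (z + (0 : ℝ) • ((X, 0) : Model p q)) := by simpa using hd
    have := (hd'.comp_hasDerivAt (0 : ℝ) hl)
    exact this.snd
  have hc0 : (fun t : ℝ => ((c' ∘ c.symm) (z + t • ((X, 0) : Model p q))).2) =ᶠ[𝓝 0]
      fun _ => ((c' ∘ c.symm) z).2 := by
    have : ∀ᶠ t in 𝓝 (0 : ℝ), z + t • ((X, 0) : Model p q) ∈ U := by
      apply hl.continuousAt.eventually_mem
      simpa using hU
    filter_upwards [this] with t ht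
    exact h _ ht _ (mem_of_mem_nhds hU) (by simp)
  exact h1.unique ((hasDerivAt_const (0 : ℝ) _).congr_of_eventuallyEq hc0)

/-- For maps that preserve the flag, diagonal blocks multiply under composition. A right inverse
that also preserves the flag therefore makes both diagonal blocks invertible. -/
theorem isFlagMap_of_inverse {D D' : Model p q →L[ℝ] Model p q}
    (h : ∀ X, (D (X, 0)).2 = 0) (h' : ∀ X, (D' (X, 0)).2 = 0) (hDD' : ∀ w, D (D' w) = w) :
    ∃ A B, IsFlagMap D A B := by
  have hblock : ∀ D : Model p q →L[ℝ] Model p q, (∀ X, (D (X, 0)).2 = 0) →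
      ∃ (A : Matrix (Fin p) (Fin p) ℝ) (B : Matrix (Fin q) (Fin q) ℝ),
        (∀ X, D (X, 0) = (A.mulVec X, 0)) ∧ ∀ w, (D w).2 = B.mulVec w.2 := by
    intro D h
    let a : (Fin p → ℝ) →ₗ[ℝ] (Fin p → ℝ) :=
      LinearMap.fst ℝ _ _ ∘ₗ D.toLinearMap ∘ₗ LinearMap.inl ℝ _ _
    let b : (Fin q → ℝ) →ₗ[ℝ] (Fin q → ℝ) :=
      LinearMap.snd ℝ _ _ ∘ₗ D.toLinearMap ∘ₗ LinearMap.inr ℝ _ _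
    refine ⟨LinearMap.toMatrix' a, LinearMap.toMatrix' b, fun X => ?_, fun w => ?_⟩
    · rw [LinearMap.toMatrix'_mulVec]
      exact Prod.ext rfl (h X)
    · rw [LinearMap.toMatrix'_mulVec]
      have : w = (w.1, 0) + (0, w.2) := by simp
      conv_lhs => rw [this, map_add, Prod.snd_add, h, zero_add]
      rfl
  obtain ⟨A, B, hA, hB⟩ := hblock D h
  obtain ⟨A', B', hA', hB'⟩ := hblock D' h'
  refine ⟨A, B, hA, fun Y => hB (0, Y), ?_, ?_⟩
  · have : A * A' = 1 := by
      apply Matrix.ext_of_mulVec_single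
      intro i
      rw [← Matrix.mulVec_mulVec, Matrix.one_mulVec]
      have := congrArg Prod.fst (hDD' (Pi.single i 1, 0))
      rwa [hA', hA] at this
    exact (Matrix.isUnit_iff_isUnit_det A).mp (IsUnit.of_mul_eq_one _ this)
  · have : B * B' = 1 := by
      apply Matrix.ext_of_mulVec_single
      intro i
      rw [← Matrix.mulVec_mulVec, Matrix.one_mulVec]
      have := congrArg Prod.snd (hDD' (0, Pi.single i 1))
      rwa [hB, hB'] at this
    exact (Matrix.isUnit_iff_isUnit_det B).mp (IsUnit.of_mul_eq_one _ this)

theorem exists_isFlagMap_transition (hF : IsFoliatedAtlas p q M)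
    [IsManifold 𝓘(ℝ, Model p q) ∞ M]
    {c c' : OpenPartialHomeomorph M (Model p q)} (hc : c ∈ atlas (Model p q) M)
    (hc' : c' ∈ atlas (Model p q) M) {z : Model p q} (hz : z ∈ (c.symm.trans c').source) :
    ∃ A B, IsFlagMap (fderiv ℝ (c' ∘ c.symm) z) A B := by
  have hx : c'.symm (c' (c.symm z)) = c.symm z := c'.left_inv hz.2
  have hz' : c' (c.symm z) ∈ (c'.symm.trans c).source :=
    mem_transition_source (c'.map_source hz.2) (by rw [hx]; exact c.map_target hz.1)
  refine isFlagMap_of_inverse (D' := fderiv ℝ (c ∘ c'.symm) (c' (c.symm z)))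
    (fderiv_transition_inl hF hc hc' hz) (fderiv_transition_inl hF hc' hc hz') fun w => ?_
  have hback : (c ∘ c'.symm) (c' (c.symm z)) = z := by
    simp only [Function.comp, hx]
    exact c.right_inv hz.1
  have hd1 : DifferentiableAt ℝ (c' ∘ c.symm) ((c ∘ c'.symm) (c' (c.symm z))) := by
    rw [hback]
    exact (contDiffAt_transition hc hc' hz).differentiableAt (by simp)
  have hd2 : DifferentiableAt ℝ (c ∘ c'.symm) (c' (c.symm z)) :=
    (contDiffAt_transition hc' hc hz').differentiableAt (by simp)
  have hcomp := fderiv_comp (c' (c.symm z)) hd1 hd2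
  have hev : (c' ∘ c.symm) ∘ (c ∘ c'.symm) =ᶠ[𝓝 (c' (c.symm z))] id := by
    filter_upwards [(c'.symm.trans c).open_source.mem_nhds hz'] with y hy
    have h1 : c'.symm y ∈ c.source := hy.2
    have h2 : y ∈ c'.target := hy.1
    simp only [Function.comp, id]
    rw [c.left_inv h1, c'.right_inv h2]
  rw [hev.fderiv_eq, fderiv_id, hback] at hcomp
  exact (congrArg (fun f : Model p q →L[ℝ] Model p q => f w) hcomp).symm

theorem exists_isFlagMap_chartInvDeriv (hF : IsFoliatedAtlas p q M)
    [IsManifold 𝓘(ℝ, Model p q) ∞ M]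
    {c : OpenPartialHomeomorph M (Model p q)} (hc : c ∈ atlas (Model p q) M)
    {z : Model p q} (hz : z ∈ c.target) : ∃ A B, IsFlagMap (chartInvDeriv c z) A B := by
  rw [chartInvDeriv_eq_fderiv hc hz]
  exact exists_isFlagMap_transition hF hc (chart_mem_atlas _ _)
    (mem_transition_source hz (mem_chart_source _ _))

variable [IsManifold 𝓘(ℝ, Model p q) ∞ M]

theorem metricAt_isScalarProduct (g : Metric p q M) (x : M) : IsScalarProduct (metricAt g x) where
  symm v w := g.symm x v w
  pos v hv := g.pos x v hv

theorem chartMetric_isScalarProduct (hF : IsFoliatedAtlas p q M) (g : Metric p q M)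
    {c : OpenPartialHomeomorph M (Model p q)} (hc : c ∈ atlas (Model p q) M)
    {z : Model p q} (hz : z ∈ c.target) : IsScalarProduct (chartMetric g c z) := by
  obtain ⟨A, B, hD⟩ := exists_isFlagMap_chartInvDeriv hF hc hz
  exact (metricAt_isScalarProduct g _).comp hD.injective

theorem chartMetric_comp (g : Metric p q M)
    {c c' : OpenPartialHomeomorph M (Model p q)} (hc : c ∈ atlas (Model p q) M)
    (hc' : c' ∈ atlas (Model p q) M) {z : Model p q} (hz : z ∈ (c.symm.trans c').source) :
    chartMetric g c z = (chartMetric g c' (c' (c.symm z))).bilinearComp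
      (fderiv ℝ (c' ∘ c.symm) z) (fderiv ℝ (c' ∘ c.symm) z) := by
  have hx : c'.symm (c' (c.symm z)) = c.symm z := c'.left_inv hz.2
  unfold chartMetric
  rw [chartInvDeriv_comp hc hc' hz, hx]
  rfl

/-- Constant vectors of the chart give smooth fields of tangent vectors of M along the inverse
chart. Applying the smooth section g to two of them gives each coefficient as a smooth function. -/
theorem contDiffOn_chartMetric (g : Metric p q M)
    {c : OpenPartialHomeomorph M (Model p q)} (hc : c ∈ atlas (Model p q) M) :
    ContDiffOn ℝ ∞ (chartMetric g c) c.target := by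
  have key : ∀ v w : Model p q, ContDiffOn ℝ ∞ (fun z => chartMetric g c z v w) c.target := by
    intro v w
    have hsymm := contMDiffOn_symm_of_mem_maximalAtlas
      (IsManifold.subset_maximalAtlas (I := 𝓘(ℝ, Model p q)) (n := ∞) hc)
    have hV : ∀ v : Model p q, ContMDiffOn 𝓘(ℝ, Model p q) (𝓘(ℝ, Model p q).prod 𝓘(ℝ, Model p q)) ∞
        (fun z : Model p q => (⟨c.symm z, chartInvDeriv c z v⟩ :
          TangentBundle 𝓘(ℝ, Model p q) M)) c.target := by
      intro v
      have ht := hsymm.contMDiffOn_tangentMapWithin (m := ∞) (by simp)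
        c.open_target.uniqueMDiffOn
      have hs : ContMDiffOn 𝓘(ℝ, Model p q) (𝓘(ℝ, Model p q).prod 𝓘(ℝ, Model p q)) ∞
          (fun z : Model p q => (⟨z, v⟩ : TangentBundle 𝓘(ℝ, Model p q) (Model p q))) c.target :=
        contMDiffOn_vectorSpace_iff_contDiffOn.mpr contDiffOn_const
      refine (ht.comp hs fun z hz => hz).congr fun z hz => ?_
      simp only [Function.comp, tangentMapWithin, chartInvDeriv]
      rw [mfderivWithin_of_isOpen c.open_target hz]
      rfl
    rw [← contMDiffOn_iff_contDiffOn]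
    intro z hz
    have hg : ContMDiffWithinAt 𝓘(ℝ, Model p q)
        (𝓘(ℝ, Model p q).prod 𝓘(ℝ, Model p q →L[ℝ] Model p q →L[ℝ] ℝ)) ∞
        (fun z => Bundle.TotalSpace.mk' (Model p q →L[ℝ] Model p q →L[ℝ] ℝ)
          (E := fun x : M => TangentSpace 𝓘(ℝ, Model p q) x →L[ℝ]
            TangentSpace 𝓘(ℝ, Model p q) x →L[ℝ] ℝ) (c.symm z) (g.inner (c.symm z)))
        c.target z := g.contMDiff.contMDiffAt.comp_contMDiffWithinAt z (hsymm z hz)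
    have : ContMDiffWithinAt 𝓘(ℝ, Model p q) (𝓘(ℝ, Model p q).prod 𝓘(ℝ)) ∞
        (fun z => Bundle.TotalSpace.mk' ℝ (E := Bundle.Trivial M ℝ) (c.symm z)
          (g.inner (c.symm z) (chartInvDeriv c z v) (chartInvDeriv c z w))) c.target z := by
      apply ContMDiffWithinAt.clm_bundle_apply₂ (F₁ := Model p q) (F₂ := Model p q)
      · exact hg
      · exact hV v z hz
      · exact hV w z hz
    simp only [Bundle.contMDiffWithinAt_totalSpace] at this
    exact this.2
  exact contDiffOn_clm_apply.mpr fun v => contDiffOn_clm_apply.mpr fun w => key v w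

end Charts

/-! ### Smoothness criteria -/

section Smooth

variable {E : Type*} [NormedAddCommGroup E] [NormedSpace ℝ E] {s : Set E}

/-- The space of forms has finite dimension, so a form is a fixed linear function of its values on a
basis. -/
theorem contDiffOn_of_apply {p q k : ℕ} {f : E → Model p q [⋀^Fin k]→L[ℝ] ℝ}
    (h : ∀ w, ContDiffOn ℝ ∞ (fun z => f z w) s) : ContDiffOn ℝ ∞ f s := by
  let β := (Pi.basisFun ℝ (Fin p)).prod (Pi.basisFun ℝ (Fin q))
  let ev : (Model p q [⋀^Fin k]→L[ℝ] ℝ) →ₗ[ℝ] ((Fin k → Fin p ⊕ Fin q) → ℝ) :=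
    { toFun := fun f i => f fun m => β (i m)
      map_add' := fun _ _ => rfl
      map_smul' := fun _ _ => rfl }
  have hev : Function.Injective ev := by
    intro f f' hff
    apply ContinuousAlternatingMap.toAlternatingMap_injective
    exact Module.Basis.ext_alternating β fun i _ => congrFun hff i
  obtain ⟨g, hg⟩ := LinearMap.exists_leftInverse_of_injective ev (LinearMap.ker_eq_bot.mpr hev)
  have hf : f = fun z => g.toContinuousLinearMap (ev (f z)) := by
    funext z
    exact (congrArg (fun l : _ →ₗ[ℝ] _ => l (f z)) hg).symm
  rw [hf]
  refine (ContinuousLinearMap.contDiff _).comp_contDiffOn ?_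
  exact contDiffOn_pi.mpr fun i => h _

theorem contDiffOn_det {ι : Type*} [Fintype ι] [DecidableEq ι] {A : E → Matrix ι ι ℝ}
    (h : ∀ i j, ContDiffOn ℝ ∞ (fun z => A z i j) s) :
    ContDiffOn ℝ ∞ (fun z => (A z).det) s := by
  simp only [Matrix.det_apply']
  exact ContDiffOn.sum fun σ _ => contDiffOn_const.mul (contDiffOn_prod fun i _ => h _ _)

theorem contDiffOn_matrix_inv {n : ℕ} {A : E → Matrix (Fin n) (Fin n) ℝ}
    (h : ∀ i j, ContDiffOn ℝ ∞ (fun z => A z i j) s) (hA : ∀ z ∈ s, (A z).det ≠ 0) (i j : Fin n) :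
    ContDiffOn ℝ ∞ (fun z => (A z)⁻¹ i j) s := by
  have e : (fun z => (A z)⁻¹ i j) = fun z => (A z).det⁻¹ * (A z).adjugate i j := by
    funext z
    rw [Matrix.inv_def, Ring.inverse_eq_inv']
    rfl
  rw [e]
  refine ((contDiffOn_det h).inv hA).mul ?_
  simp only [Matrix.adjugate_apply]
  refine contDiffOn_det fun a b => ?_
  by_cases hab : a = j
  · subst hab
    simp only [Matrix.updateRow_self]
    exact contDiffOn_const
  · simp only [Matrix.updateRow_ne hab]
    exact h a b

theorem multilinear_apply_eq_sum {n k : ℕ} (f : (Fin n → ℝ) [⋀^Fin k]→ₗ[ℝ] ℝ)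
    (x : Fin k → Fin n → ℝ) :
    f x = ∑ i : Fin k → Fin n, (∏ m, x m (i m)) * f (fun m => stdE (i m)) := by
  have h : x = fun m => ∑ a, x m a • (stdE a : Fin n → ℝ) := by
    funext m b
    simp [Finset.sum_apply, Pi.single_apply]
  conv_lhs => rw [h]
  have := f.toMultilinearMap.map_sum (fun (m : Fin k) (a : Fin n) => x m a • (stdE a : Fin n → ℝ))
  refine this.trans (Finset.sum_congr rfl fun a _ => ?_)
  exact f.toMultilinearMap.map_smul_univ _ _

/-- Smooth families of bigraded forms. -/
def IsSmoothBi {p q u v : ℕ} (a : E → BiAlt p q u v) (s : Set E) : Prop :=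
  ∀ y x, ContDiffOn ℝ ∞ (fun z => a z y x) s

theorem contDiffOn_hodgeStar {n k k' : ℕ} (h : k + k' = n) {H : E → Matrix (Fin n) (Fin n) ℝ}
    (hH : ∀ i j, ContDiffOn ℝ ∞ (fun z => H z i j) s)
    {vol : E → (Fin n → ℝ) [⋀^Fin n]→ₗ[ℝ] ℝ} (hvol : ∀ x, ContDiffOn ℝ ∞ (fun z => vol z x) s)
    {β : E → (Fin n → ℝ) [⋀^Fin k]→ₗ[ℝ] ℝ} (hβ : ∀ x, ContDiffOn ℝ ∞ (fun z => β z x) s)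
    (x : Fin k' → Fin n → ℝ) :
    ContDiffOn ℝ ∞ (fun z => hodgeStar h (H z) (vol z) (β z) x) s := by
  simp only [hodgeStar_real_apply]
  refine contDiffOn_const.mul (ContDiffOn.sum fun i _ => ContDiffOn.sum fun j _ => ?_)
  exact ((contDiffOn_prod fun m _ => hH _ _).mul (hβ _)).mul (hvol _)

variable {p q u v : ℕ}

theorem contDiffOn_apply_bilin {G : E → Bilin p q} (hG : ContDiffOn ℝ ∞ G s)
    {f f' : E → Model p q} (hf : ContDiffOn ℝ ∞ f s) (hf' : ContDiffOn ℝ ∞ f' s) :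
    ContDiffOn ℝ ∞ (fun z => G z (f z) (f' z)) s :=
  (hG.clm_apply hf).clm_apply hf'

theorem contDiffOn_leafGram {G : E → Bilin p q} (hG : ContDiffOn ℝ ∞ G s) (i j : Fin p) :
    ContDiffOn ℝ ∞ (fun z => leafGram (G z) i j) s :=
  contDiffOn_apply_bilin hG contDiffOn_const contDiffOn_const

theorem contDiffOn_leafGram_inv {G : E → Bilin p q} (hG : ContDiffOn ℝ ∞ G s)
    (hsp : ∀ z ∈ s, IsScalarProduct (G z)) (i j : Fin p) :
    ContDiffOn ℝ ∞ (fun z => (leafGram (G z))⁻¹ i j) s :=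
  contDiffOn_matrix_inv (contDiffOn_leafGram hG)
    (fun z hz => (leafGram_posDef (hsp z hz)).det_pos.ne') i j

theorem contDiffOn_normalLift {G : E → Bilin p q} (hG : ContDiffOn ℝ ∞ G s)
    (hsp : ∀ z ∈ s, IsScalarProduct (G z)) (y : Fin q → ℝ) :
    ContDiffOn ℝ ∞ (fun z => normalLift (G z) y) s := by
  refine ContDiffOn.prodMk (f := fun z => (normalLift (G z) y).1) ?_ contDiffOn_const
  refine contDiffOn_pi.mpr fun i => ?_
  have e : ∀ z, (normalLift (G z) y).1 i =
      -∑ j, (leafGram (G z))⁻¹ i j * G z (stdE j, 0) (0, y) := fun z => rfl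
  simp only [e]
  exact (ContDiffOn.sum fun j _ => (contDiffOn_leafGram_inv hG hsp i j).mul
    (contDiffOn_apply_bilin hG contDiffOn_const contDiffOn_const)).neg

theorem contDiffOn_normalGram {G : E → Bilin p q} (hG : ContDiffOn ℝ ∞ G s)
    (hsp : ∀ z ∈ s, IsScalarProduct (G z)) (i j : Fin q) :
    ContDiffOn ℝ ∞ (fun z => normalGram (G z) i j) s :=
  contDiffOn_apply_bilin hG (contDiffOn_normalLift hG hsp _) (contDiffOn_normalLift hG hsp _)

theorem contDiffOn_normalGram_inv {G : E → Bilin p q} (hG : ContDiffOn ℝ ∞ G s)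
    (hsp : ∀ z ∈ s, IsScalarProduct (G z)) (i j : Fin q) :
    ContDiffOn ℝ ∞ (fun z => (normalGram (G z))⁻¹ i j) s :=
  contDiffOn_matrix_inv (contDiffOn_normalGram hG hsp)
    (fun z hz => (normalGram_posDef (hsp z hz)).det_pos.ne') i j

theorem contDiffOn_leafProj {G : E → Bilin p q} (hG : ContDiffOn ℝ ∞ G s)
    (hsp : ∀ z ∈ s, IsScalarProduct (G z)) (w : Model p q) :
    ContDiffOn ℝ ∞ (fun z => leafProj (G z) w) s := by
  have e : ∀ z, leafProj (G z) w = w.1 - (normalLift (G z) w.2).1 := fun z => rfl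
  simp only [e]
  exact contDiffOn_const.sub (contDiff_fst.comp_contDiffOn (contDiffOn_normalLift hG hsp _))

theorem contDiffOn_toForm {G : E → Bilin p q} (hG : ContDiffOn ℝ ∞ G s)
    (hsp : ∀ z ∈ s, IsScalarProduct (G z)) {a : E → BiAlt p q u v} (ha : IsSmoothBi a s) :
    ContDiffOn ℝ ∞ (fun z => toForm (G z) (a z)) s := by
  refine contDiffOn_of_apply fun w => ?_
  simp only [toForm_apply]
  refine contDiffOn_const.mul (ContDiffOn.sum fun σ _ => contDiffOn_const.mul ?_)
  refine ContDiffOn.congr ?_ fun z _ => multilinear_apply_eq_sum _ _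
  refine ContDiffOn.sum fun i _ => ContDiffOn.mul (contDiffOn_prod fun m _ => ?_) (ha _ _)
  exact contDiffOn_pi.mp (contDiffOn_leafProj hG hsp _) _

theorem contDiffOn_biForm {N : E → Matrix (Fin q) (Fin q) ℝ} {H : E → Matrix (Fin p) (Fin p) ℝ}
    (hN : ∀ i j, ContDiffOn ℝ ∞ (fun z => N z i j) s)
    (hH : ∀ i j, ContDiffOn ℝ ∞ (fun z => H z i j) s) {a a' : E → BiAlt p q u v}
    (ha : IsSmoothBi a s) (ha' : IsSmoothBi a' s) :
    ContDiffOn ℝ ∞ (fun z => biForm (N z) (H z) (a z) (a' z)) s := by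
  unfold biForm formInner
  refine contDiffOn_const.mul (ContDiffOn.sum fun c _ => ContDiffOn.sum fun c' _ => ?_)
  refine (contDiffOn_prod fun m _ => hN _ _).mul ?_
  refine contDiffOn_const.mul (ContDiffOn.sum fun i _ => ContDiffOn.sum fun j _ => ?_)
  exact ((contDiffOn_prod fun m _ => hH _ _).mul (ha _ _)).mul (ha' _ _)

theorem contDiffOn_biInner {G : E → Bilin p q} (hG : ContDiffOn ℝ ∞ G s)
    (hsp : ∀ z ∈ s, IsScalarProduct (G z)) {a a' : E → BiAlt p q u v}
    (ha : IsSmoothBi a s) (ha' : IsSmoothBi a' s) :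
    ContDiffOn ℝ ∞ (fun z => biInner (G z) (a z) (a' z)) s := by
  simp only [biInner_eq_biForm]
  exact contDiffOn_biForm (contDiffOn_normalGram_inv hG hsp) (contDiffOn_leafGram_inv hG hsp) ha ha'

theorem contDiffOn_toBi {G : E → Bilin p q} (hG : ContDiffOn ℝ ∞ G s)
    (hsp : ∀ z ∈ s, IsScalarProduct (G z)) {f : E → Model p q [⋀^Fin (u + v)]→L[ℝ] ℝ}
    (hf : ContDiffOn ℝ ∞ f s) : IsSmoothBi (fun z => toBi (G z) (f z)) s := by
  intro y x
  simp only [toBi_apply]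
  let β := (Pi.basisFun ℝ (Fin p)).prod (Pi.basisFun ℝ (Fin q))
  have e : ∀ (f : Model p q [⋀^Fin (u + v)]→L[ℝ] ℝ) (w : Fin (u + v) → Model p q),
      f w = ∑ i : Fin (u + v) → Fin p ⊕ Fin q, (∏ m, β.equivFun (w m) (i m)) *
        f (fun m => β (i m)) := by
    intro f w
    have hw : w = fun m => ∑ c, β.equivFun (w m) c • β c := by
      funext m
      exact (β.sum_equivFun (w m)).symm
    conv_lhs => rw [hw]
    refine (f.toMultilinearMap.map_sum
      (fun (m : Fin (u + v)) c => β.equivFun (w m) c • β c)).trans ?_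
    exact Finset.sum_congr rfl fun I _ => f.toMultilinearMap.map_smul_univ _ _
  have hw : ∀ m, ContDiffOn ℝ ∞ (fun z => Fin.append (fun i => normalLift (G z) (y i))
      (fun j => ((x j, 0) : Model p q)) m) s := by
    intro m
    induction m using Fin.addCases with
    | left i => simpa using contDiffOn_normalLift hG hsp (y i)
    | right j => simpa using contDiffOn_const
  have hb : ContDiff ℝ ∞ β.equivFun :=
    (β.equivFun.toLinearMap.toContinuousLinearMap).contDiff
  have he : ∀ (w : Fin (u + v) → Model p q), ContDiffOn ℝ ∞ (fun z => f z w) s := by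
    intro w
    exact (ContinuousLinearMap.contDiff
      (ContinuousAlternatingMap.apply ℝ (Model p q) ℝ w)).comp_contDiffOn hf
  refine ContDiffOn.congr ?_ fun z _ => e (f z) _
  refine ContDiffOn.sum fun i _ => ContDiffOn.mul (contDiffOn_prod fun m _ => ?_) (he _)
  exact contDiffOn_pi.mp (hb.comp_contDiffOn (hw m)) _

end Smooth

/-! ### Linearity, and the exterior derivative in the leaf directions -/

section Linear

variable {p q u v : ℕ}

theorem toBi_add (b : Bilin p q) (f f' : Model p q [⋀^Fin (u + v)]→L[ℝ] ℝ) :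
    toBi b (f + f') = toBi b f + toBi b f' := rfl

theorem toBi_smul (b : Bilin p q) (r : ℝ) (f : Model p q [⋀^Fin (u + v)]→L[ℝ] ℝ) :
    toBi b (r • f) = r • toBi b f := rfl

theorem toForm_add (b : Bilin p q) (a a' : BiAlt p q u v) :
    toForm b (a + a') = toForm b a + toForm b a' := by
  ext w
  rw [ContinuousAlternatingMap.add_apply, toForm_apply, toForm_apply, toForm_apply, ← mul_add,
    ← Finset.sum_add_distrib]
  congr 1
  refine Finset.sum_congr rfl fun σ _ => ?_
  simp only [AlternatingMap.add_apply]
  ring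

theorem toForm_smul (b : Bilin p q) (r : ℝ) (a : BiAlt p q u v) :
    toForm b (r • a) = r • toForm b a := by
  ext w
  rw [ContinuousAlternatingMap.smul_apply, toForm_apply, toForm_apply, smul_eq_mul]
  simp only [AlternatingMap.smul_apply, Finset.mul_sum, smul_eq_mul]
  exact Finset.sum_congr rfl fun σ _ => by ring

/-- The component in `Λ^u N^* ⊗ Λ^v T^*` for the product splitting of `ℝ^p × ℝ^q`. -/
def stdBi (f : Model p q [⋀^Fin (u + v)]→L[ℝ] ℝ) : BiAlt p q u v :=
  (LinearMap.compAlternatingMap (altPullback (LinearMap.inl ℝ _ _))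
    (splitAlt f.toAlternatingMap)).compLinearMap (LinearMap.inr ℝ _ _)

theorem stdBi_apply (f : Model p q [⋀^Fin (u + v)]→L[ℝ] ℝ) (y : Fin u → Fin q → ℝ)
    (x : Fin v → Fin p → ℝ) :
    stdBi f y x = f (Fin.append (fun i => (0, y i)) (fun j => (x j, 0))) :=
  splitAlt_apply f.toAlternatingMap _ _

/-- The forms that vanish on more than `v` leafwise vectors. -/
def VanishesOnLeaf (u v : ℕ) (f : Model p q [⋀^Fin (u + v)]→L[ℝ] ℝ) : Prop :=
  ∀ (w : Fin (u + v) → Model p q) (s : Finset (Fin (u + v))), s.card < u →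
      (∀ t ∉ s, (w t).2 = 0) → f w = 0

/-- A normal vector and its transverse coordinate vector differ by a leafwise vector, which is one
leafwise argument too many. So the coefficients do not depend on b, and differentiating them
involves no derivative of the orthogonal splitting. -/
theorem VanishesOnLeaf.toBi_eq {f : Model p q [⋀^Fin (u + v)]→L[ℝ] ℝ}
    (hf : VanishesOnLeaf u v f) (b : Bilin p q) : toBi b f = stdBi f := by
  refine biAlt_ext fun y x => ?_
  rw [toBi_apply, stdBi_apply]
  exact apply_append_eq f hf _ _ (fun i => by rw [normalLift_snd]) x

theorem vanishesOnLeaf_toForm (b : Bilin p q) (a : BiAlt p q u v) :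
    VanishesOnLeaf u v (toForm b a) :=
  fun w s hs hw => toForm_eq_zero_of_card_lt b a w s hs hw

theorem hasFDerivAt_apply_const {k : ℕ} {f : Model p q → Model p q [⋀^Fin k]→L[ℝ] ℝ}
    {z : Model p q} (hf : DifferentiableAt ℝ f z) (w : Fin k → Model p q) :
    HasFDerivAt (fun z => f z w)
      ((ContinuousAlternatingMap.apply ℝ (Model p q) ℝ w).comp (fderiv ℝ f z)) z :=
  (ContinuousLinearMap.hasFDerivAt
    (ContinuousAlternatingMap.apply ℝ (Model p q) ℝ w)).comp z hf.hasFDerivAt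

theorem fderiv_apply_const {k : ℕ} {f : Model p q → Model p q [⋀^Fin k]→L[ℝ] ℝ}
    {z : Model p q} (hf : DifferentiableAt ℝ f z) (w : Fin k → Model p q) (h : Model p q) :
    fderiv ℝ (fun z => f z w) z h = fderiv ℝ f z h w := by
  rw [(hasFDerivAt_apply_const hf w).fderiv]
  rfl

/-- The leafwise exterior derivative only sees the leafwise derivatives of the coefficients. -/
theorem toBi_extDeriv {f : Model p q → Model p q [⋀^Fin (u + v)]→L[ℝ] ℝ} {z : Model p q}
    (hf : DifferentiableAt ℝ f z) (hv : ∀ᶠ z' in 𝓝 z, VanishesOnLeaf u v (f z'))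
    (b : Bilin p q) :
    toBi (u := u) (v := v + 1) b (extDeriv f z) =
      ∑ m, biWedge (LinearMap.proj m) (stdBi (fderiv ℝ f z (stdE m, 0))) := by
  classical
  refine biAlt_ext fun y x => ?_
  have hsum : (∑ m, biWedge (LinearMap.proj m) (stdBi (fderiv ℝ f z (stdE m, 0))) :
      BiAlt p q u (v + 1)) y x =
      ∑ m, biWedge (LinearMap.proj m) (stdBi (u := u) (v := v) (fderiv ℝ f z (stdE m, 0))) y x := by
    have := map_sum ((altEval x).comp (altEval (V := Fin q → ℝ) y))
      (fun m => (biWedge (LinearMap.proj m) (stdBi (fderiv ℝ f z (stdE m, 0))) :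
        BiAlt p q u (v + 1))) Finset.univ
    exact this
  rw [hsum, toBi_apply]
  refine (extDeriv_apply (n := u + v) hf _).trans ?_
  refine (Fin.sum_univ_add (a := u) (b := v + 1) _).trans ?_
  -- The terms that differentiate in a normal direction drop out: what is left has only u - 1
  -- arguments with a transverse component, so it vanishes identically near z.
  rw [Finset.sum_eq_zero, zero_add]
  · simp only [biWedge_apply, altWedge_apply, Finset.mul_sum]
    rw [Finset.sum_comm]
    refine Finset.sum_congr rfl fun j _ => ?_
    have h1 : (fun z' => f z' ((Fin.natAdd u j : Fin (u + v + 1)).removeNth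
        (Fin.append (fun i => normalLift b (y i)) (fun j => (x j, 0)) :
          Fin (u + (v + 1)) → Model p q))) =ᶠ[𝓝 z]
        fun z' => f z' (Fin.append (fun i => (0, y i)) (fun t => (j.removeNth x t, 0))) := by
      filter_upwards [hv] with z' hz'
      rw [removeNth_append_natAdd]
      exact apply_append_eq (f z') hz' _ _ (fun i => by rw [normalLift_snd]) (j.removeNth x)
    have h2 : fderiv ℝ (fun z' => f z' ((Fin.natAdd u j : Fin (u + v + 1)).removeNth
        (Fin.append (fun i => normalLift b (y i)) (fun j => (x j, 0)) :
          Fin (u + (v + 1)) → Model p q))) z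
        ((Fin.append (fun i => normalLift b (y i)) (fun j => (x j, 0)) :
          Fin (u + (v + 1)) → Model p q) (Fin.natAdd u j)) =
        ∑ m, x j m * stdBi (fderiv ℝ f z (stdE m, 0)) y (j.removeNth x) := by
      rw [h1.fderiv_eq, Fin.append_right, fderiv_apply_const hf, inl_eq_sum (x j), map_sum]
      have := map_sum (ContinuousAlternatingMap.apply ℝ (Model p q) ℝ
        (Fin.append (fun i => ((0, y i) : Model p q)) (fun t => (j.removeNth x t, 0))))
        (fun m => fderiv ℝ f z (x j m • (stdE m, 0))) Finset.univ
      refine this.trans (Finset.sum_congr rfl fun m _ => ?_)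
      rw [map_smul, map_smul, smul_eq_mul, stdBi_apply]
      rfl
    have h3 : ((-1 : ℤ) ^ (u + (j : ℕ))) • (∑ m, x j m *
        stdBi (u := u) (v := v) (fderiv ℝ f z (stdE m, 0)) y (j.removeNth x)) =
        ∑ m, (-1 : ℝ) ^ u * ((-1) ^ (j : ℕ) * ((LinearMap.proj m : (Fin p → ℝ) →ₗ[ℝ] ℝ) (x j) *
          stdBi (u := u) (v := v) (fderiv ℝ f z (stdE m, 0)) y (j.removeNth x))) := by
      rw [zsmul_eq_mul, Finset.mul_sum]
      refine Finset.sum_congr rfl fun m _ => ?_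
      push_cast
      rw [pow_add, LinearMap.proj_apply]
      ring
    rw [← h3, ← h2]
    simp
  · intro i _
    have h1 : (fun z' => f z' ((Fin.castAdd (v + 1) i : Fin (u + v + 1)).removeNth
        (Fin.append (fun i => normalLift b (y i)) (fun j => (x j, 0)) :
          Fin (u + (v + 1)) → Model p q))) =ᶠ[𝓝 z] fun _ => 0 := by
      filter_upwards [hv] with z' hz'
      let e : Fin (u + v) → Fin (u + v + 1) := (Fin.castAdd (v + 1) i : Fin (u + v + 1)).succAbove
      have he : Function.Injective e := Fin.succAbove_right_injective
      refine hz' _ (Finset.univ.filter fun t => ∃ i', e t = Fin.castAdd (v + 1) i') ?_ ?_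
      · have hlt : ((Finset.univ.filter fun t => ∃ i' : Fin u,
            e t = Fin.castAdd (v + 1) i').image e).card <
            (Finset.univ.image (Fin.castAdd (v + 1) : Fin u → Fin (u + (v + 1)))).card := by
          apply Finset.card_lt_card
          refine Finset.ssubset_iff_subset_ne.mpr ⟨?_, fun heq => ?_⟩
          · intro t ht
            obtain ⟨t', ht', rfl⟩ := Finset.mem_image.mp ht
            obtain ⟨i', hi'⟩ := (Finset.mem_filter.mp ht').2
            exact Finset.mem_image.mpr ⟨i', Finset.mem_univ _, hi'.symm⟩
          · have : (Fin.castAdd (v + 1) i : Fin (u + (v + 1))) ∈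
                (Finset.univ.image (Fin.castAdd (v + 1) : Fin u → Fin (u + (v + 1)))) :=
              Finset.mem_image_of_mem _ (Finset.mem_univ i)
            rw [← heq] at this
            obtain ⟨t', -, ht'⟩ := Finset.mem_image.mp this
            exact Fin.succAbove_ne (n := u + v) _ _ ht'
        rw [Finset.card_image_of_injective _ he,
          Finset.card_image_of_injective _ (Fin.castAdd_injective _ _)] at hlt
        simpa using hlt
      · intro t ht
        have ht' : ∀ i', e t ≠ Fin.castAdd (v + 1) i' := by
          intro i' hi'
          exact ht (Finset.mem_filter.mpr ⟨Finset.mem_univ _, i', hi'⟩)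
        change ((Fin.append (fun i => normalLift b (y i)) (fun j => (x j, 0)) :
          Fin (u + (v + 1)) → Model p q) (e t)).2 = 0
        have key : ∀ r : Fin (u + (v + 1)), (∀ i', r ≠ Fin.castAdd (v + 1) i') →
            ((Fin.append (fun i => normalLift b (y i)) (fun j => (x j, 0)) :
              Fin (u + (v + 1)) → Model p q) r).2 = 0 := by
          intro r hr
          induction r using Fin.addCases with
          | left i' => exact absurd rfl (hr i')
          | right j => rw [Fin.append_right]
        exact key _ ht'
    have h2 : fderiv ℝ (fun z' => f z' ((Fin.castAdd (v + 1) i : Fin (u + v + 1)).removeNth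
        (Fin.append (fun i => normalLift b (y i)) (fun j => (x j, 0)) :
          Fin (u + (v + 1)) → Model p q))) z = 0 := by
      rw [h1.fderiv_eq]; simp
    refine (congrArg₂ (fun (r : ℤ) (L : Model p q →L[ℝ] ℝ) => r • L
      ((Fin.append (fun i => normalLift b (y i)) (fun j => (x j, 0)) :
          Fin (u + (v + 1)) → Model p q) (Fin.castAdd (v + 1) i))) rfl h2).trans ?_
    simp

end Linear

/-! ### Coefficients of forms in charts -/

section Coef

variable {p q : ℕ} {M : Type*} [TopologicalSpace M] [ChartedSpace (Model p q) M]
  [IsManifold 𝓘(ℝ, Model p q) ∞ M] (g : Metric p q M)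

/-- The coefficients of a form in a chart. -/
def coef (c : OpenPartialHomeomorph M (Model p q)) (u v : ℕ) (φ : FormField p q M (u + v))
    (z : Model p q) : BiAlt p q u v :=
  toBi (chartMetric g c z) (chartRep c φ z)

/-- Sections, smooth or not, of `Λ^u N^*F ∧ Λ^v T^*F`. -/
def IsBiSection (u v : ℕ) (φ : FormField p q M (u + v)) : Prop :=
  ∀ x, ∃ a : BiAlt p q u v, φ x = toForm (metricAt g x) a

variable {g} {u v : ℕ} {c : OpenPartialHomeomorph M (Model p q)} {z : Model p q}

theorem IsBiform.isBiSection {φ : FormField p q M (u + v)} (hφ : IsBiform g u v φ) :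
    IsBiSection g u v φ := hφ.2

theorem IsBiSection.eq_toForm {φ : FormField p q M (u + v)} (hφ : IsBiSection g u v φ) (x : M) :
    φ x = toForm (metricAt g x) (toBi (metricAt g x) (φ x)) := by
  obtain ⟨a, ha⟩ := hφ x
  rw [ha, toBi_toForm]

theorem coef_eq_biPull {A : Matrix (Fin p) (Fin p) ℝ} {B : Matrix (Fin q) (Fin q) ℝ}
    (hD : IsFlagMap (chartInvDeriv c z) A B) (φ : FormField p q M (u + v)) :
    coef g c u v φ z =
      biPull A B (toBi (metricAt g (c.symm z)) (φ (c.symm z))) :=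
  toBi_comp (metricAt_isScalarProduct g _) hD _

theorem IsBiSection.chartRep_eq (hF : IsFoliatedAtlas p q M) {φ : FormField p q M (u + v)}
    (hφ : IsBiSection g u v φ) (hc : c ∈ atlas (Model p q) M) (hz : z ∈ c.target) :
    chartRep c φ z = toForm (chartMetric g c z) (coef g c u v φ z) := by
  obtain ⟨A, B, hD⟩ := exists_isFlagMap_chartInvDeriv hF hc hz
  rw [coef_eq_biPull hD]
  have := toForm_comp (metricAt_isScalarProduct g (c.symm z)) hD
    (toBi (metricAt g (c.symm z)) (φ (c.symm z)))
  rw [← hφ.eq_toForm] at this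
  exact this

theorem biInner_coef (hF : IsFoliatedAtlas p q M) (hc : c ∈ atlas (Model p q) M)
    (hz : z ∈ c.target) (φ ψ : FormField p q M (u + v)) :
    biInner (chartMetric g c z) (coef g c u v φ z) (coef g c u v ψ z) =
      biInner (metricAt g (c.symm z)) (toBi (metricAt g (c.symm z)) (φ (c.symm z)))
        (toBi (metricAt g (c.symm z)) (ψ (c.symm z))) := by
  obtain ⟨A, B, hD⟩ := exists_isFlagMap_chartInvDeriv hF hc hz
  rw [coef_eq_biPull hD, coef_eq_biPull hD]
  exact biInner_comp (metricAt_isScalarProduct g _) hD _ _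

theorem biPull_injective {A : Matrix (Fin p) (Fin p) ℝ} {B : Matrix (Fin q) (Fin q) ℝ}
    (hA : IsUnit A.det) (hB : IsUnit B.det) :
    Function.Injective (biPull A B : BiAlt p q u v → BiAlt p q u v) := by
  intro a a' h
  refine biAlt_ext fun y x => ?_
  have := congrArg (fun a : BiAlt p q u v =>
    a (fun i => B⁻¹.mulVec (y i)) (fun j => A⁻¹.mulVec (x j))) h
  simpa only [biPull_apply, Matrix.mulVec_mulVec, Matrix.mul_nonsing_inv _ hA,
    Matrix.mul_nonsing_inv _ hB, Matrix.one_mulVec] using this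

theorem IsBiSection.eq_of_coef (hF : IsFoliatedAtlas p q M) {φ ψ : FormField p q M (u + v)}
    (hφ : IsBiSection g u v φ) (hψ : IsBiSection g u v ψ)
    (h : ∀ c ∈ atlas (Model p q) M, ∀ z ∈ c.target, coef g c u v φ z = coef g c u v ψ z) :
    φ = ψ := by
  funext x
  have hc := chart_mem_atlas (Model p q) x
  have hz := mem_chart_target (Model p q) x
  obtain ⟨A, B, hD⟩ := exists_isFlagMap_chartInvDeriv hF hc hz
  have := h _ hc _ hz
  rw [coef_eq_biPull hD, coef_eq_biPull hD] at this
  have := biPull_injective hD.unit_leaf hD.unit_normal this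
  rw [(chartAt (Model p q) x).left_inv (mem_chart_source _ x)] at this
  rw [hφ.eq_toForm, hψ.eq_toForm, this]

theorem isBiform_of_coef (hF : IsFoliatedAtlas p q M) {φ : FormField p q M (u + v)}
    (hφ : IsBiSection g u v φ)
    (h : ∀ c ∈ atlas (Model p q) M, IsSmoothBi (coef g c u v φ) c.target) : IsBiform g u v φ := by
  refine ⟨fun c hc => ?_, hφ⟩
  refine (contDiffOn_toForm (contDiffOn_chartMetric g hc)
    (fun z hz => chartMetric_isScalarProduct hF g hc hz) (h c hc)).congr fun z hz => ?_
  exact hφ.chartRep_eq hF hc hz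

theorem IsBiform.isSmoothBi_coef (hF : IsFoliatedAtlas p q M) {φ : FormField p q M (u + v)}
    (hφ : IsBiform g u v φ) (hc : c ∈ atlas (Model p q) M) :
    IsSmoothBi (coef g c u v φ) c.target :=
  contDiffOn_toBi (contDiffOn_chartMetric g hc)
    (fun _ hz => chartMetric_isScalarProduct hF g hc hz) (hφ.1 c hc)

theorem coef_add (φ ψ : FormField p q M (u + v)) :
    coef g c u v (φ + ψ) z = coef g c u v φ z + coef g c u v ψ z := rfl

theorem coef_smul (r : ℝ) (φ : FormField p q M (u + v)) :
    coef g c u v (r • φ) z = r • coef g c u v φ z := rfl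

theorem IsBiSection.add {φ ψ : FormField p q M (u + v)} (hφ : IsBiSection g u v φ)
    (hψ : IsBiSection g u v ψ) : IsBiSection g u v (φ + ψ) := by
  intro x
  obtain ⟨a, ha⟩ := hφ x
  obtain ⟨a', ha'⟩ := hψ x
  exact ⟨a + a', by rw [toForm_add, ← ha, ← ha']; rfl⟩

theorem IsBiSection.mul (ρ : M → ℝ) {φ : FormField p q M (u + v)} (hφ : IsBiSection g u v φ) :
    IsBiSection g u v (fun x => ρ x • φ x) := by
  intro x
  obtain ⟨a, ha⟩ := hφ x
  exact ⟨ρ x • a, by rw [toForm_smul, ← ha]⟩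

theorem IsBiSection.smul (r : ℝ) {φ : FormField p q M (u + v)} (hφ : IsBiSection g u v φ) :
    IsBiSection g u v (r • φ) := hφ.mul fun _ => r

theorem IsBiform.add {φ ψ : FormField p q M (u + v)} (hφ : IsBiform g u v φ)
    (hψ : IsBiform g u v ψ) : IsBiform g u v (φ + ψ) :=
  ⟨fun c hc => (hφ.1 c hc).add (hψ.1 c hc), hφ.isBiSection.add hψ.isBiSection⟩

theorem IsBiform.smul (r : ℝ) {φ : FormField p q M (u + v)} (hφ : IsBiform g u v φ) :
    IsBiform g u v (r • φ) :=
  ⟨fun c hc => ((contDiffOn_const (c := r)).smul (hφ.1 c hc)).congr fun _ _ => rfl,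
    hφ.isBiSection.smul r⟩

theorem IsBiform.zero : IsBiform g u v 0 := by
  refine ⟨fun c hc => contDiffOn_const (c := 0), fun x => ⟨0, ?_⟩⟩
  have := toForm_smul (metricAt g x) 0 (0 : BiAlt p q u v)
  rw [zero_smul, zero_smul] at this
  rw [this]; rfl

/-- The derivative of the inverse chart is a flag map, and the star is natural for its diagonal
blocks. The pointwise formula thus holds in every chart with the metric of that chart. -/
theorem coef_leafStar (hF : IsFoliatedAtlas p q M) (hc : c ∈ atlas (Model p q) M)
    (hz : z ∈ c.target) (χ : FormField p q M (0 + p)) {v' : ℕ} (hv : v + v' = p)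
    (φ : FormField p q M (u + v)) :
    coef g c u v' (leafStar g χ u hv φ) z =
      (hodgeStar hv (leafGram (chartMetric g c z))⁻¹ (coef g c 0 p χ z 0)).compAlternatingMap
        (coef g c u v φ z) := by
  obtain ⟨A, B, hD⟩ := exists_isFlagMap_chartInvDeriv hF hc hz
  have hG : chartMetric g c z = (metricAt g (c.symm z)).bilinearComp (chartInvDeriv c z)
    (chartInvDeriv c z) := rfl
  have hχ : coef g c 0 p χ z 0 =
      (toBi (u := 0) (v := p) (metricAt g (c.symm z)) (χ (c.symm z)) 0).compLinearMap
        A.mulVecLin := by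
    rw [coef_eq_biPull hD]
    ext x
    rw [biPull_apply, Subsingleton.elim (fun i => B.mulVec ((0 : Fin 0 → Fin q → ℝ) i)) 0]
    rfl
  rw [hχ, coef_eq_biPull hD φ, hodgeStar_biPull_leaf, hG, hD.leafGram,
    mul_inv_conj_mul hD.unit_leaf, coef_eq_biPull hD]
  unfold leafStar
  rw [toBi_toForm]

theorem coef_perpStar (hF : IsFoliatedAtlas p q M) (hc : c ∈ atlas (Model p q) M)
    (hz : z ∈ c.target) (ν : FormField p q M (q + 0)) {u' : ℕ} (hu : u + u' = q)
    (φ : FormField p q M (u + v)) :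
    coef g c u' v (perpStar g ν hu v φ) z =
      hodgeStar hu (normalGram (chartMetric g c z))⁻¹ (leafEval (coef g c q 0 ν z) 0)
        (coef g c u v φ z) := by
  obtain ⟨A, B, hD⟩ := exists_isFlagMap_chartInvDeriv hF hc hz
  have hG : chartMetric g c z = (metricAt g (c.symm z)).bilinearComp (chartInvDeriv c z)
    (chartInvDeriv c z) := rfl
  have hν : leafEval (coef g c q 0 ν z) 0 =
      (leafEval (toBi (u := q) (v := 0) (metricAt g (c.symm z)) (ν (c.symm z))) 0).compLinearMap
        B.mulVecLin := by
    rw [coef_eq_biPull hD]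
    ext y
    rw [leafEval_apply, biPull_apply, AlternatingMap.compLinearMap_apply, leafEval_apply]
    congr 1
    exact Subsingleton.elim _ _
  rw [hν, coef_eq_biPull hD φ, hodgeStar_biPull_perp, hG,
    hD.normalGram (metricAt_isScalarProduct g _), mul_inv_conj_mul hD.unit_normal,
    coef_eq_biPull hD]
  unfold perpStar
  rw [toBi_toForm]
  rfl

theorem isBiform_leafStar (hF : IsFoliatedAtlas p q M) {χ : FormField p q M (0 + p)}
    (hχ : IsBiform g 0 p χ) {v' : ℕ} (hv : v + v' = p)
    {φ : FormField p q M (u + v)} (hφ : IsBiform g u v φ) :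
    IsBiform g u v' (leafStar g χ u hv φ) := by
  refine isBiform_of_coef hF (fun x => ⟨_, rfl⟩) fun c hc y x => ?_
  refine ContDiffOn.congr ?_ fun z hz => by rw [coef_leafStar hF hc hz]
  exact contDiffOn_hodgeStar hv (contDiffOn_leafGram_inv (contDiffOn_chartMetric g hc)
    fun z hz => chartMetric_isScalarProduct hF g hc hz)
    (fun x => hχ.isSmoothBi_coef hF hc 0 x) (fun x => hφ.isSmoothBi_coef hF hc y x) x

theorem isBiform_perpStar (hF : IsFoliatedAtlas p q M) {ν : FormField p q M (q + 0)}
    (hν : IsBiform g q 0 ν) {u' : ℕ} (hu : u + u' = q)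
    {φ : FormField p q M (u + v)} (hφ : IsBiform g u v φ) :
    IsBiform g u' v (perpStar g ν hu v φ) := by
  refine isBiform_of_coef hF (fun x => ⟨_, rfl⟩) fun c hc y x => ?_
  refine ContDiffOn.congr ?_ fun z hz => by
    rw [coef_perpStar hF hc hz, ← leafEval_apply, leafEval_hodgeStar]
  exact contDiffOn_hodgeStar hu (contDiffOn_normalGram_inv (contDiffOn_chartMetric g hc)
    fun z hz => chartMetric_isScalarProduct hF g hc hz)
    (fun y => hν.isSmoothBi_coef hF hc y 0) (fun y => hφ.isSmoothBi_coef hF hc y x) y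

/-- The leafwise partial derivatives of the coefficients of a form. -/
def coefPartial (c : OpenPartialHomeomorph M (Model p q)) (u v : ℕ) (φ : FormField p q M (u + v))
    (z : Model p q) (m : Fin p) : BiAlt p q u v :=
  stdBi (fderiv ℝ (chartRep c φ) z (stdE m, 0))

theorem IsBiSection.vanishesOnLeaf (hF : IsFoliatedAtlas p q M) {φ : FormField p q M (u + v)}
    (hφ : IsBiSection g u v φ) (hc : c ∈ atlas (Model p q) M) (hz : z ∈ c.target) :
    VanishesOnLeaf u v (chartRep c φ z) := by
  rw [hφ.chartRep_eq hF hc hz]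
  exact vanishesOnLeaf_toForm _ _

theorem IsBiSection.coef_eq_stdBi (hF : IsFoliatedAtlas p q M) {φ : FormField p q M (u + v)}
    (hφ : IsBiSection g u v φ) (hc : c ∈ atlas (Model p q) M) (hz : z ∈ c.target) :
    coef g c u v φ z = stdBi (chartRep c φ z) :=
  (hφ.vanishesOnLeaf hF hc hz).toBi_eq _

theorem IsBiform.differentiableAt {φ : FormField p q M (u + v)} (hφ : IsBiform g u v φ)
    (hc : c ∈ atlas (Model p q) M) (hz : z ∈ c.target) :
    DifferentiableAt ℝ (chartRep c φ) z :=
  ((hφ.1 c hc).contDiffAt (c.open_target.mem_nhds hz)).differentiableAt (by simp)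

theorem IsBiform.fderiv_coef (hF : IsFoliatedAtlas p q M) {φ : FormField p q M (u + v)}
    (hφ : IsBiform g u v φ) (hc : c ∈ atlas (Model p q) M) (hz : z ∈ c.target) (m : Fin p)
    (y : Fin u → Fin q → ℝ) (x : Fin v → Fin p → ℝ) :
    fderiv ℝ (fun z => coef g c u v φ z y x) z (stdE m, 0) = coefPartial c u v φ z m y x := by
  have hev : (fun z => coef g c u v φ z y x) =ᶠ[𝓝 z]
      fun z => chartRep c φ z (Fin.append (fun i => (0, y i)) (fun j => (x j, 0))) := by
    filter_upwards [c.open_target.mem_nhds hz] with z' hz'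
    rw [hφ.isBiSection.coef_eq_stdBi hF hc hz', stdBi_apply]
  rw [hev.fderiv_eq, fderiv_apply_const (hφ.differentiableAt hc hz), coefPartial, stdBi_apply]

/-- The local formula d_F = Σ dx_m ∧ ∂_m, with the derivative taken coefficientwise. -/
theorem coef_dLeaf (hF : IsFoliatedAtlas p q M) {φ : FormField p q M (u + v)}
    (hφ : IsBiform g u v φ) (hc : c ∈ atlas (Model p q) M) (hz : z ∈ c.target) :
    coef g c u (v + 1) (dLeaf g u v φ) z =
      ∑ m, biWedge (LinearMap.proj m) (coefPartial c u v φ z m) := by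
  obtain ⟨A, B, hD⟩ := exists_isFlagMap_chartInvDeriv hF hc hz
  have h1 : coef g c u (v + 1) (dLeaf g u v φ) z =
      toBi (u := u) (v := v + 1) (chartMetric g c z) (chartRep c (extD φ) z) := by
    rw [coef_eq_biPull hD]
    unfold dLeaf
    rw [toBi_toForm]
    exact (toBi_comp (u := u) (v := v + 1) (metricAt_isScalarProduct g _) hD _).symm
  rw [h1, chartRep_extD hc hφ.1 hz]
  refine toBi_extDeriv (hφ.differentiableAt hc hz) ?_ _
  filter_upwards [c.open_target.mem_nhds hz] with z' hz'
  exact hφ.isBiSection.vanishesOnLeaf hF hc hz'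

theorem biWedge_add_right (ξ : (Fin p → ℝ) →ₗ[ℝ] ℝ) (a a' : BiAlt p q u v) :
    biWedge ξ (a + a') = biWedge ξ a + biWedge ξ a' := by
  refine biAlt_ext fun y x => ?_
  simp only [biWedge_apply, AlternatingMap.add_apply]
  rw [← mul_add]
  congr 1
  exact congrArg (fun f => f x) (map_add (altWedgeLM ξ) (a y) (a' y))

theorem biWedge_smul_right (ξ : (Fin p → ℝ) →ₗ[ℝ] ℝ) (r : ℝ) (a : BiAlt p q u v) :
    biWedge ξ (r • a) = r • biWedge ξ a := by
  refine biAlt_ext fun y x => ?_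
  simp only [biWedge_apply, AlternatingMap.smul_apply, smul_eq_mul]
  have := congrArg (fun f => f x) (map_smul (altWedgeLM ξ) r (a y))
  change altWedge ξ (r • a y) x = r * altWedge ξ (a y) x at this
  rw [this]
  ring

/-- Writing η ∧ as Σ dx_m ∧ η_m gives it the same shape as d_F, so that the two parts of P_η can be
treated together. -/
theorem biWedge_eq_sum (ξ : (Fin p → ℝ) →ₗ[ℝ] ℝ) (a : BiAlt p q u v) :
    biWedge ξ a = ∑ m, biWedge (LinearMap.proj m) (ξ (stdE m) • a) := by
  refine biAlt_ext fun y x => ?_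
  have hsum : (∑ m, biWedge (LinearMap.proj m) (ξ (stdE m) • a) : BiAlt p q u (v + 1)) y x =
      ∑ m, biWedge (LinearMap.proj m) (ξ (stdE m) • a) y x :=
    map_sum ((altEval x).comp (altEval (V := Fin q → ℝ) y))
      (fun m => (biWedge (LinearMap.proj m) (ξ (stdE m) • a) : BiAlt p q u (v + 1))) Finset.univ
  have hξ : ∀ X : Fin p → ℝ, ξ X = ∑ m, X m * ξ (stdE m) := by
    intro X
    conv_lhs => rw [← Finset.univ_sum_single X, map_sum]
    refine Finset.sum_congr rfl fun m _ => ?_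
    have : Pi.single m (X m) = X m • (stdE m : Fin p → ℝ) := by
      rw [← Pi.single_smul]; simp
    rw [this, map_smul, smul_eq_mul]
  rw [hsum]
  simp only [biWedge_apply, altWedge_apply, AlternatingMap.smul_apply, smul_eq_mul,
    LinearMap.proj_apply, Finset.mul_sum]
  rw [Finset.sum_comm]
  refine Finset.sum_congr rfl fun j _ => ?_
  rw [hξ (x j)]
  simp only [Finset.sum_mul, Finset.mul_sum]
  exact Finset.sum_congr rfl fun m _ => by ring

/-- The components of a leafwise 1-form in a chart. -/
def leafComp (g : Metric p q M) (c : OpenPartialHomeomorph M (Model p q))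
    (η : FormField p q M (0 + 1)) (z : Model p q) (m : Fin p) : ℝ :=
  leafCovector (coef g c 0 1 η z) (stdE m)

theorem isBiSection_twistedD {η : FormField p q M (0 + 1)} (hη : IsBiSection g 0 1 η)
    {φ : FormField p q M (u + v)} (hφ : IsBiSection g u v φ) :
    IsBiSection g u (v + 1) (twistedD g η u v φ) := by
  refine IsBiSection.add (fun x => ⟨_, rfl⟩) fun x => ?_
  obtain ⟨e, he⟩ := hη x
  obtain ⟨a, ha⟩ := hφ x
  refine ⟨biWedge (leafCovector e) a, ?_⟩
  rw [he, ha]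
  exact wedgeOne_toForm _ e a

theorem wedgeOne_comp {k : ℕ} (θ : Model p q [⋀^Fin 1]→L[ℝ] ℝ) (f : Model p q [⋀^Fin k]→L[ℝ] ℝ)
    (D : Model p q →L[ℝ] Model p q) :
    (wedgeOne θ f).compContinuousLinearMap D =
      wedgeOne (θ.compContinuousLinearMap D) (f.compContinuousLinearMap D) := by
  ext w
  rw [ContinuousAlternatingMap.compContinuousLinearMap_apply, wedgeOne_apply, wedgeOne_apply]
  rfl

theorem coef_twistedD (hF : IsFoliatedAtlas p q M) {η : FormField p q M (0 + 1)}
    (hη : IsBiSection g 0 1 η) {φ : FormField p q M (u + v)}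
    (hφ : IsBiform g u v φ) (hc : c ∈ atlas (Model p q) M) (hz : z ∈ c.target) :
    coef g c u (v + 1) (twistedD g η u v φ) z = ∑ m, biWedge (LinearMap.proj m)
      (coefPartial c u v φ z m + leafComp g c η z m • coef g c u v φ z) := by
  have h1 : coef g c u (v + 1) (fun x => wedgeOne (η x) (φ x)) z =
      biWedge (leafCovector (coef g c 0 1 η z)) (coef g c u v φ z) := by
    have e : chartRep c (fun x => wedgeOne (η x) (φ x) : FormField p q M (u + v + 1)) z =
        wedgeOne (chartRep c η z) (chartRep c φ z) := wedgeOne_comp _ _ _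
    change toBi (u := u) (v := v + 1) (chartMetric g c z)
      (chartRep c (fun x => wedgeOne (η x) (φ x) : FormField p q M (u + v + 1)) z) = _
    rw [e, hη.chartRep_eq hF hc hz, hφ.isBiSection.chartRep_eq hF hc hz]
    exact toBi_wedgeOne _ _ _
  have h2 : coef g c u (v + 1) (twistedD g η u v φ) z =
      coef g c u (v + 1) (dLeaf g u v φ) z +
        coef g c u (v + 1) (fun x => wedgeOne (η x) (φ x)) z := rfl
  rw [h2, h1, coef_dLeaf hF hφ hc hz, biWedge_eq_sum, ← Finset.sum_add_distrib]
  exact Finset.sum_congr rfl fun m _ => (biWedge_add_right _ _ _).symm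

theorem IsBiform.isSmoothBi_coefPartial {φ : FormField p q M (u + v)} (hφ : IsBiform g u v φ)
    (hc : c ∈ atlas (Model p q) M) (m : Fin p) :
    IsSmoothBi (fun z => coefPartial c u v φ z m) c.target := by
  intro y x
  simp only [coefPartial, stdBi_apply]
  have h1 : ContDiffOn ℝ ∞ (fun z => fderiv ℝ (chartRep c φ) z) c.target :=
    (hφ.1 c hc).fderiv_of_isOpen c.open_target (by simp)
  exact (ContinuousLinearMap.contDiff
      (ContinuousAlternatingMap.apply ℝ (Model p q) ℝ _)).comp_contDiffOn
    (h1.clm_apply contDiffOn_const)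

theorem isBiform_twistedD (hF : IsFoliatedAtlas p q M) {η : FormField p q M (0 + 1)}
    (hη : IsBiform g 0 1 η) {φ : FormField p q M (u + v)} (hφ : IsBiform g u v φ) :
    IsBiform g u (v + 1) (twistedD g η u v φ) := by
  refine isBiform_of_coef hF (isBiSection_twistedD hη.isBiSection hφ.isBiSection)
    fun c hc y x => ?_
  refine ContDiffOn.congr (f := fun z => ∑ m, biWedge (LinearMap.proj m)
      (coefPartial c u v φ z m + leafComp g c η z m • coef g c u v φ z) y x) ?_ fun z hz => ?_
  · refine ContDiffOn.sum fun m _ => ?_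
    simp only [biWedge_apply, altWedge_apply, AlternatingMap.add_apply, AlternatingMap.smul_apply]
    refine contDiffOn_const.mul (ContDiffOn.sum fun i _ => contDiffOn_const.mul
      (contDiffOn_const.mul ?_))
    exact (hφ.isSmoothBi_coefPartial hc m _ _).add
      ((hη.isSmoothBi_coef hF hc 0 _).mul (hφ.isSmoothBi_coef hF hc _ _))
  · rw [coef_twistedD hF hη.isBiSection hφ hc hz]
    exact map_sum ((altEval x).comp (altEval (V := Fin q → ℝ) y)) (fun m =>
      (biWedge (LinearMap.proj m) (coefPartial c u v φ z m +
        leafComp g c η z m • coef g c u v φ z) : BiAlt p q u (v + 1))) Finset.univ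

end Coef

/-! ### Bundle-like metrics -/

section Geodesics

variable {E : Type*} [NormedAddCommGroup E] [NormedSpace ℝ E] [FiniteDimensional ℝ E]

theorem isInvertible_of_pos {b : E →L[ℝ] E →L[ℝ] ℝ} (hb : ∀ v, v ≠ 0 → 0 < b v v) :
    b.IsInvertible := by
  have hinj : Function.Injective (b : E →ₗ[ℝ] E →L[ℝ] ℝ) := by
    rw [injective_iff_map_eq_zero]
    intro v hv
    by_contra hne
    have := hb v hne
    have h0 : b v = 0 := hv
    rw [h0] at this
    exact lt_irrefl _ this
  have hdim : Module.finrank ℝ (E) = Module.finrank ℝ (E →L[ℝ] ℝ) := by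
    rw [← (LinearMap.toContinuousLinearMap (𝕜 := ℝ) (E := E) (F' := ℝ)).finrank_eq]
    exact (Subspace.dual_finrank_eq (K := ℝ) (V := E)).symm
  refine ⟨(LinearMap.linearEquivOfInjective _ hinj hdim).toContinuousLinearEquiv, ?_⟩
  ext v w
  rfl

/-- The acceleration of a geodesic at the point `w.1` with velocity `w.2`. -/
def geodesicAcceleration (G : E → E →L[ℝ] E →L[ℝ] ℝ) (w : E × E) : E :=
  (G w.1).inverse ((1 / 2 : ℝ) • ((fderiv ℝ G w.1).flip w.2).flip w.2 - fderiv ℝ G w.1 w.2 w.2)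

theorem geodesicAcceleration_spec {G : E → E →L[ℝ] E →L[ℝ] ℝ} {w : E × E}
    (hG : ∀ v, v ≠ 0 → 0 < G w.1 v v) (y : E) :
    G w.1 (geodesicAcceleration G w) y + fderiv ℝ G w.1 w.2 w.2 y
      - (1 / 2) * fderiv ℝ G w.1 y w.2 w.2 = 0 := by
  have h := DFunLike.congr_fun (isInvertible_of_pos hG).self_comp_inverse
    ((1 / 2 : ℝ) • ((fderiv ℝ G w.1).flip w.2).flip w.2 - fderiv ℝ G w.1 w.2 w.2)
  have h' : G w.1 (geodesicAcceleration G w) =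
    (1 / 2 : ℝ) • ((fderiv ℝ G w.1).flip w.2).flip w.2 - fderiv ℝ G w.1 w.2 w.2 := h
  rw [h']
  simp

set_option maxSynthPendingDepth 3 in
theorem contDiffOn_geodesicAcceleration {G : E → E →L[ℝ] E →L[ℝ] ℝ} {U : Set (E)}
    (hU : IsOpen U) (hG : ContDiffOn ℝ ∞ G U) (hsp : ∀ z ∈ U, ∀ v, v ≠ 0 → 0 < G z v v) :
    ContDiffOn ℝ 1 (geodesicAcceleration G) (U ×ˢ Set.univ) := by
  have hG1 : ContDiffOn ℝ 1 (fun w : E × E => G w.1) (U ×ˢ Set.univ) :=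
    (hG.of_le (by simp)).comp contDiff_fst.contDiffOn fun w hw => hw.1
  have hdG : ContDiffOn ℝ 1 (fun w : E × E => fderiv ℝ G w.1) (U ×ˢ Set.univ) :=
    ((hG.of_le two_le_infty).fderiv_of_isOpen (m := 1) hU
      (by norm_num)).comp contDiff_fst.contDiffOn fun w hw => hw.1
  have hv : ContDiffOn ℝ 1 (fun w : E × E => w.2) (U ×ˢ Set.univ) :=
    contDiff_snd.contDiffOn
  have hinv : ContDiffOn ℝ 1 (fun w : E × E => (G w.1).inverse)
      (U ×ˢ Set.univ) := by
    intro w hw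
    obtain ⟨e, he⟩ := isInvertible_of_pos (hsp w.1 hw.1)
    have h1 := contDiffAt_map_inverse (𝕜 := ℝ) (n := 1) e
    rw [he] at h1
    exact ContDiffAt.comp_contDiffWithinAt w h1 (hG1 w hw)
  have hflip : ContDiffOn ℝ 1 (fun w : E × E =>
      ((fderiv ℝ G w.1).flip w.2).flip w.2) (U ×ˢ Set.univ) := by
    have h1 : ContDiffOn ℝ 1 (fun w : E × E => (fderiv ℝ G w.1).flip w.2)
        (U ×ˢ Set.univ) :=
      ((ContinuousLinearMap.flipₗᵢ ℝ (E) (E)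
        (E →L[ℝ] ℝ)).contDiff.comp_contDiffOn hdG).clm_apply hv
    exact ((ContinuousLinearMap.flipₗᵢ ℝ (E) (E)
      ℝ).contDiff.comp_contDiffOn h1).clm_apply hv
  exact hinv.clm_apply ((hflip.const_smul (1 / 2 : ℝ)).sub ((hdG.clm_apply hv).clm_apply hv))

/-- Local existence of geodesics. -/
theorem exists_geodesic {G : E → E →L[ℝ] E →L[ℝ] ℝ} {U : Set (E)}
    (hU : IsOpen U) (hG : ContDiffOn ℝ ∞ G U) (hsp : ∀ z ∈ U, ∀ v, v ≠ 0 → 0 < G z v v)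
    {z₀ : E} (hz₀ : z₀ ∈ U) (v₀ : E) :
    ∃ (z v : ℝ → E) (ε : ℝ), 0 < ε ∧ z 0 = z₀ ∧ v 0 = v₀ ∧
      (∀ t ∈ Set.Ioo (-ε) ε, z t ∈ U) ∧
      (∀ t ∈ Set.Ioo (-ε) ε, HasDerivAt z (v t) t) ∧
      (∀ t ∈ Set.Ioo (-ε) ε, HasDerivAt v (geodesicAcceleration G (z t, v t)) t) := by
  have hopen : IsOpen (U ×ˢ (Set.univ : Set (E))) := hU.prod isOpen_univ
  have hF : ContDiffAt ℝ 1 (fun w : E × E => (w.2, geodesicAcceleration G w))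
      (z₀, v₀) :=
    contDiff_snd.contDiffAt.prodMk ((contDiffOn_geodesicAcceleration hU hG hsp).contDiffAt
      (hopen.mem_nhds ⟨hz₀, trivial⟩))
  obtain ⟨α, hα0, ε, hε, hα⟩ :=
    hF.exists_forall_mem_closedBall_exists_eq_forall_mem_Ioo_hasDerivAt₀ 0
  simp only [zero_sub, zero_add] at hα
  have hcont : ContinuousAt (fun t => (α t).1) 0 :=
    continuous_fst.continuousAt.comp (hα 0 ⟨by linarith, hε⟩).continuousAt
  have hmem : ∀ᶠ t in 𝓝 (0 : ℝ), (α t).1 ∈ U :=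
    hcont.eventually (hU.mem_nhds (by simpa [hα0] using hz₀))
  obtain ⟨δ, hδ, hball⟩ := Metric.eventually_nhds_iff.mp hmem
  have hsub : ∀ t ∈ Set.Ioo (-(min ε δ)) (min ε δ), t ∈ Set.Ioo (-ε) ε ∧ dist t 0 < δ := by
    intro t ht
    have h1 := min_le_left ε δ
    have h2 := min_le_right ε δ
    refine ⟨⟨by linarith [ht.1], by linarith [ht.2]⟩, ?_⟩
    rw [Real.dist_eq, sub_zero, abs_lt]
    exact ⟨by linarith [ht.1], by linarith [ht.2]⟩
  refine ⟨fun t => (α t).1, fun t => (α t).2, min ε δ, lt_min hε hδ, by simp [hα0],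
    by simp [hα0], fun t ht => hball (hsub t ht).2, fun t ht => ?_, fun t ht => ?_⟩
  · exact hasFDerivAt_fst.comp_hasDerivAt t (hα t (hsub t ht).1)
  · exact hasFDerivAt_snd.comp_hasDerivAt t (hα t (hsub t ht).1)

end Geodesics

/-! ### Derivatives of the transverse metric along the leaves -/

section BundleLike

variable {p q : ℕ} {M : Type*} [TopologicalSpace M] [ChartedSpace (Model p q) M]
  [IsManifold 𝓘(ℝ, Model p q) ∞ M] {g : Metric p q M}
  {c : OpenPartialHomeomorph M (Model p q)}

theorem isOrthogonalToLeafAt_iff (hF : IsFoliatedAtlas p q M) (hc : c ∈ atlas (Model p q) M)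
    {z : ℝ → Model p q} {v : Model p q} {t : ℝ} (hz : z t ∈ c.target) (hv : HasDerivAt z v t) :
    IsOrthogonalToLeafAt g (fun s => c.symm (z s)) t ↔
      ∀ X : Fin p → ℝ, chartMetric g c (z t) v (X, 0) = 0 := by
  obtain ⟨A, B, hD⟩ := exists_isFlagMap_chartInvDeriv hF hc hz
  have hmf : mfderiv 𝓘(ℝ, ℝ) 𝓘(ℝ, Model p q) (fun s => c.symm (z s)) t (1 : ℝ) =
      chartInvDeriv c (z t) v := by
    have h1 := mfderiv_comp t (mdifferentiableAt_chart_symm hc hz)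
      hv.differentiableAt.mdifferentiableAt
    have h2 : (fun s => c.symm (z s)) = c.symm ∘ z := rfl
    rw [h2, h1, mfderiv_eq_fderiv]
    change chartInvDeriv c (z t) (fderiv ℝ z t 1) = _
    rw [hv.hasFDerivAt.fderiv]
    simp
  unfold IsOrthogonalToLeafAt
  rw [hmf]
  constructor
  · intro h X
    change metricAt g (c.symm (z t)) (chartInvDeriv c (z t) v) (chartInvDeriv c (z t) (X, 0)) = 0
    rw [hD.inl]
    exact h _
  · intro h X
    have := h (A⁻¹.mulVec X)
    change metricAt g (c.symm (z t)) (chartInvDeriv c (z t) v)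
      (chartInvDeriv c (z t) (A⁻¹.mulVec X, 0)) = 0 at this
    rwa [hD.inl, Matrix.mulVec_mulVec, Matrix.mul_nonsing_inv _ hD.unit_leaf,
      Matrix.one_mulVec] at this

/-- The metric of the normal bundle of a bundle-like metric is constant along the leaves:
infinitesimal form. -/
theorem IsBundleLike.fderiv_chartMetric (hF : IsFoliatedAtlas p q M) (hg : IsBundleLike g)
    (hc : c ∈ atlas (Model p q) M) {z₀ : Model p q} (hz₀ : z₀ ∈ c.target) {n : Model p q}
    (hn : ∀ X, chartMetric g c z₀ n (X, 0) = 0) (X : Fin p → ℝ) :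
    fderiv ℝ (chartMetric g c) z₀ (X, 0) n n = 0 := by
  have hsp : ∀ z ∈ c.target, IsScalarProduct (chartMetric g c z) :=
    fun z hz => chartMetric_isScalarProduct hF g hc hz
  have hG := contDiffOn_chartMetric g hc
  have hpos : ∀ z ∈ c.target, ∀ v, v ≠ 0 → 0 < chartMetric g c z v v :=
    fun z hz => (hsp z hz).pos
  -- The test curve is the geodesic with initial velocity n, which by hypothesis is orthogonal to
  -- the leaf through z₀.
  obtain ⟨z, v, ε, hε, rfl, rfl, hzU, hz, hv⟩ := exists_geodesic c.open_target hG hpos hz₀ n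
  set γ : ℝ → M := fun s => c.symm (z s) with hγ
  have h0 : (0 : ℝ) ∈ Set.Ioo (-ε) ε := ⟨by linarith, hε⟩
  have hev : ∀ t ∈ Set.Ioo (-ε) ε, (fun s => c (γ s)) =ᶠ[𝓝 t] z := by
    intro t ht
    filter_upwards [isOpen_Ioo.mem_nhds ht] with s hs
    exact c.right_inv (hzU s hs)
  have hdz : ∀ t ∈ Set.Ioo (-ε) ε, deriv (fun s => c (γ s)) t = v t := fun t ht => by
    rw [(hev t ht).deriv_eq, (hz t ht).deriv]
  have hddz : ∀ t ∈ Set.Ioo (-ε) ε, deriv (deriv fun s => c (γ s)) t =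
      geodesicAcceleration (chartMetric g c) (z t, v t) := fun t ht => by
    have : deriv (fun s => c (γ s)) =ᶠ[𝓝 t] v := by
      filter_upwards [isOpen_Ioo.mem_nhds ht] with s hs using hdz s hs
    rw [this.deriv_eq, (hv t ht).deriv]
  have hzC : ContDiffOn ℝ 2 z (Set.Ioo (-ε) ε) := by
    have hzc : ContinuousOn z (Set.Ioo (-ε) ε) :=
      fun t ht => (hz t ht).continuousAt.continuousWithinAt
    have hvc : ContinuousOn v (Set.Ioo (-ε) ε) :=
      fun t ht => (hv t ht).continuousAt.continuousWithinAt
    have hvC : ContDiffOn ℝ (0 + 1) v (Set.Ioo (-ε) ε) := by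
      rw [contDiffOn_succ_iff_deriv_of_isOpen isOpen_Ioo]
      refine ⟨fun t ht => (hv t ht).differentiableAt.differentiableWithinAt, by simp, ?_⟩
      rw [contDiffOn_zero]
      refine ContinuousOn.congr ?_ fun t ht => (hv t ht).deriv
      exact (contDiffOn_geodesicAcceleration c.open_target hG hpos).continuousOn.comp
        (hzc.prodMk hvc) fun t ht => ⟨hzU t ht, trivial⟩
    have h2 : (2 : WithTop ℕ∞) = 1 + 1 := by norm_num
    rw [h2, contDiffOn_succ_iff_deriv_of_isOpen isOpen_Ioo]
    refine ⟨fun t ht => (hz t ht).differentiableAt.differentiableWithinAt, by simp, ?_⟩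
    rw [zero_add] at hvC
    exact hvC.congr fun t ht => (hz t ht).deriv
  have hgeo : IsGeodesicOn g γ (-ε) ε := by
    refine ⟨?_, fun t ht => ⟨c, hc, c.map_target (hzU t ht), fun w => ?_⟩⟩
    · exact ((contMDiffOn_symm_of_mem_maximalAtlas (IsManifold.subset_maximalAtlas
        (I := 𝓘(ℝ, Model p q)) (n := ∞) hc)).of_le two_le_infty).comp
          (contMDiffOn_iff_contDiffOn.mpr hzC) fun t ht => hzU t ht
    · have e : c (γ t) = z t := c.right_inv (hzU t ht)
      simp only [hdz t ht, hddz t ht, e]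
      exact geodesicAcceleration_spec (w := (z t, v t)) (hpos _ (hzU t ht)) w
  have horth := hg γ (-ε) ε hgeo
    ⟨0, h0, (isOrthogonalToLeafAt_iff hF hc (hzU 0 h0) (hz 0 h0)).mpr hn⟩
  have hzero : (fun t => chartMetric g c (z t) (v t) (X, 0)) =ᶠ[𝓝 0] fun _ => (0 : ℝ) := by
    filter_upwards [isOpen_Ioo.mem_nhds h0] with t ht
    exact (isOrthogonalToLeafAt_iff hF hc (hzU t ht) (hz t ht)).mp (horth t ht) X
  have hGd : HasDerivAt (fun t => chartMetric g c (z t))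
      (fderiv ℝ (chartMetric g c) (z 0) (v 0)) 0 :=
    ((hG.contDiffAt (c.open_target.mem_nhds hz₀)).differentiableAt
      (by simp)).hasFDerivAt.comp_hasDerivAt 0 (hz 0 h0)
  -- The derivative of G(z', (X, 0)) = 0 at time 0 reads G(z'', (X, 0)) + (D_{z'} G)(z', (X, 0)) =
  -- 0. The geodesic equation with w = (X, 0) contains the same two terms, and the difference is
  -- half of the claimed quantity.
  have hd := (hGd.clm_apply (hv 0 h0)).clm_apply (hasDerivAt_const (0 : ℝ) ((X, 0) : Model p q))
  have h1 := hd.unique ((hasDerivAt_const (0 : ℝ) (0 : ℝ)).congr_of_eventuallyEq hzero)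
  have h2 := geodesicAcceleration_spec (w := (z 0, v 0)) (hpos _ hz₀) (X, 0)
  simp only [map_zero, add_zero, add_apply] at h1
  simp only at h2
  linarith

theorem fderiv_chartMetric_symm (hF : IsFoliatedAtlas p q M) (hc : c ∈ atlas (Model p q) M)
    {z : Model p q} (hz : z ∈ c.target) (w v v' : Model p q) :
    fderiv ℝ (chartMetric g c) z w v v' = fderiv ℝ (chartMetric g c) z w v' v := by
  have hd : DifferentiableAt ℝ (chartMetric g c) z :=
    ((contDiffOn_chartMetric g hc).contDiffAt (c.open_target.mem_nhds hz)).differentiableAt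
      (by simp)
  have key : ∀ v v' : Model p q, fderiv ℝ (fun y => chartMetric g c y v v') z w =
      fderiv ℝ (chartMetric g c) z w v v' := fun v v' => by
    rw [((hd.hasFDerivAt.clm_apply (hasFDerivAt_const v z)).clm_apply
      (hasFDerivAt_const v' z)).fderiv]
    simp
  have hev : (fun y => chartMetric g c y v v') =ᶠ[𝓝 z] fun y => chartMetric g c y v' v := by
    filter_upwards [c.open_target.mem_nhds hz] with y hy
    exact (chartMetric_isScalarProduct hF g hc hy).symm v v'
  rw [← key, ← key, hev.fderiv_eq]

/-- The transverse part of a normal lift is constant, so its derivative is leafwise and orthogonal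
to the other lift. Only the derivative of the metric on two normal vectors remains, and it vanishes
by polarisation of the quadratic statement. -/
theorem IsBundleLike.fderiv_normalGram (hF : IsFoliatedAtlas p q M) (hg : IsBundleLike g)
    (hc : c ∈ atlas (Model p q) M) {z : Model p q} (hz : z ∈ c.target) (a b : Fin q)
    (X : Fin p → ℝ) :
    fderiv ℝ (fun y => normalGram (chartMetric g c y) a b) z (X, 0) = 0 := by
  have hsp : ∀ z ∈ c.target, IsScalarProduct (chartMetric g c z) :=
    fun z hz => chartMetric_isScalarProduct hF g hc hz
  have hG := contDiffOn_chartMetric g hc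
  have hb := hsp z hz
  have hnhds := c.open_target.mem_nhds hz
  have hGd : HasFDerivAt (chartMetric g c) (fderiv ℝ (chartMetric g c) z) z :=
    ((hG.contDiffAt hnhds).differentiableAt (by simp)).hasFDerivAt
  set N : (Fin q → ℝ) → Model p q → Model p q := fun Y y => normalLift (chartMetric g c y) Y
    with hN
  have hNd : ∀ Y, HasFDerivAt (N Y) (fderiv ℝ (N Y) z) z := fun Y =>
    (((contDiffOn_normalLift hG hsp Y).contDiffAt hnhds).differentiableAt (by simp)).hasFDerivAt
  have hN2 : ∀ Y w, (fderiv ℝ (N Y) z w).2 = 0 := by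
    intro Y w
    have h1 : HasFDerivAt (fun y => (N Y y).2)
      ((ContinuousLinearMap.snd ℝ _ _).comp (fderiv ℝ (N Y) z)) z :=
        hasFDerivAt_snd.comp z (hNd Y)
    have h2 : HasFDerivAt (fun y => (N Y y).2) (0 : Model p q →L[ℝ] (Fin q → ℝ)) z :=
      hasFDerivAt_const Y z
    exact DFunLike.congr_fun (h1.unique h2) w
  have hN' : ∀ Y w, fderiv ℝ (N Y) z w = ((fderiv ℝ (N Y) z w).1, 0) := fun Y w =>
    Prod.ext rfl (hN2 Y w)
  have horth : ∀ Y X, chartMetric g c z (N Y z) (X, 0) = 0 := fun Y X => by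
    rw [hb.symm]; exact normalLift_orthogonal hb Y X
  have hdiag : ∀ Y, fderiv ℝ (chartMetric g c) z (X, 0) (N Y z) (N Y z) = 0 := fun Y =>
    hg.fderiv_chartMetric hF hc hz (horth Y) X
  have hpol : fderiv ℝ (chartMetric g c) z (X, 0) (N (Pi.single a 1) z)
      (N (Pi.single b 1) z) = 0 := by
    have h1 := hdiag (Pi.single a 1 + Pi.single b 1)
    have hadd : N (Pi.single a 1 + Pi.single b 1) z = N (Pi.single a 1) z + N (Pi.single b 1) z :=
      map_add _ _ _
    rw [hadd] at h1
    simp only [map_add, add_apply, hdiag] at h1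
    rw [fderiv_chartMetric_symm hF hc hz _ (N (Pi.single b 1) z)] at h1
    linarith
  have hd : HasFDerivAt (fun y => normalGram (chartMetric g c y) a b) _ z :=
    (hGd.clm_apply (hNd (Pi.single a 1))).clm_apply (hNd (Pi.single b 1))
  rw [hd.fderiv]
  simp only [add_apply, ContinuousLinearMap.comp_apply,
    ContinuousLinearMap.flip_apply]
  rw [hN' (Pi.single a 1), hN' (Pi.single b 1), hpol, horth, hb.symm, horth]
  simp

end BundleLike

/-! ### Volume densities -/

section Volume

variable {p q u v n : ℕ}

theorem formInner_stdVol_eq_det {H : Matrix (Fin n) (Fin n) ℝ} (hH : H.PosDef) :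
    formInner H (stdVol n) (stdVol n) = H.det := by
  obtain ⟨A, rfl, -⟩ := exists_mul_transpose_eq hH
  have h := vol_eq_smul_stdVol ((stdVol n).compLinearMap A.mulVecLin)
  have hdet : (stdVol n).compLinearMap A.mulVecLin (fun i => stdE i) = A.det := by
    rw [AlternatingMap.compLinearMap_apply]
    unfold stdVol
    rw [Pi.basisFun_det_apply, ← Matrix.det_transpose]
    congr 1
    ext i j
    simp [Matrix.mulVec_single]
  rw [← formInner_comp, h, hdet, formInner_smul_left, formInner_smul_right, formInner_stdVol,
    Matrix.det_mul, Matrix.det_mul, Matrix.det_transpose, Matrix.det_one]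
  ring

/-- The standard volume form has squared length det L⁻¹, so a volume form of length one has
coefficient ± √(det L). -/
theorem vol_sq_eq_det {L : Matrix (Fin n) (Fin n) ℝ} (hL : L.PosDef)
    {vol : (Fin n → ℝ) [⋀^Fin n]→ₗ[ℝ] ℝ} (hvol : formInner L⁻¹ vol vol = 1) :
    vol (fun i => stdE i) ^ 2 = L.det := by
  have hdet := hL.det_pos.ne'
  rw [vol_eq_smul_stdVol vol, formInner_smul_left, formInner_smul_right,
    formInner_stdVol_eq_det hL.inv, Matrix.det_nonsing_inv, Ring.inverse_eq_inv'] at hvol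
  field_simp at hvol
  exact hvol

theorem biForm_zero_left (N : Matrix (Fin q) (Fin q) ℝ) (H : Matrix (Fin p) (Fin p) ℝ)
    (a a' : BiAlt p q 0 v) : biForm N H a a' = formInner H (a 0) (a' 0) := by
  unfold biForm
  rw [Fintype.sum_unique, Fintype.sum_unique]
  simp only [Finset.univ_eq_empty, Finset.prod_empty, Nat.factorial_zero, Nat.cast_one, inv_one,
    one_mul]
  congr 2 <;> exact Subsingleton.elim _ _

theorem biForm_zero_right (N : Matrix (Fin q) (Fin q) ℝ) (H : Matrix (Fin p) (Fin p) ℝ)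
    (a a' : BiAlt p q u 0) : biForm N H a a' = formInner N (leafEval a 0) (leafEval a' 0) := by
  rw [biForm_eq_leafEval, Fintype.sum_unique, Fintype.sum_unique]
  simp only [Finset.univ_eq_empty, Finset.prod_empty, Nat.factorial_zero, Nat.cast_one, inv_one,
    one_mul]
  congr 2 <;> exact Subsingleton.elim _ _

/-- The Gram matrix of the normal lifts is the Schur complement of the leafwise block. -/
theorem det_gram {b : Bilin p q} (hb : IsScalarProduct b) :
    (Matrix.of fun s t : Fin p ⊕ Fin q => b (stdVec p q s) (stdVec p q t)).det =
      (leafGram b).det * (normalGram b).det := by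
  have hdet : IsUnit (leafGram b).det := isUnit_iff_ne_zero.mpr (leafGram_posDef hb).det_pos.ne'
  let C : Matrix (Fin p) (Fin q) ℝ := Matrix.of fun i a => b (stdE i, 0) (0, stdE a)
  let R : Matrix (Fin q) (Fin q) ℝ := Matrix.of fun a c => b (0, stdE a) (0, stdE c)
  have hblock : (Matrix.of fun s t : Fin p ⊕ Fin q => b (stdVec p q s) (stdVec p q t)) =
      Matrix.fromBlocks (leafGram b) C C.transpose R := by
    ext (i | a) (j | c)
    · rfl
    · rfl
    · exact hb.symm _ _
    · rfl
  have hN : normalGram b = R - C.transpose * (leafGram b)⁻¹ * C := by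
    ext a c
    have h1 : normalLift b (stdE a) = ((normalLift b (stdE a)).1, 0) + (0, stdE a) :=
      Prod.ext (by simp) (by simp [normalLift_snd])
    have h2 : normalLift b (stdE c) =
        (0, stdE c) - ((leafGram b)⁻¹.mulVec (fun i => C i c), 0) := by
      refine Prod.ext ?_ (by simp [normalLift_snd])
      simp only [Prod.fst_sub, zero_sub]
      rfl
    change b (normalLift b (stdE a)) (normalLift b (stdE c)) = _
    rw [h1, map_add, add_apply, normalLift_orthogonal hb, zero_add, h2, map_sub,
      inl_eq_sum]
    simp only [map_sum, map_smul, smul_eq_mul, Matrix.sub_apply, Matrix.mul_assoc,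
      Matrix.mul_apply (M := C.transpose)]
    congr 1
    refine Finset.sum_congr rfl fun i _ => ?_
    rw [hb.symm, mul_comm]
    rfl
  let := Matrix.invertibleOfIsUnitDet _ hdet
  rw [hblock, Matrix.det_fromBlocks₁₁, Matrix.invOf_eq_nonsing_inv, hN]

end Volume

/-! ### Quantities that are constant along the leaves -/

section Lines

variable {E : Type*} [NormedAddCommGroup E] [NormedSpace ℝ E]

theorem tendsto_line (z w : E) : Filter.Tendsto (fun t : ℝ => z + t • w) (𝓝 0) (𝓝 z) := by
  have : ContinuousAt (fun t : ℝ => z + t • w) 0 := by fun_prop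
  simpa [ContinuousAt] using this

theorem eventually_line_eq_of_fderiv_eq_zero {U : Set E} (hU : IsOpen U) {f : E → ℝ}
    (hf : DifferentiableOn ℝ f U) {w : E} (hw : ∀ y ∈ U, fderiv ℝ f y w = 0) {z : E}
    (hz : z ∈ U) : ∀ᶠ t in 𝓝 (0 : ℝ), f (z + t • w) = f z := by
  have hmem : ∀ᶠ t in 𝓝 (0 : ℝ), z + t • w ∈ U := tendsto_line z w (hU.mem_nhds hz)
  obtain ⟨δ, hδ, hball⟩ := Metric.eventually_nhds_iff_ball.mp hmem
  have hd : ∀ t ∈ Metric.ball (0 : ℝ) δ, HasDerivAt (fun t : ℝ => f (z + t • w)) 0 t := by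
    intro t ht
    have h1 : HasDerivAt (fun t : ℝ => z + t • w) w t := by
      simpa using ((hasDerivAt_id t).smul_const w).const_add z
    have h2 := ((hf _ (hball t ht)).differentiableAt
      (hU.mem_nhds (hball t ht))).hasFDerivAt.comp_hasDerivAt t h1
    rwa [hw _ (hball t ht)] at h2
  filter_upwards [Metric.ball_mem_nhds (0 : ℝ) hδ] with t ht
  have := Metric.isOpen_ball.is_const_of_deriv_eq_zero (convex_ball (0 : ℝ) δ).isPreconnected
    (fun t ht => (hd t ht).differentiableAt.differentiableWithinAt) (fun t ht => (hd t ht).deriv)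
    ht (Metric.mem_ball_self hδ)
  simpa using this

/-- The values ± f z are 2|f z| apart, so a continuous function whose square is constant cannot
change its sign near z. This transfers constancy of a determinant to its signed square roots. -/
theorem eventually_line_eq_of_sq {f : E → ℝ} {z w : E} (hf : ContinuousAt f z) (h0 : f z ≠ 0)
    (h : ∀ᶠ t in 𝓝 (0 : ℝ), f (z + t • w) ^ 2 = f z ^ 2) :
    ∀ᶠ t in 𝓝 (0 : ℝ), f (z + t • w) = f z := by
  have h1 : Filter.Tendsto (fun t : ℝ => f (z + t • w)) (𝓝 0) (𝓝 (f z)) :=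
    hf.tendsto.comp (tendsto_line z w)
  have h2 := Metric.tendsto_nhds.mp h1 |f z| (abs_pos.mpr h0)
  filter_upwards [h, h2] with t ht ht'
  rcases sq_eq_sq_iff_eq_or_eq_neg.mp ht with e | e
  · exact e
  · rw [e, Real.dist_eq] at ht'
    have : |-f z - f z| = 2 * |f z| := by
      rw [show -f z - f z = -(2 * f z) by ring, abs_neg, abs_mul, abs_two]
    have := abs_pos.mpr h0
    linarith

theorem fderiv_eq_of_line {f : E → ℝ} {z w : E} (hf : DifferentiableAt ℝ f z) {r : ℝ}
    (h : HasDerivAt (fun t : ℝ => f (z + t • w)) r 0) : fderiv ℝ f z w = r := by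
  rw [← hf.lineDeriv_eq_fderiv]
  exact h.deriv

theorem hasDerivAt_line {f : E → ℝ} {z w : E} (hf : DifferentiableAt ℝ f z) :
    HasDerivAt (fun t : ℝ => f (z + t • w)) (fderiv ℝ f z w) 0 := by
  rw [← hf.lineDeriv_eq_fderiv]
  exact hf.lineDifferentiableAt.hasDerivAt

end Lines

/-! ### Constancy of the transverse volume and of the density ratio along plaques -/

section LeafConstant

variable {p q : ℕ} {M : Type*} [TopologicalSpace M] [ChartedSpace (Model p q) M]
  [IsManifold 𝓘(ℝ, Model p q) ∞ M] {g : Metric p q M} {u v : ℕ}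
  {c : OpenPartialHomeomorph M (Model p q)} {z : Model p q}

theorem IsBundleLike.eventually_normalGram (hF : IsFoliatedAtlas p q M) (hg : IsBundleLike g)
    (hc : c ∈ atlas (Model p q) M) (hz : z ∈ c.target) (X : Fin p → ℝ) :
    ∀ᶠ t in 𝓝 (0 : ℝ), normalGram (chartMetric g c (z + t • ((X, 0) : Model p q))) =
      normalGram (chartMetric g c z) := by
  have h : ∀ a b : Fin q, ∀ᶠ t in 𝓝 (0 : ℝ),
      normalGram (chartMetric g c (z + t • ((X, 0) : Model p q))) a b =
        normalGram (chartMetric g c z) a b := fun a b =>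
    eventually_line_eq_of_fderiv_eq_zero c.open_target
      ((contDiffOn_normalGram (contDiffOn_chartMetric g hc)
        (fun z hz => chartMetric_isScalarProduct hF g hc hz) a b).differentiableOn (by simp))
      (fun y hy => hg.fderiv_normalGram hF hc hy a b X) hz
  filter_upwards [Filter.eventually_all.mpr fun a => Filter.eventually_all.mpr (h a)] with t ht
  ext a b
  exact ht a b

theorem IsTransverseVolume.formInner_coef (hF : IsFoliatedAtlas p q M)
    {ν : FormField p q M (q + 0)} (hν : IsTransverseVolume g ν) (hc : c ∈ atlas (Model p q) M)
    (hz : z ∈ c.target) : formInner (normalGram (chartMetric g c z))⁻¹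
      (leafEval (coef g c q 0 ν z) 0) (leafEval (coef g c q 0 ν z) 0) = 1 := by
  rw [← biForm_zero_right _ (leafGram (chartMetric g c z))⁻¹, ← biInner_eq_biForm,
    biInner_coef hF hc hz]
  exact hν.2 _

theorem IsLeafVolume.formInner_coef (hF : IsFoliatedAtlas p q M)
    {χ : FormField p q M (0 + p)} (hχ : IsLeafVolume g χ) (hc : c ∈ atlas (Model p q) M)
    (hz : z ∈ c.target) : formInner (leafGram (chartMetric g c z))⁻¹
      (coef g c 0 p χ z 0) (coef g c 0 p χ z 0) = 1 := by
  rw [← biForm_zero_left (normalGram (chartMetric g c z))⁻¹, ← biInner_eq_biForm,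
    biInner_coef hF hc hz]
  exact hχ.2 _

theorem IsTransverseVolume.eventually_coef (hF : IsFoliatedAtlas p q M) (hg : IsBundleLike g)
    {ν : FormField p q M (q + 0)} (hν : IsTransverseVolume g ν) (hc : c ∈ atlas (Model p q) M)
    (hz : z ∈ c.target) (X : Fin p → ℝ) :
    ∀ᶠ t in 𝓝 (0 : ℝ), leafEval (coef g c q 0 ν (z + t • ((X, 0) : Model p q))) 0 =
      leafEval (coef g c q 0 ν z) 0 := by
  set s : Model p q → ℝ := fun y => leafEval (coef g c q 0 ν y) 0 fun i => stdE i with hs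
  have hsq : ∀ y ∈ c.target, s y ^ 2 = (normalGram (chartMetric g c y)).det := fun y hy =>
    vol_sq_eq_det (normalGram_posDef (chartMetric_isScalarProduct hF g hc hy))
      (hν.formInner_coef hF hc hy)
  have hpos := (normalGram_posDef (chartMetric_isScalarProduct hF g hc hz)).det_pos
  have h0 : s z ≠ 0 := fun h => by
    have := hsq z hz
    rw [h] at this
    simp [← this] at hpos
  have hcont : ContinuousAt s z :=
    (hν.1.isSmoothBi_coef hF hc _ _).continuousOn.continuousAt (c.open_target.mem_nhds hz)
  have hmem : ∀ᶠ t in 𝓝 (0 : ℝ), z + t • ((X, 0) : Model p q) ∈ c.target :=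
    tendsto_line z _ (c.open_target.mem_nhds hz)
  have := eventually_line_eq_of_sq (w := ((X, 0) : Model p q)) hcont h0 (by
    filter_upwards [hmem, hg.eventually_normalGram hF hc hz X] with t ht ht'
    rw [hsq _ ht, hsq _ hz, ht'])
  filter_upwards [this] with t ht
  rw [vol_eq_smul_stdVol (leafEval (coef g c q 0 ν (z + t • ((X, 0) : Model p q))) 0),
    vol_eq_smul_stdVol (leafEval (coef g c q 0 ν z) 0)]
  exact congrArg (· • stdVol q) ht

/-- The quotient of the Riemannian density by the leafwise volume form. -/
def densityRatio (g : Metric p q M) (χ : FormField p q M (0 + p))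
    (c : OpenPartialHomeomorph M (Model p q)) (z : Model p q) : ℝ :=
  volDensity g c z / coef g c 0 p χ z 0 fun i => stdE i

theorem volDensity_sq (hF : IsFoliatedAtlas p q M) (hc : c ∈ atlas (Model p q) M)
    (hz : z ∈ c.target) : volDensity g c z ^ 2 =
      (leafGram (chartMetric g c z)).det * (normalGram (chartMetric g c z)).det := by
  have hb := chartMetric_isScalarProduct hF g hc hz
  rw [volDensity, det_gram hb, Real.sq_sqrt]
  exact mul_nonneg (leafGram_posDef hb).det_pos.le (normalGram_posDef hb).det_pos.le

theorem volDensity_pos (hF : IsFoliatedAtlas p q M) (hc : c ∈ atlas (Model p q) M)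
    (hz : z ∈ c.target) : 0 < volDensity g c z := by
  have hb := chartMetric_isScalarProduct hF g hc hz
  rw [volDensity, det_gram hb]
  exact Real.sqrt_pos.mpr (mul_pos (leafGram_posDef hb).det_pos (normalGram_posDef hb).det_pos)

theorem contDiffOn_volDensity (hF : IsFoliatedAtlas p q M) (hc : c ∈ atlas (Model p q) M) :
    ContDiffOn ℝ ∞ (volDensity g c) c.target := by
  refine ContDiffOn.sqrt ?_ fun z hz => ?_
  · exact contDiffOn_det (A := fun y => Matrix.of fun s t : Fin p ⊕ Fin q =>
      chartMetric g c y (stdVec p q s) (stdVec p q t)) fun i j =>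
      contDiffOn_apply_bilin (contDiffOn_chartMetric g hc) contDiffOn_const contDiffOn_const
  · have hb := chartMetric_isScalarProduct hF g hc hz
    rw [det_gram hb]
    exact (mul_pos (leafGram_posDef hb).det_pos (normalGram_posDef hb).det_pos).ne'

theorem IsLeafVolume.coef_sq (hF : IsFoliatedAtlas p q M)
    {χ : FormField p q M (0 + p)} (hχ : IsLeafVolume g χ) (hc : c ∈ atlas (Model p q) M)
    (hz : z ∈ c.target) :
    (coef g c 0 p χ z 0 fun i => stdE i) ^ 2 = (leafGram (chartMetric g c z)).det :=
  vol_sq_eq_det (leafGram_posDef (chartMetric_isScalarProduct hF g hc hz))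
    (hχ.formInner_coef hF hc hz)

theorem IsLeafVolume.coef_ne_zero (hF : IsFoliatedAtlas p q M)
    {χ : FormField p q M (0 + p)} (hχ : IsLeafVolume g χ) (hc : c ∈ atlas (Model p q) M)
    (hz : z ∈ c.target) : (coef g c 0 p χ z 0 fun i => stdE i) ≠ 0 := fun h => by
  have h1 := hχ.coef_sq hF hc hz
  have h2 := (leafGram_posDef (chartMetric_isScalarProduct hF g hc hz)).det_pos
  rw [h] at h1
  simp [← h1] at h2

theorem contDiffOn_densityRatio (hF : IsFoliatedAtlas p q M)
    {χ : FormField p q M (0 + p)} (hχ : IsLeafVolume g χ) (hc : c ∈ atlas (Model p q) M) :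
    ContDiffOn ℝ ∞ (densityRatio g χ c) c.target :=
  (contDiffOn_volDensity hF hc).div (hχ.1.isSmoothBi_coef hF hc _ _)
    fun _ hz => hχ.coef_ne_zero hF hc hz

/-- In the square of the ratio the leafwise determinant cancels, and the normal determinant is left,
which is constant along the plaques. -/
theorem eventually_densityRatio (hF : IsFoliatedAtlas p q M) (hg : IsBundleLike g)
    {χ : FormField p q M (0 + p)} (hχ : IsLeafVolume g χ) (hc : c ∈ atlas (Model p q) M)
    (hz : z ∈ c.target) (X : Fin p → ℝ) :
    ∀ᶠ t in 𝓝 (0 : ℝ), densityRatio g χ c (z + t • ((X, 0) : Model p q)) =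
      densityRatio g χ c z := by
  have hsq : ∀ y ∈ c.target, densityRatio g χ c y ^ 2 =
      (normalGram (chartMetric g c y)).det := fun y hy => by
    have h1 := (leafGram_posDef (chartMetric_isScalarProduct hF g hc hy)).det_pos.ne'
    rw [densityRatio, div_pow, volDensity_sq hF hc hy, hχ.coef_sq hF hc hy]
    field_simp
  have hmem : ∀ᶠ t in 𝓝 (0 : ℝ), z + t • ((X, 0) : Model p q) ∈ c.target :=
    tendsto_line z _ (c.open_target.mem_nhds hz)
  refine eventually_line_eq_of_sq ((contDiffOn_densityRatio hF hχ hc).continuousOn.continuousAt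
    (c.open_target.mem_nhds hz))
    (div_ne_zero (volDensity_pos hF hc hz).ne' (hχ.coef_ne_zero hF hc hz)) ?_
  filter_upwards [hmem, hg.eventually_normalGram hF hc hz X] with t ht ht'
  rw [hsq _ ht, hsq _ hz, ht']

end LeafConstant

/-! ### The twisted differential and the star operators -/

section Pairing

variable {p q u v v' : ℕ}

theorem wedgePairing_add_left (h : v + v' = p) (α α' : (Fin p → ℝ) [⋀^Fin v]→ₗ[ℝ] ℝ)
    (γ : (Fin p → ℝ) [⋀^Fin v']→ₗ[ℝ] ℝ) :
    wedgePairing h (α + α') γ = wedgePairing h α γ + wedgePairing h α' γ := by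
  rw [wedgePairing, map_add, formInner_add_left]; rfl

theorem wedgePairing_smul_left (h : v + v' = p) (r : ℝ) (α : (Fin p → ℝ) [⋀^Fin v]→ₗ[ℝ] ℝ)
    (γ : (Fin p → ℝ) [⋀^Fin v']→ₗ[ℝ] ℝ) :
    wedgePairing h (r • α) γ = r * wedgePairing h α γ := by
  rw [wedgePairing, map_smul, formInner_smul_left]; rfl

/-- The pairing of `Λ^u N^* ⊗ Λ^v T^*` with `Λ^u N^* ⊗ Λ^{p-v} T^*` given by the exterior product
of leafwise forms and the scalar product `N` on `Λ^u N^*`. -/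
def biPairing (h : v + v' = p) (N : Matrix (Fin q) (Fin q) ℝ) :
    BiAlt p q u v →ₗ[ℝ] BiAlt p q u v' →ₗ[ℝ] ℝ :=
  LinearMap.mk₂ ℝ (fun a b => (u.factorial : ℝ)⁻¹ * ∑ c : Fin u → Fin q, ∑ c' : Fin u → Fin q,
      (∏ m, N (c m) (c' m)) *
        wedgePairing h (a fun m => stdE (c m)) (b fun m => stdE (c' m)))
    (fun a a' b => by
      simp only [AlternatingMap.add_apply, wedgePairing_add_left, mul_add,
        Finset.sum_add_distrib])
    (fun r a b => by
      simp only [AlternatingMap.smul_apply, wedgePairing_smul_left, smul_eq_mul, Finset.mul_sum]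
      exact Finset.sum_congr rfl fun i _ => Finset.sum_congr rfl fun j _ => by ring)
    (fun a b b' => by
      simp only [AlternatingMap.add_apply, wedgePairing, formInner_add_right, mul_add,
        Finset.sum_add_distrib])
    (fun r a b => by
      simp only [AlternatingMap.smul_apply, wedgePairing, formInner_smul_right, smul_eq_mul,
        Finset.mul_sum]
      exact Finset.sum_congr rfl fun i _ => Finset.sum_congr rfl fun j _ => by ring)

theorem biPairing_apply (h : v + v' = p) (N : Matrix (Fin q) (Fin q) ℝ) (a : BiAlt p q u v)
    (b : BiAlt p q u v') : biPairing h N a b =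
      (u.factorial : ℝ)⁻¹ * ∑ c : Fin u → Fin q, ∑ c' : Fin u → Fin q,
      (∏ m, N (c m) (c' m)) *
        wedgePairing h (a fun m => stdE (c m)) (b fun m => stdE (c' m)) := rfl

theorem vol_mul_biForm (h : v + v' = p) (N : Matrix (Fin q) (Fin q) ℝ)
    {H : Matrix (Fin p) (Fin p) ℝ} (hH : H.transpose = H)
    (vol : (Fin p → ℝ) [⋀^Fin p]→ₗ[ℝ] ℝ) (a b : BiAlt p q u v) :
    vol (fun i => stdE i) * biForm N H a b =
      biPairing h N a ((hodgeStar h H vol).compAlternatingMap b) := by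
  rw [biPairing_apply, biForm, mul_left_comm, Finset.mul_sum]
  congr 1
  refine Finset.sum_congr rfl fun c _ => ?_
  rw [Finset.mul_sum]
  refine Finset.sum_congr rfl fun c' _ => ?_
  rw [mul_left_comm, vol_mul_formInner h hH]
  rfl

/-- The version of `vol_mul_biForm` for a second argument that is itself a star: the double star
costs a sign independent of the point and of u. -/
theorem exists_vol_mul_biForm_hodgeStar (h : v + v' = p) (h' : v' + v = p) :
    ∃ c : ℝ, c * c = 1 ∧
    ∀ {q u : ℕ} (N : Matrix (Fin q) (Fin q) ℝ) {H : Matrix (Fin p) (Fin p) ℝ} (_ : H.PosDef)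
      {vol : (Fin p → ℝ) [⋀^Fin p]→ₗ[ℝ] ℝ} (_ : formInner H vol vol = 1)
      (a : BiAlt p q u v) (b : BiAlt p q u v'),
      vol (fun i => stdE i) * biForm N H a ((hodgeStar h' H vol).compAlternatingMap b) =
        c * biPairing h N a b := by
  obtain ⟨c, hc, hcs⟩ := exists_hodgeStar_hodgeStar (n := p) h' h
  refine ⟨c, hc, fun {q u} N {H} hH {vol} hvol a b => ?_⟩
  have hT : H.transpose = H := by
    have := hH.isHermitian
    rwa [Matrix.IsHermitian, Matrix.conjTranspose_eq_transpose_of_trivial] at this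
  rw [vol_mul_biForm h N hT vol, ← smul_eq_mul, ← map_smul]
  congr 1
  ext1 y
  exact hcs hH hvol (b y)

/-- Both sides carry the same factor (-1)^u, so the sign is the purely leafwise one and does not
depend on u. -/
theorem exists_biPairing_biWedge (h : v + 1 + v' = p) (h' : v + (v' + 1) = p) :
    ∃ c : ℝ, c * c = 1 ∧ ∀ {q u : ℕ} (N : Matrix (Fin q) (Fin q) ℝ) (ξ : (Fin p → ℝ) →ₗ[ℝ] ℝ)
      (a : BiAlt p q u v) (b : BiAlt p q u v'),
      biPairing h N (biWedge ξ a) b = c * biPairing h' N a (biWedge ξ b) := by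
  obtain ⟨c, hc, hcs⟩ := exists_wedgePairing_altWedge h h'
  refine ⟨c, hc, fun {q u} N ξ a b => ?_⟩
  simp only [biPairing_apply, Finset.mul_sum]
  refine Finset.sum_congr rfl fun y _ => Finset.sum_congr rfl fun y' _ => ?_
  have e1 : biWedge ξ a (fun m => stdE (y m)) =
    (-1 : ℝ) ^ u • altWedge ξ (a fun m => stdE (y m)) := rfl
  have e2 : biWedge ξ b (fun m => stdE (y' m)) =
    (-1 : ℝ) ^ u • altWedge ξ (b fun m => stdE (y' m)) := rfl
  rw [e1, e2, wedgePairing_smul_left, hcs, wedgePairing, wedgePairing, formInner_smul_right]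
  ring

theorem exists_eq_sum_smul_of_injective {W ι : Type*} [AddCommGroup W] [Module ℝ W] [Fintype ι]
    (ev : W →ₗ[ℝ] (ι → ℝ)) (hev : Function.Injective ev) :
    ∃ e : ι → W, ∀ w, w = ∑ i, ev w i • e i := by
  classical
  obtain ⟨l, hl⟩ := LinearMap.exists_leftInverse_of_injective ev (LinearMap.ker_eq_bot.mpr hev)
  refine ⟨fun i => l (Pi.single i 1), fun w => ?_⟩
  have h : l (ev w) = w := congrArg (fun f : W →ₗ[ℝ] W => f w) hl
  conv_lhs => rw [← h, ← Finset.univ_sum_single (ev w), map_sum]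
  refine Finset.sum_congr rfl fun i _ => ?_
  have : Pi.single i (ev w i) = ev w i • (Pi.single i 1 : ι → ℝ) := by
    rw [← Pi.single_smul]; simp
  rw [this, map_smul]

set_option maxSynthPendingDepth 3 in
/-- Expansion of bigraded alternating maps in their values on the standard basis. -/
theorem exists_biAlt_eq_sum (p q u v : ℕ) :
    ∃ e : (Fin u → Fin q) × (Fin v → Fin p) → BiAlt p q u v, ∀ a : BiAlt p q u v,
      a = ∑ I, a (fun m => stdE (I.1 m)) (fun m => stdE (I.2 m)) • e I := by
  let ev : BiAlt p q u v →ₗ[ℝ] ((Fin u → Fin q) × (Fin v → Fin p) → ℝ) :=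
    LinearMap.pi fun I => (altEval fun m => stdE (I.2 m)).comp
      (altEval (V := Fin q → ℝ) fun m => stdE (I.1 m))
  have hev : Function.Injective ev := (injective_iff_map_eq_zero ev).mpr fun a ha =>
    biAlt_eq_zero_of_stdE fun c i => congrFun ha (c, i)
  exact exists_eq_sum_smul_of_injective ev hev

/-- Differentiability of a family is meant value by value. A linear functional depends on finitely
many values, so it can be differentiated under the family. -/
theorem hasDerivAt_biAlt_apply {a : ℝ → BiAlt p q u v} {a' : BiAlt p q u v} {t : ℝ}
    (ha : ∀ y x, HasDerivAt (fun s => a s y x) (a' y x) t) (l : BiAlt p q u v →ₗ[ℝ] ℝ) :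
    HasDerivAt (fun s => l (a s)) (l a') t := by
  obtain ⟨e, he⟩ := exists_biAlt_eq_sum p q u v
  have hl : ∀ a, l a = ∑ I, a (fun m => stdE (I.1 m)) (fun m => stdE (I.2 m)) * l (e I) := by
    intro a
    conv_lhs => rw [he a, map_sum]
    exact Finset.sum_congr rfl fun I _ => map_smul _ _ _
  rw [hl a', funext fun s => hl (a s)]
  exact HasDerivAt.fun_sum fun I _ => (ha _ _).mul_const _

theorem hasDerivAt_biAlt_apply₂ {a : ℝ → BiAlt p q u v} {a' : BiAlt p q u v}
    {b : ℝ → BiAlt p q u v'} {b' : BiAlt p q u v'} {t : ℝ}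
    (ha : ∀ y x, HasDerivAt (fun s => a s y x) (a' y x) t)
    (hb : ∀ y x, HasDerivAt (fun s => b s y x) (b' y x) t)
    (Q : BiAlt p q u v →ₗ[ℝ] BiAlt p q u v' →ₗ[ℝ] ℝ) :
    HasDerivAt (fun s => Q (a s) (b s)) (Q a' (b t) + Q (a t) b') t := by
  obtain ⟨e, he⟩ := exists_biAlt_eq_sum p q u v
  have hQ : ∀ a b, Q a b =
      ∑ I, a (fun m => stdE (I.1 m)) (fun m => stdE (I.2 m)) * Q (e I) b := by
    intro a b
    conv_lhs => rw [he a, map_sum, LinearMap.sum_apply]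
    exact Finset.sum_congr rfl fun I _ => by rw [map_smul]; rfl
  rw [hQ a', hQ (a t), ← Finset.sum_add_distrib]
  simp only [hQ (a _)]
  exact HasDerivAt.fun_sum fun I _ => (ha _ _).mul (hasDerivAt_biAlt_apply hb (Q (e I)))

theorem contDiffOn_wedgePairing {E : Type*} [NormedAddCommGroup E] [NormedSpace ℝ E] {s : Set E}
    (h : v + v' = p) {α : E → (Fin p → ℝ) [⋀^Fin v]→ₗ[ℝ] ℝ}
    {γ : E → (Fin p → ℝ) [⋀^Fin v']→ₗ[ℝ] ℝ} (hα : ∀ x, ContDiffOn ℝ ∞ (fun z => α z x) s)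
    (hγ : ∀ x, ContDiffOn ℝ ∞ (fun z => γ z x) s) :
    ContDiffOn ℝ ∞ (fun z => wedgePairing h (α z) (γ z)) s := by
  unfold wedgePairing formInner
  refine contDiffOn_const.mul (ContDiffOn.sum fun i _ => ContDiffOn.sum fun j _ => ?_)
  exact (contDiffOn_const.mul (contDiffOn_hodgeStar h (H := fun _ => 1) (vol := fun _ => stdVol p)
    (fun _ _ => contDiffOn_const) (fun _ => contDiffOn_const) hα _)).mul (hγ _)

theorem contDiffOn_biPairing {E : Type*} [NormedAddCommGroup E] [NormedSpace ℝ E] {s : Set E}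
    (h : v + v' = p) {N : E → Matrix (Fin q) (Fin q) ℝ}
    (hN : ∀ i j, ContDiffOn ℝ ∞ (fun z => N z i j) s) {a : E → BiAlt p q u v}
    {b : E → BiAlt p q u v'} (ha : IsSmoothBi a s) (hb : IsSmoothBi b s) :
    ContDiffOn ℝ ∞ (fun z => biPairing h (N z) (a z) (b z)) s := by
  simp only [biPairing_apply]
  refine contDiffOn_const.mul (ContDiffOn.sum fun c _ => ContDiffOn.sum fun c' _ => ?_)
  exact (contDiffOn_prod fun m _ => hN _ _).mul
    (contDiffOn_wedgePairing h (fun x => ha _ x) (fun x => hb _ x))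

theorem IsSmoothBi.biWedge {E : Type*} [NormedAddCommGroup E] [NormedSpace ℝ E] {s : Set E}
    {a : E → BiAlt p q u v} (ha : IsSmoothBi a s) (ξ : (Fin p → ℝ) →ₗ[ℝ] ℝ) :
    IsSmoothBi (fun z => biWedge ξ (a z)) s := by
  intro y x
  simp only [biWedge_apply, altWedge_apply]
  exact contDiffOn_const.mul (ContDiffOn.sum fun i _ => contDiffOn_const.mul
    (contDiffOn_const.mul (ha _ _)))

/-- The star acts on the normal factor and commutes with the linear map ξ ∧ on values. The remaining
signs are (-1)^u and (-1)^{u'} with u + u' = q. -/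
theorem biWedge_hodgeStar {u' : ℕ} (hu : u + u' = q) (N : Matrix (Fin q) (Fin q) ℝ)
    (vol : (Fin q → ℝ) [⋀^Fin q]→ₗ[ℝ] ℝ) (ξ : (Fin p → ℝ) →ₗ[ℝ] ℝ) (a : BiAlt p q u v) :
    hodgeStar hu N vol (biWedge ξ a) = (-1 : ℝ) ^ q • biWedge ξ (hodgeStar hu N vol a) := by
  refine biAlt_ext fun y x => ?_
  have h1 : hodgeStar hu N vol (biWedge ξ a) y x =
      (-1 : ℝ) ^ u * hodgeStar hu N vol ((altEval x).compAlternatingMap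
        ((altWedgeLM ξ).compAlternatingMap a)) y := by
    rw [biWedge, map_smul, AlternatingMap.smul_apply, AlternatingMap.smul_apply, smul_eq_mul,
      ← map_hodgeStar]
    rfl
  have h2 : biWedge ξ (hodgeStar hu N vol a) y x =
      (-1 : ℝ) ^ u' * hodgeStar hu N vol ((altEval x).compAlternatingMap
        ((altWedgeLM ξ).compAlternatingMap a)) y := by
    rw [biWedge_apply]
    congr 1
    exact map_hodgeStar hu N vol a ((altEval x).comp (altWedgeLM ξ)) y
  have hsign : (-1 : ℝ) ^ q * (-1) ^ u' = (-1) ^ u := by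
    rw [← hu, pow_add, mul_assoc, ← pow_add, Even.neg_one_pow ⟨u', rfl⟩, mul_one]
  rw [h1, AlternatingMap.smul_apply, AlternatingMap.smul_apply, h2, smul_eq_mul, ← mul_assoc,
    hsign]

end Pairing

/-! ### Leafwise derivatives and the stars; the divergence identity -/

section Commutation

variable {p q : ℕ} {M : Type*} [TopologicalSpace M] [ChartedSpace (Model p q) M]
  [IsManifold 𝓘(ℝ, Model p q) ∞ M] {g : Metric p q M} {u v : ℕ}
  {c : OpenPartialHomeomorph M (Model p q)} {z : Model p q}

theorem IsBiform.neg {φ : FormField p q M (u + v)} (hφ : IsBiform g u v φ) :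
    IsBiform g u v (-φ) := by
  have e : -φ = (-1 : ℝ) • φ := (neg_one_smul ℝ φ).symm
  rw [e]
  exact hφ.smul _

theorem IsBiform.hasDerivAt_coef (hF : IsFoliatedAtlas p q M) {φ : FormField p q M (u + v)}
    (hφ : IsBiform g u v φ) (hc : c ∈ atlas (Model p q) M) (hz : z ∈ c.target) (m : Fin p)
    (y : Fin u → Fin q → ℝ) (x : Fin v → Fin p → ℝ) :
    HasDerivAt (fun t : ℝ => coef g c u v φ (z + t • ((stdE m, 0) : Model p q)) y x)
      (coefPartial c u v φ z m y x) 0 := by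
  rw [← hφ.fderiv_coef hF hc hz]
  exact hasDerivAt_line (f := fun z => coef g c u v φ z y x)
    (((hφ.isSmoothBi_coef hF hc y x).contDiffAt (c.open_target.mem_nhds hz)).differentiableAt
      (by simp))

/-- Along the line through z in a leaf direction the normal Gram matrix and the coefficient of ν are
locally constant. The transverse star is there one fixed linear operator, which commutes with the
derivative. -/
theorem coefPartial_perpStar (hF : IsFoliatedAtlas p q M) (hg : IsBundleLike g)
    {ν : FormField p q M (q + 0)} (hν : IsTransverseVolume g ν) {u' : ℕ} (hu : u + u' = q)
    {φ : FormField p q M (u + v)} (hφ : IsBiform g u v φ) (hc : c ∈ atlas (Model p q) M)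
    (hz : z ∈ c.target) (m : Fin p) :
    coefPartial c u' v (perpStar g ν hu v φ) z m =
      hodgeStar hu (normalGram (chartMetric g c z))⁻¹ (leafEval (coef g c q 0 ν z) 0)
        (coefPartial c u v φ z m) := by
  refine biAlt_ext fun y x => ?_
  let l : BiAlt p q u v →ₗ[ℝ] ℝ := (altEval x).comp ((altEval (V := Fin q → ℝ) y).comp
    (hodgeStar hu (normalGram (chartMetric g c z))⁻¹ (leafEval (coef g c q 0 ν z) 0)))
  have h1 := hasDerivAt_biAlt_apply (hφ.hasDerivAt_coef hF hc hz m) l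
  refine ((isBiform_perpStar hF hν.1 hu hφ).hasDerivAt_coef hF hc hz m y x).unique
    (h1.congr_of_eventuallyEq ?_)
  have hmem : ∀ᶠ t in 𝓝 (0 : ℝ), z + t • ((stdE m, 0) : Model p q) ∈ c.target :=
    tendsto_line z _ (c.open_target.mem_nhds hz)
  filter_upwards [hmem, hg.eventually_normalGram hF hc hz (stdE m),
    hν.eventually_coef hF hg hc hz (stdE m)] with t ht hN hv
  rw [coef_perpStar hF hc ht, hN, hv]
  rfl

theorem perpStar_twistedD (hF : IsFoliatedAtlas p q M) (hg : IsBundleLike g)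
    {ν : FormField p q M (q + 0)} (hν : IsTransverseVolume g ν) {η : FormField p q M (0 + 1)}
    (hη : IsBiform g 0 1 η) {u' : ℕ} (hu : u + u' = q)
    {φ : FormField p q M (u + v)} (hφ : IsBiform g u v φ) :
    perpStar g ν hu (v + 1) (twistedD g η u v φ) =
      (-1 : ℝ) ^ q • twistedD g η u' v (perpStar g ν hu v φ) := by
  have hS := isBiform_perpStar hF hν.1 hu hφ
  refine IsBiSection.eq_of_coef hF (fun x => ⟨_, rfl⟩)
    ((isBiSection_twistedD hη.isBiSection hS.isBiSection).smul _) fun c hc z hz => ?_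
  rw [coef_perpStar hF hc hz, coef_smul, coef_twistedD hF hη.isBiSection hφ hc hz,
    coef_twistedD hF hη.isBiSection hS hc hz, map_sum, Finset.smul_sum]
  refine Finset.sum_congr rfl fun m _ => ?_
  rw [biWedge_hodgeStar, coefPartial_perpStar hF hg hν hu hφ hc hz, coef_perpStar hF hc hz,
    map_add, map_smul]

/-- The flux whose leafwise divergence is the defect of formal adjointness. -/
def leafFlux (g : Metric p q M) (χ : FormField p q M (0 + p))
    (c : OpenPartialHomeomorph M (Model p q)) {u v v' : ℕ} (h : v + 1 + v' = p)
    (φ : FormField p q M (u + v)) (γ : FormField p q M (u + v')) (m : Fin p)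
    (z : Model p q) : ℝ :=
  densityRatio g χ c z * biPairing h (normalGram (chartMetric g c z))⁻¹
    (biWedge (LinearMap.proj m) (coef g c u v φ z)) (coef g c u v' γ z)

theorem contDiffOn_leafFlux (hF : IsFoliatedAtlas p q M) {χ : FormField p q M (0 + p)}
    (hχ : IsLeafVolume g χ) (hc : c ∈ atlas (Model p q) M) {v' : ℕ} (h : v + 1 + v' = p)
    {φ : FormField p q M (u + v)} (hφ : IsBiform g u v φ) {γ : FormField p q M (u + v')}
    (hγ : IsBiform g u v' γ) (m : Fin p) :
    ContDiffOn ℝ ∞ (leafFlux g χ c h φ γ m) c.target :=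
  (contDiffOn_densityRatio hF hχ hc).mul (contDiffOn_biPairing h
    (contDiffOn_normalGram_inv (contDiffOn_chartMetric g hc)
      fun _ hz => chartMetric_isScalarProduct hF g hc hz)
    ((hφ.isSmoothBi_coef hF hc).biWedge _) (hγ.isSmoothBi_coef hF hc))

/-- The density ratio and the normal metric are constant in the leaf directions, so the Leibniz rule
differentiates only the two forms. -/
theorem fderiv_leafFlux (hF : IsFoliatedAtlas p q M) (hg : IsBundleLike g)
    {χ : FormField p q M (0 + p)}
    (hχ : IsLeafVolume g χ) (hc : c ∈ atlas (Model p q) M) (hz : z ∈ c.target) {v' : ℕ}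
    (h : v + 1 + v' = p)
    {φ : FormField p q M (u + v)} (hφ : IsBiform g u v φ) {γ : FormField p q M (u + v')}
    (hγ : IsBiform g u v' γ) (m : Fin p) :
    fderiv ℝ (leafFlux g χ c h φ γ m) z (stdE m, 0) =
      densityRatio g χ c z * (biPairing h (normalGram (chartMetric g c z))⁻¹
          (biWedge (LinearMap.proj m) (coefPartial c u v φ z m)) (coef g c u v' γ z) +
        biPairing h (normalGram (chartMetric g c z))⁻¹
          (biWedge (LinearMap.proj m) (coef g c u v φ z)) (coefPartial c u v' γ z m)) := by
  have hnhds := c.open_target.mem_nhds hz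
  refine fderiv_eq_of_line (((contDiffOn_leafFlux hF hχ hc h hφ hγ m).contDiffAt
    hnhds).differentiableAt (by simp)) ?_
  have hw : ∀ y x, HasDerivAt (fun t : ℝ => biWedge (LinearMap.proj m)
      (coef g c u v φ (z + t • ((stdE m, 0) : Model p q))) y x)
      (biWedge (LinearMap.proj m) (coefPartial c u v φ z m) y x) 0 := by
    intro y x
    simp only [biWedge_apply, altWedge_apply]
    exact (HasDerivAt.fun_sum fun i _ =>
      ((hφ.hasDerivAt_coef hF hc hz m _ _).const_mul _).const_mul _).const_mul _
  have h1 := (hasDerivAt_biAlt_apply₂ hw (hγ.hasDerivAt_coef hF hc hz m)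
    (biPairing h (normalGram (chartMetric g c z))⁻¹)).const_mul (densityRatio g χ c z)
  simp only [zero_smul, add_zero] at h1
  refine h1.congr_of_eventuallyEq ?_
  filter_upwards [hg.eventually_normalGram hF hc hz (stdE m),
    eventually_densityRatio hF hg hχ hc hz (stdE m)] with t hN hd
  rw [leafFlux, hN, hd]

/-- Density times scalar product is the density ratio times the exterior pairing with ⋆ψ. By the
Leibniz rule the derivative terms on both sides add up to the divergence, while the terms η_m and
-η_m cancel. -/
theorem exists_sum_fderiv_leafFlux (hF : IsFoliatedAtlas p q M) (hg : IsBundleLike g)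
    {χ : FormField p q M (0 + p)} (hχ : IsLeafVolume g χ) {η : FormField p q M (0 + 1)}
    (hη : IsBiform g 0 1 η) {v' : ℕ} (h : v + 1 + v' = p) (h' : v' + 1 + v = p) :
    ∃ ε : ℝ, ε * ε = 1 ∧ ∀ {u : ℕ} {φ : FormField p q M (u + v)} (_ : IsBiform g u v φ)
      {ψ : FormField p q M (u + (v + 1))} (_ : IsBiform g u (v + 1) ψ)
      {c : OpenPartialHomeomorph M (Model p q)} (_ : c ∈ atlas (Model p q) M) {z : Model p q}
      (_ : z ∈ c.target),
      (biInner (chartMetric g c z) (coef g c u (v + 1) (twistedD g η u v φ) z)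
          (coef g c u (v + 1) ψ z) -
        biInner (chartMetric g c z) (coef g c u v φ z) (coef g c u v
          (ε • leafStar g χ u h' (twistedD g (-η) u v' (leafStar g χ u h ψ))) z)) *
        volDensity g c z =
      ∑ m, fderiv ℝ (leafFlux g χ c h φ (leafStar g χ u h ψ) m) z (stdE m, 0) := by
  have h'' : v + (v' + 1) = p := by omega
  obtain ⟨c₁, hc₁, hs₁⟩ := exists_vol_mul_biForm_hodgeStar h'' h'
  obtain ⟨c₂, hc₂, hs₂⟩ := exists_biPairing_biWedge h h''
  -- Here c₁ comes from the double leafwise star, c₂ from carrying dx_m over the first form, and the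
  -- minus sign from integration by parts.
  refine ⟨-(c₁ * c₂), by linear_combination (c₂ * c₂) * hc₁ + hc₂,
    fun {u φ} hφ {ψ} hψ {c} hc {z} hz => ?_⟩
  have hb := chartMetric_isScalarProduct hF g hc hz
  have hγ := isBiform_leafStar hF hχ.1 h hψ
  have hη' : IsBiform g 0 1 (-η) := hη.neg
  set γ := leafStar g χ u h ψ with hγdef
  set s := coef g c 0 p χ z 0 (fun i => stdE i) with hs
  have hs0 : s ≠ 0 := hχ.coef_ne_zero hF hc hz
  have hdens : volDensity g c z = densityRatio g χ c z * s := by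
    rw [densityRatio, div_mul_cancel₀ _ hs0]
  have hH := (leafGram_posDef hb).inv
  have hT : (leafGram (chartMetric g c z))⁻¹.transpose = (leafGram (chartMetric g c z))⁻¹ := by
    have := hH.isHermitian
    rwa [Matrix.IsHermitian, Matrix.conjTranspose_eq_transpose_of_trivial] at this
  have e1 : s * biInner (chartMetric g c z) (coef g c u (v + 1) (twistedD g η u v φ) z)
      (coef g c u (v + 1) ψ z) = biPairing h (normalGram (chartMetric g c z))⁻¹
        (coef g c u (v + 1) (twistedD g η u v φ) z) (coef g c u v' γ z) := by
    rw [biInner_eq_biForm, hs, vol_mul_biForm h _ hT, hγdef, coef_leafStar hF hc hz]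
  have e2 : s * biInner (chartMetric g c z) (coef g c u v φ z) (coef g c u v
      (-(c₁ * c₂) • leafStar g χ u h' (twistedD g (-η) u v' γ)) z) =
      -(c₂ * biPairing h'' (normalGram (chartMetric g c z))⁻¹ (coef g c u v φ z)
        (coef g c u (v' + 1) (twistedD g (-η) u v' γ) z)) := by
    rw [biInner_eq_biForm, coef_smul, biForm_smul_right, coef_leafStar hF hc hz, mul_left_comm, hs,
      hs₁ _ hH (hχ.formInner_coef hF hc hz)]
    linear_combination (-c₂ * biPairing h'' (normalGram (chartMetric g c z))⁻¹
      (coef g c u v φ z) (coef g c u (v' + 1) (twistedD g (-η) u v' γ) z)) * hc₁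
  have hcomp : ∀ m, leafComp g c (-η) z m = -leafComp g c η z m := fun m => rfl
  rw [hdens, mul_comm, mul_assoc, mul_sub, e1, e2, coef_twistedD hF hη.isBiSection hφ hc hz,
    coef_twistedD hF hη'.isBiSection hγ hc hz]
  simp only [fderiv_leafFlux hF hg hχ hc hz h hφ hγ, ← Finset.mul_sum]
  congr 1
  rw [map_sum, LinearMap.sum_apply, map_sum, sub_neg_eq_add, Finset.mul_sum,
    ← Finset.sum_add_distrib]
  refine Finset.sum_congr rfl fun m _ => ?_
  rw [← hs₂, hcomp, biWedge_add_right, biWedge_smul_right, map_add, map_smul, map_add, map_smul]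
  simp only [LinearMap.add_apply, LinearMap.smul_apply, smul_eq_mul]
  ring

end Commutation

/-! ### Integration -/

section Integration

open MeasureTheory

variable {p q : ℕ} {M : Type*} [TopologicalSpace M] [ChartedSpace (Model p q) M]
  [IsManifold 𝓘(ℝ, Model p q) ∞ M] {g : Metric p q M}
  {c c' : OpenPartialHomeomorph M (Model p q)} {z : Model p q}

theorem det_gram_comp (b : Bilin p q) (D : Model p q →L[ℝ] Model p q) :
    (Matrix.of fun s t : Fin p ⊕ Fin q =>
      b.bilinearComp D D (stdVec p q s) (stdVec p q t)).det =
    D.det ^ 2 * (Matrix.of fun s t : Fin p ⊕ Fin q => b (stdVec p q s) (stdVec p q t)).det := by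
  let β := (Pi.basisFun ℝ (Fin p)).prod (Pi.basisFun ℝ (Fin q))
  have hβ : ∀ s, β s = stdVec p q s := by
    rintro (i | a) <;> simp [β, stdVec]
  set T := LinearMap.toMatrix β β (D : Model p q →ₗ[ℝ] Model p q) with hT
  have hD : ∀ s, D (stdVec p q s) = ∑ i, T i s • stdVec p q i := by
    intro s
    have := β.sum_repr (D (stdVec p q s))
    rw [← this]
    refine Finset.sum_congr rfl fun i _ => ?_
    rw [hT, LinearMap.toMatrix_apply, hβ, hβ]
    rfl
  have hmat : (Matrix.of fun s t : Fin p ⊕ Fin q =>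
      b.bilinearComp D D (stdVec p q s) (stdVec p q t)) = T.transpose *
        (Matrix.of fun s t : Fin p ⊕ Fin q => b (stdVec p q s) (stdVec p q t)) * T := by
    ext s t
    rw [Matrix.mul_assoc]
    simp only [Matrix.of_apply, ContinuousLinearMap.bilinearComp_apply, hD, map_sum, map_smul,
      FunLike.coe_sum, Finset.sum_apply, smul_apply,
      smul_eq_mul, Matrix.mul_apply, Matrix.transpose_apply, Finset.mul_sum]
    rw [Finset.sum_comm]
    exact Finset.sum_congr rfl fun i _ => Finset.sum_congr rfl fun j _ => by ring
  have hdet : D.det = T.det := (LinearMap.det_toMatrix β _).symm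
  rw [hmat, Matrix.det_mul, Matrix.det_mul, Matrix.det_transpose, hdet]
  ring

theorem volDensity_comp (hc : c ∈ atlas (Model p q) M) (hc' : c' ∈ atlas (Model p q) M)
    (hz : z ∈ (c.symm.trans c').source) : volDensity g c z =
      |(fderiv ℝ (c' ∘ c.symm) z).det| * volDensity g c' (c' (c.symm z)) := by
  unfold volDensity
  rw [chartMetric_comp g hc hc' hz, det_gram_comp, Real.sqrt_mul (sq_nonneg _), Real.sqrt_sq_eq_abs]

instance isAddHaarMeasure_model : (volume : Measure (Model p q)).IsAddHaarMeasure :=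
  Measure.prod.instIsAddHaarMeasure (volume : Measure (Fin p → ℝ)) (volume : Measure (Fin q → ℝ))

/-- The integral, for the Riemannian volume, of a function supported in the domain of a chart. -/
def chartIntegral (g : Metric p q M) (c : OpenPartialHomeomorph M (Model p q)) (f : M → ℝ) : ℝ :=
  ∫ z in c.target, f (c.symm z) * volDensity g c z

theorem chartIntegral_eq_setIntegral (f : M → ℝ)
    (hf' : ∀ x, x ∉ c'.source → f x = 0) :
    chartIntegral g c f =
      ∫ z in (c.symm.trans c').source, f (c.symm z) * volDensity g c z := by
  refine setIntegral_eq_of_subset_of_forall_sdiff_eq_zero c.open_target.measurableSet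
    (fun z hz => hz.1) fun z hz => ?_
  have : c.symm z ∉ c'.source := fun h => hz.2 (mem_transition_source hz.1 h)
  rw [hf' _ this, zero_mul]

/-- Both integrals live on the overlap, since f vanishes off each domain. There the change of
variables applies, the density absorbing the Jacobian. -/
theorem chartIntegral_eq (hc : c ∈ atlas (Model p q) M) (hc' : c' ∈ atlas (Model p q) M)
    {f : M → ℝ} (hf : ∀ x, x ∉ c.source → f x = 0) (hf' : ∀ x, x ∉ c'.source → f x = 0) :
    chartIntegral g c f = chartIntegral g c' f := by
  rw [chartIntegral_eq_setIntegral f hf', chartIntegral_eq_setIntegral f hf]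
  have himage : (c' ∘ c.symm) '' (c.symm.trans c').source = (c'.symm.trans c).source := by
    have := (c.symm.trans c').image_source_eq_target
    have e : (c.symm.trans c').target = (c'.symm.trans c).source := by
      rw [← OpenPartialHomeomorph.symm_source, OpenPartialHomeomorph.trans_symm_eq_symm_trans_symm,
        OpenPartialHomeomorph.symm_symm]
    rw [← e, ← this]
    rfl
  rw [← himage, integral_image_eq_integral_abs_det_fderiv_smul volume
    (c.symm.trans c').open_source.measurableSet
    (fun z hz => ((contDiffAt_transition hc hc' hz).differentiableAt
      (by simp)).hasFDerivAt.hasFDerivWithinAt) (c.symm.trans c').injOn]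
  refine setIntegral_congr_fun (c.symm.trans c').open_source.measurableSet fun z hz => ?_
  have hx : c'.symm (c' (c.symm z)) = c.symm z := c'.left_inv hz.2
  simp only [Function.comp_apply, smul_eq_mul]
  rw [hx, volDensity_comp hc hc' hz]
  ring

theorem integrableOn_chart (hF : IsFoliatedAtlas p q M) (hc : c ∈ atlas (Model p q) M)
    {f : M → ℝ} (hf : Continuous f) {K : Set M} (hK : IsCompact K) (hKc : K ⊆ c.source)
    (hfK : ∀ x, x ∉ K → f x = 0) :
    IntegrableOn (fun z => f (c.symm z) * volDensity g c z) c.target := by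
  have hsub : c '' K ⊆ c.target := fun z ⟨x, hx, h⟩ => h ▸ c.map_source (hKc hx)
  have hcomp : IsCompact (c '' K) := hK.image_of_continuousOn (c.continuousOn.mono hKc)
  have hcont : ContinuousOn (fun z => f (c.symm z) * volDensity g c z) c.target :=
    (hf.comp_continuousOn c.continuousOn_symm).mul (contDiffOn_volDensity hF hc).continuousOn
  refine ((hcont.mono hsub).integrableOn_compact hcomp).of_forall_sdiff_eq_zero
    c.open_target.measurableSet fun z hz => ?_
  rw [hfK, zero_mul]
  intro h
  exact hz.2 ⟨_, h, c.right_inv hz.1⟩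

variable [T2Space M] [CompactSpace M]

theorem chartPartition_tsupport (i : M) :
    tsupport (chartPartition p q M i) ⊆ (chartAt (Model p q) i).source :=
  Classical.choose_spec
    (SmoothPartitionOfUnity.exists_isSubordinate_chartAt_source 𝓘(ℝ, Model p q) M) i

theorem chartPartition_eq_zero {i x : M} (hx : x ∉ tsupport (chartPartition p q M i)) :
    chartPartition p q M i x = 0 := image_eq_zero_of_notMem_tsupport hx

theorem continuous_chartPartition (i : M) : Continuous (chartPartition p q M i) :=
  (chartPartition p q M i).contMDiff.continuous

theorem isCompact_tsupport_chartPartition (i : M) :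
    IsCompact (tsupport (chartPartition p q M i)) := (isClosed_tsupport _).isCompact

variable (p q M) in
theorem finite_chartPartition :
    {i : M | (Function.support (chartPartition p q M i)).Nonempty}.Finite :=
  (chartPartition p q M).locallyFinite.finite_nonempty_of_compact

variable (p q M) in
/-- The indices of the members of the partition of unity that are not zero. -/
def chartIndices : Finset M := (finite_chartPartition p q M).toFinset

theorem chartPartition_of_notMem {i : M} (hi : i ∉ chartIndices p q M) (x : M) :
    chartPartition p q M i x = 0 := by
  by_contra h
  exact hi ((finite_chartPartition p q M).mem_toFinset.mpr ⟨x, h⟩)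

theorem sum_chartPartition (x : M) : ∑ i ∈ chartIndices p q M, chartPartition p q M i x = 1 := by
  rw [← (chartPartition p q M).sum_eq_one (Set.mem_univ x)]
  refine (finsum_eq_sum_of_support_subset _ fun i hi => ?_).symm
  by_contra h
  exact hi (chartPartition_of_notMem h x)

theorem integralVol_eq_sum (f : M → ℝ) : integralVol g f = ∑ i ∈ chartIndices p q M,
    chartIntegral g (chartAt (Model p q) i) fun x => chartPartition p q M i x * f x := by
  refine finsum_eq_sum_of_support_subset _ fun i hi => ?_
  by_contra h
  refine hi ?_
  simp [chartPartition_of_notMem h]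

theorem integrableOn_chartPartition (hF : IsFoliatedAtlas p q M) {f : M → ℝ} (hf : Continuous f)
    (i : M) : IntegrableOn (fun z => chartPartition p q M i ((chartAt (Model p q) i).symm z) *
      f ((chartAt (Model p q) i).symm z) * volDensity g (chartAt (Model p q) i) z)
      (chartAt (Model p q) i).target :=
  integrableOn_chart (f := fun x => chartPartition p q M i x * f x) hF (chart_mem_atlas _ i)
    ((continuous_chartPartition i).mul hf) (isCompact_tsupport_chartPartition i)
    (chartPartition_tsupport i) fun x hx => by rw [chartPartition_eq_zero hx, zero_mul]

theorem integralVol_add (hF : IsFoliatedAtlas p q M) {f f' : M → ℝ} (hf : Continuous f)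
    (hf' : Continuous f') :
    integralVol g (fun x => f x + f' x) = integralVol g f + integralVol g f' := by
  simp only [integralVol_eq_sum, ← Finset.sum_add_distrib]
  refine Finset.sum_congr rfl fun i _ => ?_
  unfold chartIntegral
  rw [← integral_add (integrableOn_chartPartition hF hf i) (integrableOn_chartPartition hF hf' i)]
  exact integral_congr_ae (Filter.Eventually.of_forall fun z => by ring)

theorem integralVol_const_mul (r : ℝ) (f : M → ℝ) :
    integralVol g (fun x => r * f x) = r * integralVol g f := by
  simp only [integralVol_eq_sum, Finset.mul_sum]
  refine Finset.sum_congr rfl fun i _ => ?_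
  unfold chartIntegral
  rw [← integral_const_mul]
  exact integral_congr_ae (Filter.Eventually.of_forall fun z => by ring)

/-- The partition of unity is inserted into the integral in the chart c. Each piece is supported in
the domain of c and of the preferred chart of its index, and the two charts give the same integral.
-/
theorem integralVol_eq_chartIntegral (hF : IsFoliatedAtlas p q M)
    (hc : c ∈ atlas (Model p q) M) {f : M → ℝ} (hf : Continuous f) {K : Set M}
    (hK : IsCompact K) (hKc : K ⊆ c.source) (hfK : ∀ x, x ∉ K → f x = 0) :
    integralVol g f = chartIntegral g c f := by
  have h1 : chartIntegral g c f = ∑ i ∈ chartIndices p q M,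
      chartIntegral g c fun x => chartPartition p q M i x * f x := by
    unfold chartIntegral
    rw [← integral_finsetSum]
    · refine integral_congr_ae (Filter.Eventually.of_forall fun z => ?_)
      simp only
      rw [← Finset.sum_mul, ← Finset.sum_mul, sum_chartPartition, one_mul]
    · intro i _
      exact integrableOn_chart (f := fun x => chartPartition p q M i x * f x) hF hc
        ((continuous_chartPartition i).mul hf) hK hKc fun x hx => by rw [hfK x hx, mul_zero]
  rw [h1, integralVol_eq_sum]
  refine Finset.sum_congr rfl fun i _ => chartIntegral_eq (chart_mem_atlas _ i) hc
    (fun x hx => ?_) fun x hx => ?_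
  · rw [chartPartition_eq_zero fun h => hx (chartPartition_tsupport i h), zero_mul]
  · rw [hfK x fun h => hx (hKc h), mul_zero]

/-- Some member of the partition is nonzero at x. Its integrand is continuous, nonnegative and
almost everywhere zero on an open set, hence zero, and the density is positive. -/
theorem eq_zero_of_integralVol_eq_zero (hF : IsFoliatedAtlas p q M) {f : M → ℝ}
    (hf : Continuous f) (h0 : ∀ x, 0 ≤ f x) (h : integralVol g f = 0) (x : M) : f x = 0 := by
  have hnn : ∀ (i : M) (z : Model p q),
      0 ≤ chartPartition p q M i ((chartAt (Model p q) i).symm z) *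
      f ((chartAt (Model p q) i).symm z) * volDensity g (chartAt (Model p q) i) z := fun i z =>
    mul_nonneg (mul_nonneg ((chartPartition p q M).nonneg i _) (h0 _)) (Real.sqrt_nonneg _)
  rw [integralVol_eq_sum, Finset.sum_eq_zero_iff_of_nonneg fun i _ =>
    integral_nonneg fun z => hnn i z] at h
  have hex : ∃ i ∈ chartIndices p q M, chartPartition p q M i x ≠ 0 := by
    by_contra hcon
    push Not at hcon
    have := sum_chartPartition (p := p) (q := q) x
    rw [Finset.sum_eq_zero hcon] at this
    exact zero_ne_one this
  obtain ⟨i, hi, hix⟩ := hex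
  have hxs : x ∈ (chartAt (Model p q) i).source := by
    by_contra hcon
    exact hix (chartPartition_eq_zero fun h => hcon (chartPartition_tsupport i h))
  have hci := chart_mem_atlas (Model p q) i
  have hae := (setIntegral_eq_zero_iff_of_nonneg_ae
    (Filter.Eventually.of_forall fun z => hnn i z) (integrableOn_chartPartition hF hf i)).mp (h i hi)
  have hcont : ContinuousOn (fun z => chartPartition p q M i ((chartAt (Model p q) i).symm z) *
      f ((chartAt (Model p q) i).symm z) * volDensity g (chartAt (Model p q) i) z)
      (chartAt (Model p q) i).target :=
    ((((continuous_chartPartition i).mul hf).comp_continuousOn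
      (chartAt (Model p q) i).continuousOn_symm).mul
        (contDiffOn_volDensity hF hci).continuousOn)
  have heq := MeasureTheory.Measure.eqOn_open_of_ae_eq hae (chartAt (Model p q) i).open_target
    hcont continuousOn_const
  have hz := (chartAt (Model p q) i).map_source hxs
  have := heq hz
  simp only [Pi.zero_apply, (chartAt (Model p q) i).left_inv hxs] at this
  rcases mul_eq_zero.mp this with h | h
  · exact (mul_eq_zero.mp h).resolve_left hix
  · exact absurd h (volDensity_pos hF hci hz).ne'

end Integration

/-! ### The formal adjoint -/

section Divergence

open MeasureTheory

variable {p q : ℕ}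

/-- The integral of a derivative of a function with compact support vanishes. -/
theorem setIntegral_fderiv_eq_zero {U K : Set (Model p q)} (hU : IsOpen U) (hK : IsCompact K)
    (hKU : K ⊆ U) {f : Model p q → ℝ} (hf : ContDiffOn ℝ ∞ f U) (hfK : ∀ z ∈ U, z ∉ K → f z = 0)
    (w : Model p q) : IntegrableOn (fun z => fderiv ℝ f z w) U ∧
      ∫ z in U, fderiv ℝ f z w = 0 := by
  -- Extension by zero is C¹, as f vanishes on U outside the compact set K.
  set F := U.indicator f with hFdef
  have hF0 : ∀ z, z ∉ K → F z = 0 := by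
    intro z hz
    by_cases h : z ∈ U
    · rw [hFdef, Set.indicator_of_mem h, hfK z h hz]
    · exact Set.indicator_of_notMem h _
  have hevU : ∀ z ∈ U, F =ᶠ[𝓝 z] f := fun z hz => by
    filter_upwards [hU.mem_nhds hz] with y hy using Set.indicator_of_mem hy f
  have hevK : ∀ z, z ∉ K → F =ᶠ[𝓝 z] fun _ => 0 := fun z hz => by
    filter_upwards [hK.isClosed.isOpen_compl.mem_nhds hz] with y hy using hF0 y hy
  have hC : ContDiff ℝ 1 F := by
    rw [contDiff_iff_contDiffAt]
    intro z
    by_cases h : z ∈ K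
    · exact ((hf.contDiffAt (hU.mem_nhds (hKU h))).of_le (by simp)).congr_of_eventuallyEq
        (hevU z (hKU h))
    · exact contDiffAt_const.congr_of_eventuallyEq (hevK z h)
  have hsupp : HasCompactSupport F := HasCompactSupport.intro hK hF0
  have hint : Integrable F := hC.continuous.integrable_of_hasCompactSupport hsupp
  have hint' : Integrable fun z => fderiv ℝ F z w := by
    refine Continuous.integrable_of_hasCompactSupport
      ((hC.continuous_fderiv (by simp)).clm_apply continuous_const)
      (HasCompactSupport.intro hK fun z hz => ?_)
    rw [(hevK z hz).fderiv_eq]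
    simp
  have heq : Set.EqOn (fun z => fderiv ℝ F z w) (fun z => fderiv ℝ f z w) U := fun z hz => by
    simp only
    rw [(hevU z hz).fderiv_eq]
  have hzero : ∫ z, fderiv ℝ F z w = 0 := by
    -- Integration by parts against the constant function 1.
    have := integral_mul_fderiv_eq_neg_fderiv_mul_of_integrable (μ := (volume : Measure (Model p q)))
      (f := F) (g := fun _ => (1 : ℝ)) (v := w) (by simpa using hint') (by simp) (by simpa using hint)
      (fun z _ => hC.differentiable (by simp) z) (fun z _ => differentiableAt_const _)
    simpa using this
  refine ⟨hint'.integrableOn.congr_fun heq hU.measurableSet, ?_⟩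
  rw [← setIntegral_congr_fun hU.measurableSet heq, setIntegral_eq_integral_of_forall_compl_eq_zero,
    hzero]
  intro z hz
  rw [(hevK z fun h => hz (hKU h)).fderiv_eq]
  simp

end Divergence

/-! ### Pointwise scalar products; linearity and locality of P_η -/

section Linearity

variable {p q : ℕ} {M : Type*} [TopologicalSpace M] [ChartedSpace (Model p q) M]
  [IsManifold 𝓘(ℝ, Model p q) ∞ M] {g : Metric p q M} {u v : ℕ}
  {c : OpenPartialHomeomorph M (Model p q)} {z : Model p q}

/-- The pointwise scalar product of forms. -/
def fiberInner (g : Metric p q M) (u v : ℕ) (α β : FormField p q M (u + v)) (x : M) : ℝ :=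
  biInner (metricAt g x) (u := u) (v := v)
    (toBi (metricAt g x) (α x)) (toBi (metricAt g x) (β x))

theorem continuous_fiberInner (hF : IsFoliatedAtlas p q M) {α β : FormField p q M (u + v)}
    (hα : IsBiform g u v α) (hβ : IsBiform g u v β) : Continuous (fiberInner g u v α β) := by
  rw [continuous_iff_continuousAt]
  intro x
  set c := chartAt (Model p q) x
  have hc : c ∈ atlas (Model p q) M := chart_mem_atlas _ x
  have hmem : c.source ∈ 𝓝 x := c.open_source.mem_nhds (mem_chart_source _ x)
  refine ContinuousOn.continuousAt ?_ hmem
  have h1 := (contDiffOn_biInner (contDiffOn_chartMetric g hc)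
    (fun z hz => chartMetric_isScalarProduct hF g hc hz) (hα.isSmoothBi_coef hF hc)
    (hβ.isSmoothBi_coef hF hc)).continuousOn.comp c.continuousOn fun y hy => c.map_source hy
  refine h1.congr fun y hy => ?_
  simp only [Function.comp_apply]
  rw [biInner_coef hF hc (c.map_source hy), c.left_inv hy]
  rfl

theorem fiberInner_add_right (α β β' : FormField p q M (u + v)) (x : M) :
    fiberInner g u v α (β + β') x = fiberInner g u v α β x + fiberInner g u v α β' x := by
  unfold fiberInner
  rw [biInner_eq_biForm, biInner_eq_biForm, biInner_eq_biForm, ← biForm_add_right]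
  rfl

theorem fiberInner_mul_right (α β : FormField p q M (u + v)) (ρ : M → ℝ) (x : M) :
    fiberInner g u v α (fun x => ρ x • β x) x = ρ x * fiberInner g u v α β x := by
  unfold fiberInner
  rw [biInner_eq_biForm, biInner_eq_biForm, ← biForm_smul_right]
  rfl

theorem inv_transpose_of_posDef {n : ℕ} {L : Matrix (Fin n) (Fin n) ℝ} (hL : L.PosDef) :
    L⁻¹.transpose = L⁻¹ := by
  have := hL.inv.isHermitian
  rwa [Matrix.IsHermitian, Matrix.conjTranspose_eq_transpose_of_trivial] at this

theorem fiberInner_comm (α β : FormField p q M (u + v)) (x : M) :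
    fiberInner g u v α β x = fiberInner g u v β α x := by
  have hb := metricAt_isScalarProduct g x
  unfold fiberInner
  rw [biInner_eq_biForm, biInner_eq_biForm]
  exact biForm_comm (inv_transpose_of_posDef (normalGram_posDef hb))
    (inv_transpose_of_posDef (leafGram_posDef hb)) _ _

theorem fiberInner_eq_zero_right {α β : FormField p q M (u + v)} {x : M} (h : β x = 0) :
    fiberInner g u v α β x = 0 := by
  have h1 := fiberInner_mul_right (g := g) α β (fun _ => 0) x
  rw [zero_mul] at h1
  rw [← h1]
  simp only [fiberInner, h, smul_zero]

theorem fiberInner_self_nonneg (α : FormField p q M (u + v)) (x : M) :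
    0 ≤ fiberInner g u v α α x := by
  have hb := metricAt_isScalarProduct g x
  unfold fiberInner
  rw [biInner_eq_biForm]
  exact biForm_self_nonneg (normalGram_posDef hb).inv (leafGram_posDef hb).inv _

theorem IsBiSection.eq_zero_of_fiberInner_self {α : FormField p q M (u + v)}
    (hα : IsBiSection g u v α) {x : M} (h : fiberInner g u v α α x = 0) : α x = 0 := by
  have hb := metricAt_isScalarProduct g x
  unfold fiberInner at h
  rw [biInner_eq_biForm] at h
  rw [hα.eq_toForm, eq_zero_of_biForm_self (normalGram_posDef hb).inv (leafGram_posDef hb).inv h]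
  have := toForm_smul (metricAt g x) 0 (0 : BiAlt p q u v)
  rwa [zero_smul, zero_smul] at this

theorem stdBi_add (f f' : Model p q [⋀^Fin (u + v)]→L[ℝ] ℝ) :
    (stdBi (f + f') : BiAlt p q u v) = stdBi f + stdBi f' := rfl

theorem stdBi_smul (r : ℝ) (f : Model p q [⋀^Fin (u + v)]→L[ℝ] ℝ) :
    (stdBi (r • f) : BiAlt p q u v) = r • stdBi f := rfl

theorem twistedD_add (hF : IsFoliatedAtlas p q M) {η : FormField p q M (0 + 1)}
    (hη : IsBiform g 0 1 η) {φ ψ : FormField p q M (u + v)} (hφ : IsBiform g u v φ)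
    (hψ : IsBiform g u v ψ) :
    twistedD g η u v (φ + ψ) = twistedD g η u v φ + twistedD g η u v ψ := by
  refine IsBiSection.eq_of_coef hF (isBiform_twistedD hF hη (hφ.add hψ)).isBiSection
    ((isBiform_twistedD hF hη hφ).add (isBiform_twistedD hF hη hψ)).isBiSection
    fun c hc z hz => ?_
  rw [coef_add, coef_twistedD hF hη.isBiSection hφ hc hz, coef_twistedD hF hη.isBiSection hψ hc hz,
    coef_twistedD hF hη.isBiSection (hφ.add hψ) hc hz, ← Finset.sum_add_distrib]
  refine Finset.sum_congr rfl fun m _ => ?_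
  have e : coefPartial c u v (φ + ψ) z m = coefPartial c u v φ z m + coefPartial c u v ψ z m := by
    have h1 : chartRep c (φ + ψ) = chartRep c φ + chartRep c ψ := rfl
    rw [coefPartial, h1, fderiv_add (hφ.differentiableAt hc hz) (hψ.differentiableAt hc hz)]
    exact stdBi_add _ _
  rw [e, coef_add, ← biWedge_add_right, smul_add]
  congr 1
  abel

theorem twistedD_smul (hF : IsFoliatedAtlas p q M) {η : FormField p q M (0 + 1)}
    (hη : IsBiform g 0 1 η) (r : ℝ) {φ : FormField p q M (u + v)} (hφ : IsBiform g u v φ) :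
    twistedD g η u v (r • φ) = r • twistedD g η u v φ := by
  refine IsBiSection.eq_of_coef hF (isBiform_twistedD hF hη (hφ.smul r)).isBiSection
    ((isBiform_twistedD hF hη hφ).smul r).isBiSection fun c hc z hz => ?_
  rw [coef_smul, coef_twistedD hF hη.isBiSection hφ hc hz,
    coef_twistedD hF hη.isBiSection (hφ.smul r) hc hz, Finset.smul_sum]
  refine Finset.sum_congr rfl fun m _ => ?_
  have e : coefPartial c u v (r • φ) z m = r • coefPartial c u v φ z m := by
    have h1 : chartRep c (r • φ) = r • chartRep c φ := rfl
    rw [coefPartial, h1, fderiv_const_smul (hφ.differentiableAt hc hz)]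
    exact stdBi_smul _ _
  rw [e, coef_smul, ← biWedge_smul_right, smul_add, smul_comm]

/-- P_η is local: K is closed, so φ vanishes near x and the local formula gives zero coefficients.
The value at x is then zero because its length is. -/
theorem twistedD_eq_zero (hF : IsFoliatedAtlas p q M) {η : FormField p q M (0 + 1)}
    (hη : IsBiform g 0 1 η) {φ : FormField p q M (u + v)} (hφ : IsBiform g u v φ) {K : Set M}
    (hK : IsClosed K) (hφK : ∀ x, x ∉ K → φ x = 0) {x : M} (hx : x ∉ K) :
    twistedD g η u v φ x = 0 := by
  refine IsBiSection.eq_zero_of_fiberInner_self (isBiform_twistedD hF hη hφ).isBiSection ?_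
  set c := chartAt (Model p q) x
  have hc : c ∈ atlas (Model p q) M := chart_mem_atlas _ x
  have hz : c x ∈ c.target := mem_chart_target _ x
  have hxc : c.symm (c x) = x := c.left_inv (mem_chart_source _ x)
  have hev : chartRep c φ =ᶠ[𝓝 (c x)] fun _ => 0 := by
    have : c.symm ⁻¹' Kᶜ ∈ 𝓝 (c x) :=
      (c.continuousAt_symm hz).preimage_mem_nhds (by rw [hxc]; exact hK.isOpen_compl.mem_nhds hx)
    filter_upwards [this] with y hy
    unfold chartRep
    rw [hφK _ hy]
    rfl
  have hcoef : coef g c u (v + 1) (twistedD g η u v φ) (c x) = 0 := by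
    rw [coef_twistedD hF hη.isBiSection hφ hc hz]
    refine Finset.sum_eq_zero fun m _ => ?_
    have e1 : coefPartial c u v φ (c x) m = 0 := by
      rw [coefPartial, hev.fderiv_eq]
      simp only [fderiv_const_apply]
      rfl
    have e2 : coef g c u v φ (c x) = 0 := by
      unfold coef
      rw [hev.eq_of_nhds]
      rfl
    rw [e1, e2, smul_zero, add_zero]
    have := biWedge_smul_right (LinearMap.proj m) 0 (0 : BiAlt p q u v)
    rwa [zero_smul, zero_smul] at this
  have h1 := biInner_coef (g := g) hF hc hz (twistedD g η u v φ) (twistedD g η u v φ)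
  rw [hxc, hcoef] at h1
  refine h1.symm.trans ?_
  have := biForm_smul_right (normalGram (chartMetric g c (c x)))⁻¹
    (leafGram (chartMetric g c (c x)))⁻¹ 0 (0 : BiAlt p q u (v + 1)) 0
  rw [zero_smul, zero_mul] at this
  rwa [biInner_eq_biForm]

theorem IsBiform.mul {ρ : M → ℝ} (hρ : ContMDiff 𝓘(ℝ, Model p q) 𝓘(ℝ, ℝ) ∞ ρ)
    {φ : FormField p q M (u + v)} (hφ : IsBiform g u v φ) :
    IsBiform g u v fun x => ρ x • φ x := by
  refine ⟨fun c hc => ?_, hφ.isBiSection.mul ρ⟩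
  have h1 : ContDiffOn ℝ ∞ (fun z => ρ (c.symm z)) c.target :=
    contMDiffOn_iff_contDiffOn.mp (hρ.comp_contMDiffOn (contMDiffOn_symm_of_mem_maximalAtlas
      (IsManifold.subset_maximalAtlas (I := 𝓘(ℝ, Model p q)) (n := ∞) hc)))
  exact (h1.smul (hφ.1 c hc)).congr fun _ _ => rfl

theorem biAlt_eq_zero_of_lt (h : p < v) (a : BiAlt p q u v) : a = 0 := by
  refine biAlt_eq_zero_of_stdE fun c i => ?_
  obtain ⟨m, m', hne, he⟩ := Fintype.exists_ne_map_eq_of_card_lt i (by simpa using h)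
  exact (a _).map_eq_zero_of_eq _ (congrArg stdE he) hne

theorem IsBiSection.eq_zero_of_lt (h : p < v) {φ : FormField p q M (u + v)}
    (hφ : IsBiSection g u v φ) : φ = 0 := by
  funext x
  rw [hφ.eq_toForm, biAlt_eq_zero_of_lt h (toBi (metricAt g x) (φ x))]
  have := toForm_smul (metricAt g x) 0 (0 : BiAlt p q u v)
  rwa [zero_smul, zero_smul] at this

end Linearity

/-! ### Existence and uniqueness of the formal adjoint -/

section Adjoint

open MeasureTheory

variable {p q : ℕ} {M : Type*} [TopologicalSpace M] [ChartedSpace (Model p q) M]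
  [IsManifold 𝓘(ℝ, Model p q) ∞ M] [T2Space M] [CompactSpace M] {g : Metric p q M} {u v : ℕ}

theorem l2Inner_eq (α β : FormField p q M (u + v)) :
    l2Inner g u v α β = integralVol g (fiberInner g u v α β) := rfl

theorem l2Inner_comm (α β : FormField p q M (u + v)) :
    l2Inner g u v α β = l2Inner g u v β α := by
  rw [l2Inner_eq, l2Inner_eq, funext (fiberInner_comm α β)]

theorem l2Inner_add_right (hF : IsFoliatedAtlas p q M) {α β β' : FormField p q M (u + v)}
    (hα : IsBiform g u v α) (hβ : IsBiform g u v β) (hβ' : IsBiform g u v β') :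
    l2Inner g u v α (β + β') = l2Inner g u v α β + l2Inner g u v α β' := by
  rw [l2Inner_eq, l2Inner_eq, l2Inner_eq, ← integralVol_add hF (continuous_fiberInner hF hα hβ)
    (continuous_fiberInner hF hα hβ')]
  exact congrArg _ (funext (fiberInner_add_right α β β'))

theorem l2Inner_add_left (hF : IsFoliatedAtlas p q M) {α α' β : FormField p q M (u + v)}
    (hα : IsBiform g u v α) (hα' : IsBiform g u v α') (hβ : IsBiform g u v β) :
    l2Inner g u v (α + α') β = l2Inner g u v α β + l2Inner g u v α' β := by
  rw [l2Inner_comm, l2Inner_add_right hF hβ hα hα', l2Inner_comm β, l2Inner_comm β]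

theorem l2Inner_smul_right (r : ℝ) (α β : FormField p q M (u + v)) :
    l2Inner g u v α (r • β) = r * l2Inner g u v α β := by
  rw [l2Inner_eq, l2Inner_eq, ← integralVol_const_mul]
  exact congrArg _ (funext (fiberInner_mul_right α β fun _ => r))

theorem l2Inner_smul_left (r : ℝ) (α β : FormField p q M (u + v)) :
    l2Inner g u v (r • α) β = r * l2Inner g u v α β := by
  rw [l2Inner_comm, l2Inner_smul_right, l2Inner_comm]

theorem l2Inner_zero_right (α : FormField p q M (u + v)) : l2Inner g u v α 0 = 0 := by
  have := l2Inner_smul_right (g := g) 0 α 0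
  rwa [zero_smul, zero_mul] at this

/-- Biforms are determined by their scalar products. -/
theorem IsBiform.eq_of_l2Inner (hF : IsFoliatedAtlas p q M) {α β : FormField p q M (u + v)}
    (hα : IsBiform g u v α) (hβ : IsBiform g u v β)
    (h : ∀ φ, IsBiform g u v φ → l2Inner g u v φ α = l2Inner g u v φ β) : α = β := by
  -- The difference of the two forms serves as its own test form.
  set δ := α + (-1 : ℝ) • β with hδ
  have hδb : IsBiform g u v δ := hα.add (hβ.smul _)
  have h0 : integralVol g (fiberInner g u v δ δ) = 0 := by
    rw [← l2Inner_eq]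
    rw [show l2Inner g u v δ δ = l2Inner g u v δ (α + (-1 : ℝ) • β) from rfl,
      l2Inner_add_right hF hδb hα (hβ.smul _), l2Inner_smul_right, h δ hδb]
    ring
  have hzero : δ = 0 := funext fun x => hδb.isBiSection.eq_zero_of_fiberInner_self
    (eq_zero_of_integralVol_eq_zero hF (continuous_fiberInner hF hδb hδb)
      (fiberInner_self_nonneg δ) h0 x)
  have e : (-1 : ℝ) • β = -β := neg_one_smul ℝ β
  rw [hδ, e, ← sub_eq_add_neg, sub_eq_zero] at hzero
  exact hzero

/-- Formal adjointness for forms supported in the domain of a chart. -/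
theorem l2Inner_twistedD_of_support (hF : IsFoliatedAtlas p q M) {χ : FormField p q M (0 + p)}
    (hχ : IsLeafVolume g χ) {η : FormField p q M (0 + 1)} (hη : IsBiform g 0 1 η)
    {c : OpenPartialHomeomorph M (Model p q)} (hc : c ∈ atlas (Model p q) M) {v' : ℕ}
    (h : v + 1 + v' = p) {φ : FormField p q M (u + v)} (hφ : IsBiform g u v φ)
    {ψ : FormField p q M (u + (v + 1))} (hψ : IsBiform g u (v + 1) ψ)
    {θ : FormField p q M (u + v)} (hθ : IsBiform g u v θ)
    (hdiv : ∀ z ∈ c.target,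
      (biInner (chartMetric g c z) (coef g c u (v + 1) (twistedD g η u v φ) z)
          (coef g c u (v + 1) ψ z) -
        biInner (chartMetric g c z) (coef g c u v φ z) (coef g c u v θ z)) * volDensity g c z =
      ∑ m, fderiv ℝ (leafFlux g χ c h φ (leafStar g χ u h ψ) m) z (stdE m, 0))
    {K : Set M} (hK : IsCompact K) (hKc : K ⊆ c.source) (hφK : ∀ x, x ∉ K → φ x = 0) :
    l2Inner g u (v + 1) (twistedD g η u v φ) ψ = l2Inner g u v φ θ := by
  have hP := isBiform_twistedD hF hη hφ
  set f : M → ℝ := fun x => fiberInner g u (v + 1) (twistedD g η u v φ) ψ x +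
    (-1) * fiberInner g u v φ θ x with hf
  have hcont1 := continuous_fiberInner hF hP hψ
  have hcont2 := continuous_fiberInner hF hφ hθ
  have hcont3 : Continuous fun x => (-1) * fiberInner g u v φ θ x := continuous_const.mul hcont2
  have hfcont : Continuous f := hcont1.add hcont3
  have hfK : ∀ x, x ∉ K → f x = 0 := by
    intro x hx
    simp only [hf]
    rw [fiberInner_comm, fiberInner_eq_zero_right (twistedD_eq_zero hF hη hφ hK.isClosed hφK hx),
      fiberInner_comm, fiberInner_eq_zero_right (hφK x hx)]
    ring
  have hzero : integralVol g f = 0 := by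
    rw [integralVol_eq_chartIntegral hF hc hfcont hK hKc hfK, chartIntegral]
    have hγ := isBiform_leafStar hF hχ.1 h hψ
    have hcK : IsCompact (c '' K) := hK.image_of_continuousOn (c.continuousOn.mono hKc)
    have hcKt : c '' K ⊆ c.target := fun z ⟨x, hx, h⟩ => h ▸ c.map_source (hKc hx)
    have hflux : ∀ m, ∀ z ∈ c.target, z ∉ c '' K →
        leafFlux g χ c h φ (leafStar g χ u h ψ) m z = 0 := by
      intro m z hz hzK
      have hx : c.symm z ∉ K := fun hx => hzK ⟨_, hx, c.right_inv hz⟩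
      have e : coef g c u v φ z = 0 := by
        unfold coef chartRep
        rw [hφK _ hx]
        rfl
      have e' := biWedge_smul_right (LinearMap.proj m) 0 (0 : BiAlt p q u v)
      rw [zero_smul, zero_smul] at e'
      rw [leafFlux, e, e', map_zero, LinearMap.zero_apply, mul_zero]
    -- The flux is supported where φ is, inside the compact image of K, so each term of the
    -- divergence integrates to zero.
    have hdivm := fun m => setIntegral_fderiv_eq_zero c.open_target hcK hcKt
      (contDiffOn_leafFlux hF hχ hc h hφ hγ m) (hflux m) (stdE m, 0)
    rw [setIntegral_congr_fun (g := fun z => ∑ m, fderiv ℝ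
      (leafFlux g χ c h φ (leafStar g χ u h ψ) m) z (stdE m, 0)) c.open_target.measurableSet,
      integral_finsetSum _ fun m _ => (hdivm m).1]
    · exact Finset.sum_eq_zero fun m _ => (hdivm m).2
    · intro z hz
      simp only
      rw [← hdiv z hz, biInner_coef hF hc hz, biInner_coef hF hc hz, sub_eq_add_neg,
        ← neg_one_mul]
      rfl
  rw [hf, integralVol_add hF hcont1 hcont3, integralVol_const_mul] at hzero
  rw [l2Inner_eq, l2Inner_eq]
  linarith

/-- Only φ is cut by the partition of unity, with ψ and θ fixed. This is why the divergence identity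
is required for all φ with one θ. -/
theorem l2Inner_twistedD (hF : IsFoliatedAtlas p q M) {χ : FormField p q M (0 + p)}
    (hχ : IsLeafVolume g χ) {η : FormField p q M (0 + 1)} (hη : IsBiform g 0 1 η) {v' : ℕ}
    (h : v + 1 + v' = p) {φ : FormField p q M (u + v)} (hφ : IsBiform g u v φ)
    {ψ : FormField p q M (u + (v + 1))} (hψ : IsBiform g u (v + 1) ψ)
    {θ : FormField p q M (u + v)} (hθ : IsBiform g u v θ)
    (hdiv : ∀ φ, IsBiform g u v φ → ∀ c ∈ atlas (Model p q) M, ∀ z ∈ c.target,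
      (biInner (chartMetric g c z) (coef g c u (v + 1) (twistedD g η u v φ) z)
          (coef g c u (v + 1) ψ z) -
        biInner (chartMetric g c z) (coef g c u v φ z) (coef g c u v θ z)) * volDensity g c z =
      ∑ m, fderiv ℝ (leafFlux g χ c h φ (leafStar g χ u h ψ) m) z (stdE m, 0)) :
    l2Inner g u (v + 1) (twistedD g η u v φ) ψ = l2Inner g u v φ θ := by
  classical
  set ρφ : M → FormField p q M (u + v) := fun i x => chartPartition p q M i x • φ x with hρφ
  have hρ : ∀ i, IsBiform g u v (ρφ i) := fun i =>
    IsBiform.mul (chartPartition p q M i).contMDiff hφ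
  have hsum : φ = ∑ i ∈ chartIndices p q M, ρφ i := by
    funext x
    rw [Finset.sum_apply]
    simp only [hρφ]
    rw [← Finset.sum_smul, sum_chartPartition, one_smul]
  have key : ∀ S : Finset M, IsBiform g u v (∑ i ∈ S, ρφ i) ∧
      l2Inner g u (v + 1) (twistedD g η u v (∑ i ∈ S, ρφ i)) ψ =
        l2Inner g u v (∑ i ∈ S, ρφ i) θ := by
    intro S
    induction S using Finset.induction_on with
    | empty =>
      refine ⟨IsBiform.zero, ?_⟩
      have h0 := twistedD_smul hF hη 0 (IsBiform.zero (g := g) (u := u) (v := v))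
      rw [zero_smul, zero_smul] at h0
      rw [Finset.sum_empty, h0, l2Inner_comm, l2Inner_zero_right, l2Inner_comm,
        l2Inner_zero_right]
    | insert i S hi ih =>
      rw [Finset.sum_insert hi]
      refine ⟨(hρ i).add ih.1, ?_⟩
      rw [twistedD_add hF hη (hρ i) ih.1, l2Inner_add_left hF (isBiform_twistedD hF hη (hρ i))
        (isBiform_twistedD hF hη ih.1) hψ, l2Inner_add_left hF (hρ i) ih.1 hθ, ih.2,
        l2Inner_twistedD_of_support hF hχ hη (chart_mem_atlas _ i) h (hρ i) hψ hθ
          (fun z hz => hdiv _ (hρ i) _ (chart_mem_atlas _ i) z hz)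
          (isCompact_tsupport_chartPartition i) (chartPartition_tsupport i)
          fun x hx => by simp only [hρφ, chartPartition_eq_zero hx, zero_smul]]
  rw [hsum]
  exact (key _).2

theorem IsFormalAdjoint.unique (hF : IsFoliatedAtlas p q M)
    {A : FormField p q M (u + v) → FormField p q M (u + (v + 1))}
    {B B' : FormField p q M (u + (v + 1)) → FormField p q M (u + v)}
    (hB : IsFormalAdjoint g u v A B) (hB' : IsFormalAdjoint g u v A B')
    {ψ : FormField p q M (u + (v + 1))} (hψ : IsBiform g u (v + 1) ψ) : B ψ = B' ψ :=
  IsBiform.eq_of_l2Inner hF (hB.2.1 ψ hψ) (hB'.2.1 ψ hψ) fun φ hφ =>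
    (hB.2.2 φ ψ hφ hψ).symm.trans (hB'.2.2 φ ψ hφ hψ)

/-- The integrated form of the divergence identity: it provides the adjoint and the formula P_η^* =
ε ⋆_F P_{-η} ⋆_F. -/
theorem exists_isFormalAdjoint_leafStar (hF : IsFoliatedAtlas p q M) (hg : IsBundleLike g)
    {χ : FormField p q M (0 + p)} (hχ : IsLeafVolume g χ) {η : FormField p q M (0 + 1)}
    (hη : IsBiform g 0 1 η) {v' : ℕ} (h : v + 1 + v' = p) (h' : v' + 1 + v = p) :
    ∃ ε : ℝ, ε * ε = 1 ∧ ∀ u, IsFormalAdjoint g u v (twistedD g η u v) fun ψ =>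
      ε • leafStar g χ u h' (twistedD g (-η) u v' (leafStar g χ u h ψ)) := by
  obtain ⟨ε, hε, hdiv⟩ := exists_sum_fderiv_leafFlux hF hg hχ hη h h'
  have hB : ∀ u ψ, IsBiform g u (v + 1) ψ →
      IsBiform g u v (ε • leafStar g χ u h' (twistedD g (-η) u v' (leafStar g χ u h ψ))) :=
    fun u ψ hψ => (isBiform_leafStar hF hχ.1 h' (isBiform_twistedD hF hη.neg
      (isBiform_leafStar hF hχ.1 h hψ))).smul ε
  exact ⟨ε, hε, fun u => ⟨fun φ hφ => isBiform_twistedD hF hη hφ, hB u, fun φ ψ hφ hψ =>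
    l2Inner_twistedD hF hχ hη h hφ hψ (hB u ψ hψ) fun φ hφ c hc z hz => hdiv hφ hψ hc hz⟩⟩

theorem isFormalAdjoint_twistedCoD (hF : IsFoliatedAtlas p q M) (hg : IsBundleLike g)
    {χ : FormField p q M (0 + p)} (hχ : IsLeafVolume g χ) {η : FormField p q M (0 + 1)}
    (hη : IsBiform g 0 1 η) (u v : ℕ) :
    IsFormalAdjoint g u v (twistedD g η u v) (twistedCoD g η u v) := by
  have hex : ∃ B, IsFormalAdjoint g u v (twistedD g η u v) B := by
    by_cases hv : v + 1 ≤ p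
    · obtain ⟨ε, -, hB⟩ := exists_isFormalAdjoint_leafStar hF hg hχ hη (v := v)
        (v' := p - (v + 1)) (by omega) (by omega)
      exact ⟨_, hB u⟩
    -- For v ≥ p there are no nonzero forms of leafwise degree v + 1, and the zero operator is
    -- adjoint to P_η.
    · refine ⟨fun _ => 0, fun φ hφ => isBiform_twistedD hF hη hφ, fun _ _ => IsBiform.zero,
        fun φ ψ hφ hψ => ?_⟩
      rw [hψ.isBiSection.eq_zero_of_lt (by omega), l2Inner_zero_right, l2Inner_zero_right]
  unfold twistedCoD formalAdjoint
  rw [dif_pos hex]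
  exact Classical.choose_spec hex

end Adjoint

/-! ### The star operators and the Laplacian -/

section Stars

variable {p q : ℕ} {M : Type*} [TopologicalSpace M] [ChartedSpace (Model p q) M]
  [IsManifold 𝓘(ℝ, Model p q) ∞ M] {g : Metric p q M} {u u' v v' : ℕ}

theorem leafStar_add (χ : FormField p q M (0 + p)) (hv : v + v' = p)
    (φ ψ : FormField p q M (u + v)) :
    leafStar g χ u hv (φ + ψ) = leafStar g χ u hv φ + leafStar g χ u hv ψ := by
  have key : ∀ (S : ((Fin p → ℝ) [⋀^Fin v]→ₗ[ℝ] ℝ) →ₗ[ℝ] ((Fin p → ℝ) [⋀^Fin v']→ₗ[ℝ] ℝ))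
      (a a' : BiAlt p q u v), S.compAlternatingMap (a + a') =
        S.compAlternatingMap a + S.compAlternatingMap a' := fun S a a' => by
    ext1 y
    exact map_add S (a y) (a' y)
  funext x
  simp only [leafStar, Pi.add_apply]
  rw [toBi_add, key, toForm_add]

theorem leafStar_smul (χ : FormField p q M (0 + p)) (hv : v + v' = p) (r : ℝ)
    (φ : FormField p q M (u + v)) :
    leafStar g χ u hv (r • φ) = r • leafStar g χ u hv φ := by
  have key : ∀ (S : ((Fin p → ℝ) [⋀^Fin v]→ₗ[ℝ] ℝ) →ₗ[ℝ] ((Fin p → ℝ) [⋀^Fin v']→ₗ[ℝ] ℝ))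
      (a : BiAlt p q u v), S.compAlternatingMap (r • a) = r • S.compAlternatingMap a :=
    fun S a => by
      ext1 y
      exact map_smul S r (a y)
  funext x
  simp only [leafStar, Pi.smul_apply]
  rw [toBi_smul, key, toForm_smul]

theorem perpStar_add (ν : FormField p q M (q + 0)) (hu : u + u' = q)
    (φ ψ : FormField p q M (u + v)) :
    perpStar g ν hu v (φ + ψ) = perpStar g ν hu v φ + perpStar g ν hu v ψ := by
  funext x
  simp only [perpStar, Pi.add_apply]
  rw [toBi_add, map_add, toForm_add]

theorem perpStar_smul (ν : FormField p q M (q + 0)) (hu : u + u' = q) (r : ℝ)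
    (φ : FormField p q M (u + v)) :
    perpStar g ν hu v (r • φ) = r • perpStar g ν hu v φ := by
  funext x
  simp only [perpStar, Pi.smul_apply]
  rw [toBi_smul, map_smul, toForm_smul]

theorem IsLeafVolume.formInner_toBi {χ : FormField p q M (0 + p)} (hχ : IsLeafVolume g χ)
    (x : M) : formInner (leafGram (metricAt g x))⁻¹
      (toBi (u := 0) (v := p) (metricAt g x) (χ x) 0)
      (toBi (u := 0) (v := p) (metricAt g x) (χ x) 0) = 1 := by
  rw [← biForm_zero_left (normalGram (metricAt g x))⁻¹, ← biInner_eq_biForm]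
  exact hχ.2 x

theorem IsTransverseVolume.formInner_toBi {ν : FormField p q M (q + 0)}
    (hν : IsTransverseVolume g ν) (x : M) : formInner (normalGram (metricAt g x))⁻¹
      (leafEval (toBi (u := q) (v := 0) (metricAt g x) (ν x)) 0)
      (leafEval (toBi (u := q) (v := 0) (metricAt g x) (ν x)) 0) = 1 := by
  rw [← biForm_zero_right _ (leafGram (metricAt g x))⁻¹, ← biInner_eq_biForm]
  exact hν.2 x

theorem toBi_leafStar (χ : FormField p q M (0 + p)) (hv : v + v' = p)
    (φ : FormField p q M (u + v)) (x : M) :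
    toBi (metricAt g x) (leafStar g χ u hv φ x) =
      (hodgeStar hv (leafGram (metricAt g x))⁻¹
        (toBi (u := 0) (v := p) (metricAt g x) (χ x) 0)).compAlternatingMap
      (toBi (u := u) (v := v) (metricAt g x) (φ x)) := toBi_toForm _ _

theorem toBi_perpStar (ν : FormField p q M (q + 0)) (hu : u + u' = q)
    (φ : FormField p q M (u + v)) (x : M) :
    toBi (metricAt g x) (perpStar g ν hu v φ x) =
      hodgeStar hu (normalGram (metricAt g x))⁻¹
        (leafEval (toBi (u := q) (v := 0) (metricAt g x) (ν x)) 0)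
      (toBi (u := u) (v := v) (metricAt g x) (φ x)) := toBi_toForm _ _

theorem fiberInner_leafStar {χ : FormField p q M (0 + p)} (hχ : IsLeafVolume g χ)
    (hv : v + v' = p) (φ ψ : FormField p q M (u + v)) (x : M) :
    fiberInner g u v' (leafStar g χ u hv φ) (leafStar g χ u hv ψ) x = fiberInner g u v φ ψ x := by
  have hb := metricAt_isScalarProduct g x
  unfold fiberInner
  rw [toBi_leafStar, toBi_leafStar, biInner_eq_biForm, biInner_eq_biForm,
    biForm_hodgeStar_leaf hv _ (leafGram_posDef hb).inv (hχ.formInner_toBi x)]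

theorem fiberInner_perpStar {ν : FormField p q M (q + 0)} (hν : IsTransverseVolume g ν)
    (hu : u + u' = q) (φ ψ : FormField p q M (u + v)) (x : M) :
    fiberInner g u' v (perpStar g ν hu v φ) (perpStar g ν hu v ψ) x = fiberInner g u v φ ψ x := by
  have hb := metricAt_isScalarProduct g x
  unfold fiberInner
  rw [toBi_perpStar, toBi_perpStar, biInner_eq_biForm, biInner_eq_biForm,
    biForm_hodgeStar_perp hu _ (normalGram_posDef hb).inv (hν.formInner_toBi x)]

theorem exists_leafStar_leafStar {χ : FormField p q M (0 + p)} (hχ : IsLeafVolume g χ)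
    (hv : v + v' = p) (hv' : v' + v = p) : ∃ c : ℝ, c * c = 1 ∧
      ∀ (u : ℕ) (φ : FormField p q M (u + v)), IsBiSection g u v φ →
        leafStar g χ u hv' (leafStar g χ u hv φ) = c • φ := by
  obtain ⟨c, hc, hs⟩ := exists_hodgeStar_hodgeStar hv hv'
  refine ⟨c, hc, fun u φ hφ => funext fun x => ?_⟩
  have hb := metricAt_isScalarProduct g x
  have e : c • φ x = toForm (metricAt g x) (c • toBi (u := u) (v := v) (metricAt g x) (φ x)) := by
    rw [toForm_smul, ← hφ.eq_toForm]
  refine Eq.trans ?_ e.symm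
  rw [leafStar, toBi_leafStar]
  congr 1
  ext1 y
  exact hs (leafGram_posDef hb).inv (hχ.formInner_toBi x) _

theorem exists_perpStar_perpStar {ν : FormField p q M (q + 0)} (hν : IsTransverseVolume g ν)
    (hu : u + u' = q) (hu' : u' + u = q) : ∃ c : ℝ, c * c = 1 ∧
      ∀ (v : ℕ) (φ : FormField p q M (u + v)), IsBiSection g u v φ →
        perpStar g ν hu' v (perpStar g ν hu v φ) = c • φ := by
  obtain ⟨c, hc, hs⟩ := exists_hodgeStar_hodgeStar hu hu'
  refine ⟨c, hc, fun v φ hφ => funext fun x => ?_⟩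
  have hb := metricAt_isScalarProduct g x
  have e : c • φ x = toForm (metricAt g x) (c • toBi (u := u) (v := v) (metricAt g x) (φ x)) := by
    rw [toForm_smul, ← hφ.eq_toForm]
  refine Eq.trans ?_ e.symm
  rw [perpStar, toBi_perpStar]
  congr 1
  refine biAlt_ext fun y z => ?_
  change leafEval (hodgeStar hu' (normalGram (metricAt g x))⁻¹
    (leafEval (toBi (u := q) (v := 0) (metricAt g x) (ν x)) 0) _) z y = _
  rw [leafEval_hodgeStar, leafEval_hodgeStar,
    hs (normalGram_posDef hb).inv (hν.formInner_toBi x)]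
  rfl

end Stars

/-! ### Intertwining relations and the Laplacians -/

section Laplacian

variable {p q : ℕ} {M : Type*} [TopologicalSpace M] [ChartedSpace (Model p q) M]
  [IsManifold 𝓘(ℝ, Model p q) ∞ M] [T2Space M] [CompactSpace M] {g : Metric p q M}
  {u u' v v' : ℕ}

theorem l2Inner_leafStar {χ : FormField p q M (0 + p)} (hχ : IsLeafVolume g χ)
    (hv : v + v' = p) (φ ψ : FormField p q M (u + v)) :
    l2Inner g u v' (leafStar g χ u hv φ) (leafStar g χ u hv ψ) = l2Inner g u v φ ψ := by
  rw [l2Inner_eq, l2Inner_eq, funext (fiberInner_leafStar hχ hv φ ψ)]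

theorem l2Inner_perpStar {ν : FormField p q M (q + 0)} (hν : IsTransverseVolume g ν)
    (hu : u + u' = q) (φ ψ : FormField p q M (u + v)) :
    l2Inner g u' v (perpStar g ν hu v φ) (perpStar g ν hu v ψ) = l2Inner g u v φ ψ := by
  rw [l2Inner_eq, l2Inner_eq, funext (fiberInner_perpStar hν hu φ ψ)]

/-- Forms of the same bidegree are equal if they have the same scalar products with the images of
the leafwise star operator. -/
theorem IsBiform.eq_of_l2Inner_leafStar (hF : IsFoliatedAtlas p q M)
    {χ : FormField p q M (0 + p)} (hχ : IsLeafVolume g χ) (hv : v + v' = p)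
    {α β : FormField p q M (u + v')} (hα : IsBiform g u v' α) (hβ : IsBiform g u v' β)
    (h : ∀ φ, IsBiform g u v φ →
      l2Inner g u v' (leafStar g χ u hv φ) α = l2Inner g u v' (leafStar g χ u hv φ) β) :
    α = β := by
  have hv' : v' + v = p := by omega
  obtain ⟨c, hc, hs⟩ := exists_leafStar_leafStar hχ hv' hv
  refine hα.eq_of_l2Inner hF hβ fun θ hθ => ?_
  have := h _ (isBiform_leafStar hF hχ.1 hv' hθ)
  rw [hs u θ hθ.isBiSection, l2Inner_smul_left, l2Inner_smul_left] at this
  exact mul_left_cancel₀ (fun h0 => by simp [h0] at hc) this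

theorem IsBiform.eq_of_l2Inner_perpStar (hF : IsFoliatedAtlas p q M)
    {ν : FormField p q M (q + 0)} (hν : IsTransverseVolume g ν) (hu : u + u' = q)
    {α β : FormField p q M (u' + v)} (hα : IsBiform g u' v α) (hβ : IsBiform g u' v β)
    (h : ∀ φ, IsBiform g u v φ →
      l2Inner g u' v (perpStar g ν hu v φ) α = l2Inner g u' v (perpStar g ν hu v φ) β) :
    α = β := by
  have hu' : u' + u = q := by omega
  obtain ⟨c, hc, hs⟩ := exists_perpStar_perpStar hν hu' hu
  refine hα.eq_of_l2Inner hF hβ fun θ hθ => ?_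
  have := h _ (isBiform_perpStar hF hν.1 hu' hθ)
  rw [hs v θ hθ.isBiSection, l2Inner_smul_left, l2Inner_smul_left] at this
  exact mul_left_cancel₀ (fun h0 => by simp [h0] at hc) this

variable {η : FormField p q M (0 + 1)}

theorem twistedCoD_smul (hF : IsFoliatedAtlas p q M)
    (hadj : IsFormalAdjoint g u v (twistedD g η u v) (twistedCoD g η u v)) (r : ℝ)
    {ψ : FormField p q M (u + (v + 1))} (hψ : IsBiform g u (v + 1) ψ) :
    twistedCoD g η u v (r • ψ) = r • twistedCoD g η u v ψ := by
  refine IsBiform.eq_of_l2Inner hF (hadj.2.1 _ (hψ.smul r)) ((hadj.2.1 _ hψ).smul r)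
    fun φ hφ => ?_
  rw [← hadj.2.2 φ _ hφ (hψ.smul r), l2Inner_smul_right, l2Inner_smul_right,
    hadj.2.2 φ ψ hφ hψ]

theorem twistedCoD_zero (hF : IsFoliatedAtlas p q M)
    (hadj : IsFormalAdjoint g u v (twistedD g η u v) (twistedCoD g η u v)) :
    twistedCoD g η u v 0 = 0 := by
  have := twistedCoD_smul hF hadj 0 (IsBiform.zero (g := g) (u := u) (v := v + 1))
  rwa [zero_smul, zero_smul] at this

/-- The leafwise star operator intertwines `P_η^*` with `P_{-η}` and `P_η` with `P_{-η}^*`, with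
the same sign. -/
theorem exists_leafStar_twistedD (hF : IsFoliatedAtlas p q M) (hg : IsBundleLike g)
    {χ : FormField p q M (0 + p)} (hχ : IsLeafVolume g χ) (hη : IsBiform g 0 1 η)
    (h : v + 1 + v' = p) (h' : v + (v' + 1) = p) : ∃ e : ℝ, e * e = 1 ∧ ∀ u : ℕ,
      (∀ ψ : FormField p q M (u + (v + 1)), IsBiform g u (v + 1) ψ →
        leafStar g χ u h' (twistedCoD g η u v ψ) =
          e • twistedD g (-η) u v' (leafStar g χ u h ψ)) ∧
      (∀ φ : FormField p q M (u + v), IsBiform g u v φ →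
        leafStar g χ u h (twistedD g η u v φ) =
          e • twistedCoD g (-η) u v' (leafStar g χ u h' φ)) := by
  have h'' : v' + 1 + v = p := by omega
  obtain ⟨ε, hε, hB⟩ := exists_isFormalAdjoint_leafStar hF hg hχ hη h h''
  obtain ⟨c, hc, hs⟩ := exists_leafStar_leafStar hχ h'' h'
  -- The first factor comes from the formula for the adjoint; the second from the double star
  -- created by applying ⋆_F to that formula.
  refine ⟨ε * c, by linear_combination (c * c) * hε + hc, fun u => ?_⟩
  have hadj := isFormalAdjoint_twistedCoD hF hg hχ hη u v
  have hadj' := isFormalAdjoint_twistedCoD hF hg hχ hη.neg u v'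
  have first : ∀ ψ : FormField p q M (u + (v + 1)), IsBiform g u (v + 1) ψ →
      leafStar g χ u h' (twistedCoD g η u v ψ) =
        (ε * c) • twistedD g (-η) u v' (leafStar g χ u h ψ) := by
    intro ψ hψ
    have hD := isBiform_twistedD hF hη.neg (isBiform_leafStar hF hχ.1 h hψ)
    rw [hadj.unique hF (hB u) hψ, leafStar_smul, hs u _ hD.isBiSection]
    exact smul_smul ε c _
  refine ⟨first, fun φ hφ => ?_⟩
  have hSφ := isBiform_leafStar hF hχ.1 h' hφ
  -- The second relation is the dual of the first, tested on the forms ⋆_F ψ: the star is an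
  -- isometry and P_η, P_{-η} have adjoints. Hence the sign is the same.
  refine IsBiform.eq_of_l2Inner_leafStar hF hχ h
    (isBiform_leafStar hF hχ.1 h (isBiform_twistedD hF hη hφ))
    ((hadj'.2.1 _ hSφ).smul _) fun ψ hψ => ?_
  have hSψ := isBiform_leafStar hF hχ.1 h hψ
  rw [l2Inner_leafStar hχ, l2Inner_comm, hadj.2.2 φ ψ hφ hψ, ← l2Inner_leafStar hχ h',
    first ψ hψ, l2Inner_smul_right, l2Inner_smul_right, ← hadj'.2.2 _ _ hSψ hSφ, l2Inner_comm]

/-- The adjoint of `perpStar_twistedD`, as ⋆_⊥ is an isometry whose images suffice as test forms. -/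
theorem perpStar_twistedCoD (hF : IsFoliatedAtlas p q M) (hg : IsBundleLike g)
    (hadj : ∀ u v, IsFormalAdjoint g u v (twistedD g η u v) (twistedCoD g η u v))
    {ν : FormField p q M (q + 0)} (hν : IsTransverseVolume g ν) (hη : IsBiform g 0 1 η)
    (hu : u + u' = q) {ψ : FormField p q M (u + (v + 1))} (hψ : IsBiform g u (v + 1) ψ) :
    perpStar g ν hu v (twistedCoD g η u v ψ) =
      (-1 : ℝ) ^ q • twistedCoD g η u' v (perpStar g ν hu (v + 1) ψ) := by
  have hSψ := isBiform_perpStar hF hν.1 hu hψ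
  refine IsBiform.eq_of_l2Inner_perpStar hF hν hu
    (isBiform_perpStar hF hν.1 hu ((hadj u v).2.1 _ hψ))
    (((hadj u' v).2.1 _ hSψ).smul _) fun φ hφ => ?_
  rw [l2Inner_perpStar hν, ← (hadj u v).2.2 φ ψ hφ hψ, ← l2Inner_perpStar hν hu,
    perpStar_twistedD hF hg hν hη hu hφ, l2Inner_smul_left, l2Inner_smul_right,
    (hadj u' v).2.2 _ _ (isBiform_perpStar hF hν.1 hu hφ) hSψ]

/-- The term `P P^*` of the Laplacian, which is absent for `v = 0`. -/
def twistedDCoD (g : Metric p q M) (η : FormField p q M (0 + 1)) (u : ℕ) :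
    (v : ℕ) → FormField p q M (u + v) → FormField p q M (u + v)
  | 0, _ => 0
  | v + 1, φ => twistedD g η u v (twistedCoD g η u v φ)

theorem twistedLaplacian_eq (v : ℕ) (φ : FormField p q M (u + v)) :
    twistedLaplacian g η u v φ =
      twistedDCoD g η u v φ + twistedCoD g η u v (twistedD g η u v φ) := by
  cases v with
  | zero => exact (zero_add _).symm
  | succ v => rfl

theorem leafStar_twistedCoD_twistedD (hF : IsFoliatedAtlas p q M) (hg : IsBundleLike g)
    {χ : FormField p q M (0 + p)} (hχ : IsLeafVolume g χ) (hη : IsBiform g 0 1 η)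
    (hv : v + v' = p) {φ : FormField p q M (u + v)} (hφ : IsBiform g u v φ) :
    leafStar g χ u hv (twistedCoD g η u v (twistedD g η u v φ)) =
      twistedDCoD g (-η) u v' (leafStar g χ u hv φ) := by
  have hPφ := isBiform_twistedD hF hη hφ
  cases v' with
  | zero =>
    -- Here v = p, so P_η φ has leafwise degree p + 1 and is zero; on the other side the term is
    -- absent in degree 0.
    rw [hPφ.isBiSection.eq_zero_of_lt (by omega),
      twistedCoD_zero hF (isFormalAdjoint_twistedCoD hF hg hχ hη u v)]
    have := leafStar_smul (g := g) (u := u) χ hv 0 0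
    rw [zero_smul, zero_smul] at this
    exact this
  | succ w =>
    obtain ⟨e, he, hs⟩ := exists_leafStar_twistedD hF hg hχ hη (v := v) (v' := w) (by omega) hv
    have hQ := (isFormalAdjoint_twistedCoD hF hg hχ hη.neg u w).2.1 _
      (isBiform_leafStar hF hχ.1 hv hφ)
    -- Both intertwining relations are applied, each with the sign e, so e² = 1 remains.
    rw [(hs u).1 _ hPφ, (hs u).2 _ hφ, twistedD_smul hF hη.neg _ hQ]
    exact (smul_smul e e _).trans (by rw [he, one_smul]; rfl)

theorem leafStar_twistedDCoD (hF : IsFoliatedAtlas p q M) (hg : IsBundleLike g)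
    {χ : FormField p q M (0 + p)} (hχ : IsLeafVolume g χ) (hη : IsBiform g 0 1 η)
    (hv : v + v' = p) {φ : FormField p q M (u + v)} (hφ : IsBiform g u v φ) :
    leafStar g χ u hv (twistedDCoD g η u v φ) =
      twistedCoD g (-η) u v' (twistedD g (-η) u v' (leafStar g χ u hv φ)) := by
  have hSφ := isBiform_leafStar hF hχ.1 hv hφ
  have hQ := isBiform_twistedD hF hη.neg hSφ
  have hadj' := isFormalAdjoint_twistedCoD hF hg hχ hη.neg u v'
  cases v with
  | zero =>
    -- Here v' = p: the left term is absent, and P_{-η} of the starred form has leafwise degree p +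
    -- 1.
    rw [hQ.isBiSection.eq_zero_of_lt (by omega), twistedCoD_zero hF hadj']
    have := leafStar_smul (g := g) (u := u) χ hv 0 0
    rw [zero_smul, zero_smul] at this
    exact this
  | succ w =>
    obtain ⟨e, he, hs⟩ := exists_leafStar_twistedD hF hg hχ hη (v := w) (v' := v') hv (by omega)
    have hP := (isFormalAdjoint_twistedCoD hF hg hχ hη u w).2.1 _ hφ
    change leafStar g χ u hv (twistedD g η u w (twistedCoD g η u w φ)) = _
    rw [(hs u).2 _ hP, (hs u).1 _ hφ, twistedCoD_smul hF hadj' _ hQ]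
    exact (smul_smul e e _).trans (by rw [he, one_smul])

/-- The leafwise star exchanges the two summands of the Laplacian, up to replacing η by -η. -/
theorem leafStar_twistedLaplacian (hF : IsFoliatedAtlas p q M) (hg : IsBundleLike g)
    {χ : FormField p q M (0 + p)} (hχ : IsLeafVolume g χ) (hη : IsBiform g 0 1 η)
    (hv : v + v' = p) {φ : FormField p q M (u + v)} (hφ : IsBiform g u v φ) :
    leafStar g χ u hv (twistedLaplacian g η u v φ) =
      twistedLaplacian g (-η) u v' (leafStar g χ u hv φ) := by
  rw [twistedLaplacian_eq, twistedLaplacian_eq, leafStar_add,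
    leafStar_twistedCoD_twistedD hF hg hχ hη hv hφ, leafStar_twistedDCoD hF hg hχ hη hv hφ]
  exact add_comm _ _

/-- The transverse star preserves each summand: the sign (-1)^q arises once from P_η and once from
P_η^*. -/
theorem perpStar_twistedLaplacian (hF : IsFoliatedAtlas p q M) (hg : IsBundleLike g)
    (hadj : ∀ u v, IsFormalAdjoint g u v (twistedD g η u v) (twistedCoD g η u v))
    {ν : FormField p q M (q + 0)} (hν : IsTransverseVolume g ν) (hη : IsBiform g 0 1 η)
    (hu : u + u' = q) {φ : FormField p q M (u + v)} (hφ : IsBiform g u v φ) :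
    perpStar g ν hu v (twistedLaplacian g η u v φ) =
      twistedLaplacian g η u' v (perpStar g ν hu v φ) := by
  have hsign : (-1 : ℝ) ^ q * (-1) ^ q = 1 := by
    rw [← pow_add, Even.neg_one_pow ⟨q, rfl⟩]
  have hSφ := isBiform_perpStar hF hν.1 hu hφ
  have hPφ := isBiform_twistedD hF hη hφ
  have first : perpStar g ν hu v (twistedCoD g η u v (twistedD g η u v φ)) =
      twistedCoD g η u' v (twistedD g η u' v (perpStar g ν hu v φ)) := by
    rw [perpStar_twistedCoD hF hg hadj hν hη hu hPφ, perpStar_twistedD hF hg hν hη hu hφ,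
      twistedCoD_smul hF (hadj u' v) _ (isBiform_twistedD hF hη hSφ)]
    exact (smul_smul _ _ _).trans (by rw [hsign, one_smul])
  have second : perpStar g ν hu v (twistedDCoD g η u v φ) =
      twistedDCoD g η u' v (perpStar g ν hu v φ) := by
    cases v with
    | zero =>
      have := perpStar_smul (g := g) (v := 0) ν hu 0 0
      rw [zero_smul, zero_smul] at this
      exact this
    | succ v =>
      change perpStar g ν hu (v + 1) (twistedD g η u v (twistedCoD g η u v φ)) = _
      rw [perpStar_twistedD hF hg hν hη hu ((hadj u v).2.1 _ hφ),
        perpStar_twistedCoD hF hg hadj hν hη hu hφ, twistedD_smul hF hη _ ((hadj u' v).2.1 _ hSφ)]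
      exact (smul_smul _ _ _).trans (by rw [hsign, one_smul]; rfl)
  rw [twistedLaplacian_eq, twistedLaplacian_eq, perpStar_add, first, second]

end Laplacian

end FoliatedHodge

end

open FoliatedHodge in
theorem mainTheorem9 {p q : ℕ} {M : Type*} [TopologicalSpace M] [T2Space M] [CompactSpace M]
    [ChartedSpace (Model p q) M] [IsManifold 𝓘(ℝ, Model p q) ∞ M]
    (hF : IsFoliatedAtlas p q M) (g : FoliatedHodge.Metric p q M) (hg : IsBundleLike g)
    (χ : FormField p q M (0 + p)) (hχ : IsLeafVolume g χ)
    (ν : FormField p q M (q + 0)) (hν : IsTransverseVolume g ν)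
    (η : FormField p q M (0 + 1)) (hη : IsBiform g 0 1 η) :
    (∀ u v : ℕ, IsFormalAdjoint g u v (twistedD g η u v) (twistedCoD g η u v)) ∧
    (∀ (u v v' : ℕ) (hv : v + v' = p) (φ : FormField p q M (u + v)), IsBiform g u v φ →
      IsBiform g u v' (leafStar g χ u hv φ) ∧
      leafStar g χ u hv (twistedLaplacian g η u v φ) =
        twistedLaplacian g (-η) u v' (leafStar g χ u hv φ)) ∧
    (∀ (u u' v : ℕ) (hu : u + u' = q) (φ : FormField p q M (u + v)), IsBiform g u v φ →
      IsBiform g u' v (perpStar g ν hu v φ) ∧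
      perpStar g ν hu v (twistedLaplacian g η u v φ) =
        twistedLaplacian g η u' v (perpStar g ν hu v φ)) := by
  have hadj := isFormalAdjoint_twistedCoD hF hg hχ hη
  exact ⟨hadj,
    fun u v v' hv φ hφ => ⟨isBiform_leafStar hF hχ.1 hv hφ,
      leafStar_twistedLaplacian hF hg hχ hη hv hφ⟩,
    fun u u' v hu φ hφ => ⟨isBiform_perpStar hF hν.1 hu hφ,
      perpStar_twistedLaplacian hF hg hadj hν hη hu hφ⟩⟩
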